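/- **Intrinsic Itô formula.** Let $0\le p_0\le d$ be integers, $T_0>0$, $D\subseteq\mathbb R^d$ open and connected, $B$ a real $d\times d$ matrix, and put $Y=\partial_t+\langle Bx,\nabla_x\rangle$ on $\mathbb R\times\mathbb R^d$. *Hörmander condition.* Assume that at every point of $\mathbb R\times\mathbb R^d$ the Lie algebra generated by $\partial_{x_1},\dots,\partial_{x_{p_0}},Y$ has rank $d+1$. *The process.* Let $X=(X_t)_{0\le t<T_0}$ be a continuous $\mathbb R^d$-valued Markov process (for instance a continuous strong Markov process) with transition distribution $p(t,x;T,d\xi)$, i.e. there are a set $\Omega$, $\sigma$-algebras $\mathcal F^t_T$ ($0\le t\le T<T_0$) with $\mathcal F^t_T\subseteq\mathcal F^{t'}_{T'}$ for $t'\le t\le T\le T'$, and probability measures $P_{t,x}$ on $\mathcal F^t_{T_0}:=\sigma(\bigcup_{t\le T<T_0}\mathcal F^t_T)$ such that: $p(t,x;T,\cdot)$ ($0\le t<T<T_0$) are probability measures on $\mathbb R^d$, Borel measurable in $x$, satisfying the Chapman–Kolmogorov identity; $X_T$ is $\mathcal F^t_T$-measurable for $t\le T$; all trajectories are continuous; $P_{t,x}(X_t=x)=1$;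 and $P_{t,x}(X_T\in A\mid\mathcal F^t_s)=p(s,X_s;T,A)$ $P_{t,x}$-a.s. for $t\le s<T<T_0$ and Borel $A$. *Local diffusion.* Let $a_{ij},a_i$ ($1\le i,j\le p_0$) be real Borel functions on $[0,T_0[\times D$, bounded on compact subsets of $[0,T_0[\times D$. For a quantity $g(t,T)$, $\lim_{T-t\to0^+}g(t,T)=\ell$ means that $g(t,t+h)\to\ell$ and, if $t>0$, $g(t-h,t)\to\ell$ as $h\to0^+$. Assume that $X$ is a local diffusion generated on $D$ by $\mathcal A_t=\frac12\sum_{i,j\le p_0}a_{ij}\partial_{x_ix_j}+\sum_{i\le p_0}a_i\partial_{x_i}+\langle Bx,\nabla_x\rangle$, that is, for all $t\in[0,T_0[$, $\delta>0$ and compact $H\subset D$: $$\lim_{T-t\to0^+}\frac{p(t,x;T,\{|\xi-x|>\delta\}\cap H)}{T-t}=0\ \text{ uniformly in }x\in\mathbb R^d,\qquad \lim_{T-t\to0^+}\frac{p(t,x;T,\{|\xi-x|>\delta\})}{T-t}=0\ \text{ uniformly in }x\in H,$$ and, for $i,j=1,\dots,d$ and uniformly in $x\in H$, $$\lim_{T-t\to0^+}\int_{|\xi-x|<\delta}(\xi-x)_i\frac{p(t,x;T,d\xi)}{T-t}=\mathbf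 1_{i\le p_0}a_i(t,x)+(Bx)_i,\qquad \lim_{T-t\to0^+}\int_{|\xi-x|<\delta}(\xi-x)_i(\xi-x)_j\frac{p(t,x;T,d\xi)}{T-t}=\mathbf 1_{i,j\le p_0}a_{ij}(t,x).$$ *Intrinsic Hölder spaces.* For $z=(t,x)$ put $e^{\delta\partial_{x_i}}z=(t,x+\delta e_i)$ ($i\le p_0$) and $e^{\delta Y}z=(t+\delta,e^{\delta B}x)$, and let $\partial_{x_i}f(z)$, $Yf(z)$ be the derivatives of $\delta\mapsto f(e^{\delta\partial_{x_i}}z)$, $\delta\mapsto f(e^{\delta Y}z)$ at $\delta=0$. For $Q$ open and $V\Subset Q$ let $\delta_V=\inf_{z\in V}\delta_z$, where $\delta_z$ is the supremum of the $\bar\delta\in\,]0,1]$ such that all these curves through $z$ stay in $Q$ for $|\delta|\le\bar\delta$. Write $f\in C^{\beta}_{\partial_{x_i}}(Q)$ (resp. $f\in C^{\beta}_Y(Q)$) if for every $V\Subset Q$ the supremum over $z\in V$, $0<|\delta|<\delta_V$ of $|f(e^{\delta\partial_{x_i}}z)-f(z)|/|\delta|^{\beta}$ (resp. $|f(e^{\delta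 Y}z)-f(z)|/|\delta|^{\beta/2}$) is finite. Then $C^{0,\alpha}_B(Q)=C^\alpha_Y(Q)\cap\bigcap_{i\le p_0}C^\alpha_{\partial_{x_i}}(Q)$; $f\in C^{1,\alpha}_B(Q)$ if $f\in C^{1+\alpha}_Y(Q)$ and, for all $i\le p_0$, $\partial_{x_i}f$ exists on $Q$ and is in $C^{0,\alpha}_B(Q)$; $f\in C^{2,\alpha}_B(Q)$ if $Yf$ exists on $Q$ and is in $C^{0,\alpha}_B(Q)$ and, for all $i\le p_0$, $\partial_{x_i}f$ exists on $Q$ and is in $C^{1,\alpha}_B(Q)$. *Conclusion.* Let $(t,x)\in\,]0,T_0[\times\mathbb R^d$, $\alpha\in\,]0,1]$, and let $f\in C^{2,\alpha}_B(]0,T_0[\times D)$ have compact support in $]0,T_0[\times D$ (and be extended by zero). With $\mathcal Lf=\frac12\sum_{i,j\le p_0}a_{ij}\partial_{x_ix_j}f+\sum_{i\le p_0}a_i\partial_{x_i}f+Yf$ (which vanishes off the support of $f$), the process $$M^t_T:=f(T,X_T)-f(t,X_t)-\int_t^T\mathcal Lf(u,X_u)\,du,\qquad t\le T<T_0,$$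 is well defined and is a zero-mean martingale with respect to $(\mathcal F^t_T)_{t\le T<T_0}$ under $P_{t,x}$. Moreover, it is square integrable and, for $t\le T<T_0$, $$E_{t,x}\big[|M^t_T|^2\big]=E_{t,x}\Big[\int_t^T\sum_{i,j=1}^{p_0}a_{ij}(s,X_s)\,\partial_{x_i}f(s,X_s)\,\partial_{x_j}f(s,X_s)\,ds\Big],$$ where both sides are finite. -/

import Mathlib

open MeasureTheory ProbabilityTheory Filter Topology Set
open scoped ENNReal

noncomputable section

/-- `ℝ^d` with the Euclidean norm. -/
abbrev Euc (d : ℕ) : Type := EuclideanSpace ℝ (Fin d)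

/-- The linear operator `x ↦ B x` on `ℝ^d`. -/
def matOp {d : ℕ} (B : Matrix (Fin d) (Fin d) ℝ) : Euc d →L[ℝ] Euc d :=
  Matrix.toEuclideanCLM (n := Fin d) (𝕜 := ℝ) B

/-- The `i`-th canonical basis vector of `ℝ^d`, for `i` among the first `p₀` indices. -/
def basisVec {p₀ d : ℕ} (hp : p₀ ≤ d) (i : Fin p₀) : Euc d :=
  EuclideanSpace.single (Fin.castLE hp i) (1 : ℝ)

/-! ### The Hörmander condition -/

/-- The real Lie algebra of vector fields generated by the family `S`: the smallest real vector
space of vector fields that contains `S` and is closed under Lie brackets. -/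
inductive LieGenerated {V : Type*} [NormedAddCommGroup V] [NormedSpace ℝ V] (S : Set (V → V)) :
    (V → V) → Prop
  | of (v : V → V) (hv : v ∈ S) : LieGenerated S v
  | zero : LieGenerated S 0
  | add (v w : V → V) (hv : LieGenerated S v) (hw : LieGenerated S w) : LieGenerated S (v + w)
  | smul (c : ℝ) (v : V → V) (hv : LieGenerated S v) : LieGenerated S (c • v)
  | bracket (v w : V → V) (hv : LieGenerated S v) (hw : LieGenerated S w) :
      LieGenerated S (VectorField.lieBracket ℝ v w)

/-- The vector field `∂_{x_i}` on `ℝ × ℝ^d`. -/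
def fieldDx {p₀ d : ℕ} (hp : p₀ ≤ d) (i : Fin p₀) : ℝ × Euc d → ℝ × Euc d :=
  fun _ => (0, basisVec hp i)

/-- The vector field `Y = ∂_t + ⟨Bx, ∇_x⟩` on `ℝ × ℝ^d`. -/
def fieldY {d : ℕ} (B : Matrix (Fin d) (Fin d) ℝ) : ℝ × Euc d → ℝ × Euc d :=
  fun z => (1, matOp B z.2)

/-- Hörmander's condition for `∂_{x_1}, …, ∂_{x_{p₀}}, Y`: at every point of `ℝ × ℝ^d` the Lie
algebra they generate has full rank `d + 1`. -/
def HormanderCondition {p₀ d : ℕ} (hp : p₀ ≤ d) (B : Matrix (Fin d) (Fin d) ℝ) : Prop :=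
  ∀ z : ℝ × Euc d,
    Module.finrank ℝ (Submodule.span ℝ
      ((fun v : ℝ × Euc d → ℝ × Euc d => v z) ''
        {v | LieGenerated (Set.range (fieldDx hp) ∪ {fieldY B}) v})) = d + 1

/-! ### Intrinsic Hölder spaces -/

/-- The integral curve `δ ↦ (t, x + δ e_i)` of `∂_{x_i}`. -/
def flowDx {p₀ d : ℕ} (hp : p₀ ≤ d) (i : Fin p₀) (δ : ℝ) (z : ℝ × Euc d) : ℝ × Euc d :=
  (z.1, z.2 + δ • basisVec hp i)

/-- The integral curve `δ ↦ (t + δ, e^{δB} x)` of `Y`. -/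
def flowY {d : ℕ} (B : Matrix (Fin d) (Fin d) ℝ) (δ : ℝ) (z : ℝ × Euc d) : ℝ × Euc d :=
  (z.1 + δ, NormedSpace.exp (δ • matOp B) z.2)

/-- The radius `δ_z ∈ ]0,1]` up to which all the integral curves through `z` remain in `Q`. -/
def radiusAt {p₀ d : ℕ} (hp : p₀ ≤ d) (B : Matrix (Fin d) (Fin d) ℝ) (Q : Set (ℝ × Euc d))
    (z : ℝ × Euc d) : ℝ :=
  sSup {r : ℝ | r ∈ Ioc (0 : ℝ) 1 ∧
    ∀ δ ∈ Icc (-r) r, (∀ i : Fin p₀, flowDx hp i δ z ∈ Q) ∧ flowY B δ z ∈ Q}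

/-- `δ_V = inf_{z ∈ V} δ_z`. -/
def radiusOn {p₀ d : ℕ} (hp : p₀ ≤ d) (B : Matrix (Fin d) (Fin d) ℝ) (Q V : Set (ℝ × Euc d)) : ℝ :=
  sInf (radiusAt hp B Q '' V)

/-- For each `V ⋐ Q`, the difference quotients of order `β` of `f` along the flow `φ` are bounded
over base points in `V` and increments `0 < |δ| < δ_V`. -/
def HolderAlong {p₀ d : ℕ} (hp : p₀ ≤ d) (B : Matrix (Fin d) (Fin d) ℝ) (Q : Set (ℝ × Euc d))
    (φ : ℝ → ℝ × Euc d → ℝ × Euc d) (β : ℝ) (f : ℝ × Euc d → ℝ) : Prop :=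
  ∀ V : Set (ℝ × Euc d), IsCompact (closure V) → closure V ⊆ Q →
    ∃ C : ℝ, ∀ z ∈ V, ∀ δ : ℝ, 0 < |δ| → |δ| < radiusOn hp B Q V →
      |f (φ δ z) - f z| / |δ| ^ β ≤ C

/-- `f ∈ C^α_{∂_{x_i}}(Q)`. -/
def HolderDx {p₀ d : ℕ} (hp : p₀ ≤ d) (B : Matrix (Fin d) (Fin d) ℝ) (Q : Set (ℝ × Euc d))
    (i : Fin p₀) (α : ℝ) (f : ℝ × Euc d → ℝ) : Prop :=
  HolderAlong hp B Q (flowDx hp i) α f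

/-- `f ∈ C^α_Y(Q)`: the exponent of the increment is `α / 2`. -/
def HolderY {p₀ d : ℕ} (hp : p₀ ≤ d) (B : Matrix (Fin d) (Fin d) ℝ) (Q : Set (ℝ × Euc d))
    (α : ℝ) (f : ℝ × Euc d → ℝ) : Prop :=
  HolderAlong hp B Q (flowY B) (α / 2) f

/-- The derivative `∂_{x_i} f`. -/
def derivDx {p₀ d : ℕ} (hp : p₀ ≤ d) (i : Fin p₀) (f : ℝ × Euc d → ℝ) : ℝ × Euc d → ℝ :=
  fun z => deriv (fun δ : ℝ => f (flowDx hp i δ z)) 0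

/-- The Lie derivative `Y f`. -/
def derivY {d : ℕ} (B : Matrix (Fin d) (Fin d) ℝ) (f : ℝ × Euc d → ℝ) : ℝ × Euc d → ℝ :=
  fun z => deriv (fun δ : ℝ => f (flowY B δ z)) 0

/-- `∂_{x_i} f` exists at every point of `Q`. -/
def HasDx {p₀ d : ℕ} (hp : p₀ ≤ d) (Q : Set (ℝ × Euc d)) (i : Fin p₀) (f : ℝ × Euc d → ℝ) : Prop :=
  ∀ z ∈ Q, DifferentiableAt ℝ (fun δ : ℝ => f (flowDx hp i δ z)) 0

/-- `Y f` exists at every point of `Q`. -/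
def HasY {d : ℕ} (B : Matrix (Fin d) (Fin d) ℝ) (Q : Set (ℝ × Euc d)) (f : ℝ × Euc d → ℝ) : Prop :=
  ∀ z ∈ Q, DifferentiableAt ℝ (fun δ : ℝ => f (flowY B δ z)) 0

/-- The intrinsic Hölder space `C^{n,α}_B(Q)`. -/
def IntrinsicHolder {p₀ d : ℕ} (hp : p₀ ≤ d) (B : Matrix (Fin d) (Fin d) ℝ) (Q : Set (ℝ × Euc d))
    (α : ℝ) : ℕ → (ℝ × Euc d → ℝ) → Prop
  | 0, f => HolderY hp B Q α f ∧ ∀ i : Fin p₀, HolderDx hp B Q i α f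
  | 1, f => HolderY hp B Q (1 + α) f ∧
      ∀ i : Fin p₀, HasDx hp Q i f ∧ IntrinsicHolder hp B Q α 0 (derivDx hp i f)
  | n + 2, f => (HasY B Q f ∧ IntrinsicHolder hp B Q α n (derivY B f)) ∧
      ∀ i : Fin p₀, HasDx hp Q i f ∧ IntrinsicHolder hp B Q α (n + 1) (derivDx hp i f)

/-! ### The operator -/

/-- `𝓛 f = ½ ∑ a_{ij} ∂_{x_i x_j} f + ∑ a_i ∂_{x_i} f + Y f`; here `b i` is the first order
coefficient `a_i`. -/
def opL {p₀ d : ℕ} (hp : p₀ ≤ d) (B : Matrix (Fin d) (Fin d) ℝ)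
    (a : Fin p₀ → Fin p₀ → ℝ × Euc d → ℝ) (b : Fin p₀ → ℝ × Euc d → ℝ)
    (f : ℝ × Euc d → ℝ) (z : ℝ × Euc d) : ℝ :=
  (1 / 2 : ℝ) * ∑ i, ∑ j, a i j z * derivDx hp i (derivDx hp j f) z
    + ∑ i, b i z * derivDx hp i f z + derivY B f z

/-- `∑ a_{ij} ∂_{x_i} f ∂_{x_j} f`. -/
def energyDensity {p₀ d : ℕ} (hp : p₀ ≤ d) (a : Fin p₀ → Fin p₀ → ℝ × Euc d → ℝ)
    (f : ℝ × Euc d → ℝ) (z : ℝ × Euc d) : ℝ :=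
  ∑ i, ∑ j, a i j z * derivDx hp i f z * derivDx hp j f z

/-! ### Continuous Markov processes and local diffusions -/

/-- `𝓕^t_{T₀}`, the σ-algebra generated by all the `𝓕^t_T`, `t ≤ T < T₀`. -/
abbrev sigmaFrom {Ω : Type*} (F : ℝ → ℝ → MeasurableSpace Ω) (T₀ t : ℝ) : MeasurableSpace Ω :=
  ⨆ T ∈ Ico t T₀, F t T

/-- An `ℝ^d`-valued Markov process `(X_t)_{0 ≤ t < T₀}` with continuous trajectories and transition
distribution `p(t,x;T,·) = p t T x`, on a space `(Ω, (𝓕^t_T), (P_{t,x}))`. The measure `P_{t,x}` is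
defined on `𝓕^t_{T₀}`. Only indices with `0 ≤ t ≤ T < T₀` are meaningful. -/
structure ContMarkovProcess (d : ℕ) (T₀ : ℝ) (Ω : Type*) where
  /-- transition distribution -/
  p : ℝ → ℝ → Kernel (Euc d) (Euc d)
  /-- the σ-algebras `𝓕^t_T` -/
  F : ℝ → ℝ → MeasurableSpace Ω
  /-- the probability measures `P_{t,x}` -/
  P : (t : ℝ) → Euc d → @Measure Ω (sigmaFrom F T₀ t)
  /-- the process -/
  X : ℝ → Ω → Euc d
  isMarkovKernel : ∀ t T, 0 ≤ t → t < T → T < T₀ → IsMarkovKernel (p t T)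
  chapmanKolmogorov : ∀ t s T, 0 ≤ t → t < s → s < T → T < T₀ →
    ∀ (x : Euc d) (A : Set (Euc d)), MeasurableSet A →
      p t T x A = ∫⁻ ξ, p s T ξ A ∂(p t s x)
  mono : ∀ t' t T T', 0 ≤ t' → t' ≤ t → t ≤ T → T ≤ T' → T' < T₀ → F t T ≤ F t' T'
  adapted : ∀ t T, 0 ≤ t → t ≤ T → T < T₀ → Measurable[F t T] (X T)
  isProbability : ∀ t x, 0 ≤ t → t < T₀ → IsProbabilityMeasure (P t x)
  initial : ∀ t x, 0 ≤ t → t < T₀ → P t x {ω | X t ω = x} = 1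
  markov : ∀ t x s T, 0 ≤ t → t ≤ s → s < T → T < T₀ →
    ∀ A : Set (Euc d), MeasurableSet A →
      (P t x)⟦X T ⁻¹' A | F t s⟧ =ᵐ[P t x] fun ω => (p s T (X s ω)).real A
  continuous_paths : ∀ ω, ContinuousOn (fun t => X t ω) (Ico 0 T₀)

/-- The filtration `𝓕^t = (𝓕^t_T)_{t ≤ T < T₀}`. -/
def ContMarkovProcess.filtration {d : ℕ} {T₀ : ℝ} {Ω : Type*} (M : ContMarkovProcess d T₀ Ω)
    (t : ℝ) (ht : 0 ≤ t) : Filtration (Ico t T₀) (sigmaFrom M.F T₀ t) where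
  seq T := M.F t T
  mono' T T' h := M.mono t t T T' ht le_rfl T.2.1 h T'.2.2
  le' T := le_iSup₂_of_le (f := fun T (_ : T ∈ Ico t T₀) => M.F t T) T.1 T.2 le_rfl

/-- `lim_{T-t → 0⁺} φ(t,T,x) = g(x)` uniformly w.r.t. `x ∈ S`: both `φ(t,t+h,x)` and (if `t > 0`)
`φ(t-h,t,x)` converge to `g(x)` as `h → 0⁺`, uniformly w.r.t. `x ∈ S`. -/
def UnifLimAt {d : ℕ} (φ : ℝ → ℝ → Euc d → ℝ) (g : Euc d → ℝ) (t : ℝ) (S : Set (Euc d)) : Prop :=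
  TendstoUniformlyOn (fun (h : ℝ) x => φ t (t + h) x) g (𝓝[>] 0) S ∧
  (0 < t → TendstoUniformlyOn (fun (h : ℝ) x => φ (t - h) t x) g (𝓝[>] 0) S)

/-- A Borel function on `[0,T₀[ × D` that is bounded on compact subsets of `[0,T₀[ × D`. -/
def LocBounded {d : ℕ} (T₀ : ℝ) (D : Set (Euc d)) (c : ℝ × Euc d → ℝ) : Prop :=
  Measurable ((Ico 0 T₀ ×ˢ D).domRestrict c) ∧
  ∀ K : Set (ℝ × Euc d), IsCompact K → K ⊆ Ico 0 T₀ ×ˢ D → ∃ C : ℝ, ∀ z ∈ K, |c z| ≤ C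

/-- `M` is a local diffusion generated on `D` by
`𝓐_t = ½ ∑ a_{ij} ∂_{x_i x_j} + ∑ b_i ∂_{x_i} + ⟨Bx, ∇_x⟩`. -/
structure IsLocalDiffusion {p₀ d : ℕ} (hp : p₀ ≤ d) {T₀ : ℝ} {Ω : Type*}
    (M : ContMarkovProcess d T₀ Ω) (D : Set (Euc d)) (B : Matrix (Fin d) (Fin d) ℝ)
    (a : Fin p₀ → Fin p₀ → ℝ × Euc d → ℝ) (b : Fin p₀ → ℝ × Euc d → ℝ) : Prop where
  locBounded_a : ∀ i j, LocBounded T₀ D (a i j)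
  locBounded_b : ∀ i, LocBounded T₀ D (b i)
  lim_jump_into : ∀ t, 0 ≤ t → t < T₀ → ∀ δ : ℝ, 0 < δ → ∀ H : Set (Euc d), IsCompact H → H ⊆ D →
    UnifLimAt (fun t T x => (M.p t T x).real ({ξ | δ < ‖ξ - x‖} ∩ H) / (T - t))
      (fun _ => 0) t univ
  lim_jump_from : ∀ t, 0 ≤ t → t < T₀ → ∀ δ : ℝ, 0 < δ → ∀ H : Set (Euc d), IsCompact H → H ⊆ D →
    UnifLimAt (fun t T x => (M.p t T x).real {ξ | δ < ‖ξ - x‖} / (T - t))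
      (fun _ => 0) t H
  lim_drift : ∀ t, 0 ≤ t → t < T₀ → ∀ δ : ℝ, 0 < δ → ∀ H : Set (Euc d), IsCompact H → H ⊆ D →
    ∀ i : Fin d,
    UnifLimAt (fun t T x => (∫ ξ in {ξ | ‖ξ - x‖ < δ}, (ξ - x) i ∂(M.p t T x)) / (T - t))
      (fun x => (if h : (i : ℕ) < p₀ then b ⟨i, h⟩ (t, x) else 0) + matOp B x i) t H
  lim_diffusion : ∀ t, 0 ≤ t → t < T₀ → ∀ δ : ℝ, 0 < δ → ∀ H : Set (Euc d), IsCompact H → H ⊆ D →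
    ∀ i j : Fin d,
    UnifLimAt
      (fun t T x => (∫ ξ in {ξ | ‖ξ - x‖ < δ}, (ξ - x) i * (ξ - x) j ∂(M.p t T x)) / (T - t))
      (fun x => if h : (i : ℕ) < p₀ ∧ (j : ℕ) < p₀ then a ⟨i, h.1⟩ ⟨j, h.2⟩ (t, x) else 0) t H

/-- `M^t_T = f(T,X_T) - f(t,X_t) - ∫_t^T 𝓛f(u,X_u) du`. -/
def itoRemainder {p₀ d : ℕ} (hp : p₀ ≤ d) {T₀ : ℝ} {Ω : Type*} (M : ContMarkovProcess d T₀ Ω)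
    (B : Matrix (Fin d) (Fin d) ℝ) (a : Fin p₀ → Fin p₀ → ℝ × Euc d → ℝ)
    (b : Fin p₀ → ℝ × Euc d → ℝ) (f : ℝ × Euc d → ℝ) (t T : ℝ) (ω : Ω) : ℝ :=
  f (T, M.X T ω) - f (t, M.X t ω) - ∫ u in t..T, opL hp B a b f (u, M.X u ω)

end

/-! ### The flows -/

/-! The classical Itô formula for functions of class C^{1,2} does not apply: `f` need not have a
time derivative, nor derivatives in the directions x_i with i > p₀, and the process is known only
through the short-time behaviour of its transition kernels. Everything is derived instead from a
weak Dynkin formula, E[W (f(T,X_T) - f(r,X_r))] = E[W ∫_r^T 𝓛f(u,X_u) du] for every bounded `W`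
measurable with respect to the past at time r (`IsMarkovUnder.dynkin`). Taking for `W` the
indicators of past events gives the martingale property.

Regularity. Hörmander's condition makes the vectors e^{δB} e_i, with i ≤ p₀ and small δ, span ℝ^d.
Since e^{δY} e^{c∂_i} e^{-δY} translates x by c e^{δB} e_i, moderate motions along the given fields
produce small displacements in every direction, and uniform continuity along the fields becomes
continuity (`continuous_of_unifContAlong`). Hence `f`, ∂_i f, ∂_i∂_j f and Yf are continuous with
compact support (`IntrinsicHolder.intrinsicC2`); besides the support, this is all that is used of
`f`.

Dynkin for functions smooth in x. The increment of `f` from (r, X_r) to (r+δ, X_{r+δ}) is split at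
the points (r, e^{-δB} X_{r+δ}) and (r, X_{r+δ}). Divided by δ, the three pieces produce Yf, -⟨Bx,
∇f⟩ and the spatial generator, the last by the Markov property and the uniform generator limit
`eventually_generator`. The drift terms in B cancel and 𝓛f remains. So s ↦ E[W f(s,X_s)] is
continuous with a bounded right derivative at every interior point, which suffices for the
fundamental theorem of calculus although the coefficients are only Borel.

General `f`. Averaging over the shifts x ↦ x - e^{tB} y gives functions smooth in x. These shifts
commute with the flows of all the fields, so the mollified derivatives are the derivatives of the
mollification; 𝓛 applied to it converges boundedly and pointwise to 𝓛f, and Dynkin's formula passes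
to the limit.

Second moment. No quadratic variation is needed: f² belongs to the same class and 𝓛f² = 2f𝓛f + Γ,
with Γ the energy density. Expanding the square of the martingale leaves the terms E[f(T,X_T) ∫𝓛f]
and E[(∫𝓛f)²]. The second is twice an integral over u < v, to which Dynkin's formula applies with
weight 𝓛f(u,X_u); after that everything but E[∫Γ] cancels
(`IsDynkinPair.integral_sq_dynkinRemainder`). -/

theorem exp_add_smul {E : Type*} [NormedAddCommGroup E] [NormedSpace ℝ E] [CompleteSpace E]
    (A : E →L[ℝ] E) (δ η : ℝ) :
    NormedSpace.exp ((δ + η) • A) = NormedSpace.exp (δ • A) * NormedSpace.exp (η • A) := by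
  -- The addition rule for the exponential is used over a normed `ℚ`-algebra; that structure comes
  -- from restriction of scalars.
  let _ : NormedAlgebra ℚ (E →L[ℝ] E) := NormedAlgebra.restrictScalars ℚ ℝ _
  rw [add_smul, NormedSpace.exp_add_of_commute]
  exact ((Commute.refl A).smul_left δ).smul_right η

section Flows

variable {p₀ d : ℕ} (hp : p₀ ≤ d) (B : Matrix (Fin d) (Fin d) ℝ)

/-- The one-parameter group `e^{δB}`. -/
noncomputable def expB (δ : ℝ) : Euc d →L[ℝ] Euc d := NormedSpace.exp (δ • matOp B)

@[simp] theorem expB_zero : expB B 0 = 1 := by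
  have : (0 : ℝ) • matOp B = 0 := zero_smul ℝ (matOp B)
  rw [expB, this, NormedSpace.exp_zero]

theorem expB_add (δ η : ℝ) : expB B (δ + η) = expB B δ * expB B η :=
  exp_add_smul (matOp B) δ η

theorem expB_add_apply (δ η : ℝ) (x : Euc d) : expB B (δ + η) x = expB B δ (expB B η x) := by
  rw [expB_add]; rfl

@[simp] theorem expB_apply_neg (δ : ℝ) (x : Euc d) : expB B δ (expB B (-δ) x) = x := by
  rw [← expB_add_apply]; simp

theorem hasDerivAt_expB (δ : ℝ) : HasDerivAt (expB B) (matOp B * expB B δ) δ :=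
  hasDerivAt_exp_smul_const' (𝕂 := ℝ) (matOp B) δ

@[fun_prop]
theorem continuous_expB : Continuous (expB B) :=
  continuous_iff_continuousAt.2 fun δ => (hasDerivAt_expB B δ).continuousAt

theorem flowY_eq (δ : ℝ) (z : ℝ × Euc d) : flowY B δ z = (z.1 + δ, expB B δ z.2) := rfl

@[simp] theorem flowY_zero (z : ℝ × Euc d) : flowY B 0 z = z := by simp [flowY_eq]

theorem flowY_add (δ η : ℝ) (z : ℝ × Euc d) : flowY B (δ + η) z = flowY B δ (flowY B η z) := by
  simp only [flowY_eq, expB_add_apply, Prod.mk.injEq, and_true]; ring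

@[simp] theorem flowDx_zero (i : Fin p₀) (z : ℝ × Euc d) : flowDx hp i 0 z = z := by simp [flowDx]

theorem flowDx_add (i : Fin p₀) (δ η : ℝ) (z : ℝ × Euc d) :
    flowDx hp i (δ + η) z = flowDx hp i δ (flowDx hp i η z) := by
  simp only [flowDx, Prod.mk.injEq, true_and, add_smul]; abel

theorem continuous_flowY : Continuous fun q : ℝ × (ℝ × Euc d) => flowY B q.1 q.2 := by
  simp only [flowY_eq]
  fun_prop

theorem continuous_flowDx (i : Fin p₀) :
    Continuous fun q : ℝ × (ℝ × Euc d) => flowDx hp i q.1 q.2 := by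
  unfold flowDx; fun_prop

/-- A jointly continuous one-parameter group of transformations. -/
structure IsFlow {Z : Type*} [TopologicalSpace Z] (φ : ℝ → Z → Z) : Prop where
  cont : Continuous fun q : ℝ × Z => φ q.1 q.2
  zero : ∀ z, φ 0 z = z
  add : ∀ δ η z, φ (δ + η) z = φ δ (φ η z)

theorem isFlow_flowY : IsFlow (flowY B) :=
  ⟨continuous_flowY B, flowY_zero B, flowY_add B⟩

theorem isFlow_flowDx (i : Fin p₀) : IsFlow (flowDx (d := d) hp i) :=
  ⟨continuous_flowDx hp i, flowDx_zero hp i, flowDx_add hp i⟩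

end Flows

/-! ### Differentiation and uniform continuity along a flow -/

section DerivAlong

variable {Z : Type*} [TopologicalSpace Z] {φ : ℝ → Z → Z}

theorem IsFlow.neg_apply (hφ : IsFlow φ) (δ : ℝ) (z : Z) : φ (-δ) (φ δ z) = z := by
  rw [← hφ.add, neg_add_cancel, hφ.zero]

/-- `f` is differentiable along the flow `φ` at every point, with derivative `g`. -/
def HasDerivAlong (φ : ℝ → Z → Z) (f g : Z → ℝ) : Prop :=
  ∀ z, HasDerivAt (fun δ => f (φ δ z)) (g z) 0

/-- The group law identifies the curve through `z` near parameter `δ` with the curve through `φ δ z`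
near parameter 0. -/
theorem HasDerivAlong.hasDerivAt (hφ : IsFlow φ) {f g : Z → ℝ} (h : HasDerivAlong φ f g) (z : Z)
    (δ : ℝ) : HasDerivAt (fun η => f (φ η z)) (g (φ δ z)) δ := by
  have h1 := h (φ δ z)
  have h2 : HasDerivAt (fun η : ℝ => η - δ) 1 δ := (hasDerivAt_id δ).sub_const δ
  have h3 : HasDerivAt (fun η => f (φ η (φ δ z))) (g (φ δ z)) (δ - δ) := by simpa using h1
  have h4 := HasDerivAt.comp (h₂ := fun η => f (φ η (φ δ z))) (h := fun η => η - δ) δ h3 h2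
  rw [mul_one] at h4
  refine h4.congr_of_eventuallyEq (Eventually.of_forall fun η => ?_)
  simp only [Function.comp]
  rw [← hφ.add]; simp

theorem HasDerivAlong.abs_sub_le (hφ : IsFlow φ) {f g : Z → ℝ} (h : HasDerivAlong φ f g) {C : ℝ}
    (hC : ∀ z, |g z| ≤ C) (δ : ℝ) (z : Z) : |f (φ δ z) - f z| ≤ C * |δ| := by
  have := Convex.norm_image_sub_le_of_norm_hasDerivWithin_le (s := univ)
    (f := fun η => f (φ η z)) (f' := fun η => g (φ η z)) (C := C) (x := 0) (y := δ)
    (fun η _ => (h.hasDerivAt hφ z η).hasDerivWithinAt) (fun η _ => hC _) convex_univ trivial trivial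
  simpa [hφ.zero] using this

/-- The increments of `g` along the flow `φ` tend to `0` uniformly in the base point. -/
def UnifContAlong (φ : ℝ → Z → Z) (g : Z → ℝ) : Prop :=
  ∀ η > 0, ∃ ρ > 0, ∀ δ, |δ| < ρ → ∀ z, |g (φ δ z) - g z| ≤ η

theorem HasDerivAlong.unifContAlong (hφ : IsFlow φ) {f g : Z → ℝ} (h : HasDerivAlong φ f g) {C : ℝ}
    (hC : ∀ z, |g z| ≤ C) : UnifContAlong φ f := by
  intro η hη
  have hC' : 0 < |C| + 1 := by positivity
  refine ⟨η / (|C| + 1), by positivity, fun δ hδ z => (h.abs_sub_le hφ hC δ z).trans ?_⟩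
  rw [lt_div_iff₀ hC'] at hδ
  nlinarith [abs_nonneg δ, le_abs_self C]

/-- A Hölder bound at the points of a set off which the function vanishes is a global one. -/
theorem unifContAlong_of_holder (hφ : IsFlow φ) {g : Z → ℝ} {K : Set Z} (hg : ∀ z ∉ K, g z = 0)
    {C β r : ℝ} (hβ : 0 < β) (hr : 0 < r)
    (h : ∀ z ∈ K, ∀ δ : ℝ, 0 < |δ| → |δ| < r → |g (φ δ z) - g z| / |δ| ^ β ≤ C) :
    UnifContAlong φ g := by
  have key : ∀ δ : ℝ, |δ| < r → ∀ z, |g (φ δ z) - g z| ≤ |C| * |δ| ^ β := by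
    have key1 : ∀ δ : ℝ, |δ| < r → ∀ z ∈ K, |g (φ δ z) - g z| ≤ |C| * |δ| ^ β := by
      intro δ hδ z hz
      rcases eq_or_ne δ 0 with rfl | h0
      · simp [hφ.zero, Real.zero_rpow hβ.ne']
      have hp : 0 < |δ| := abs_pos.2 h0
      have := h z hz δ hp hδ
      rw [div_le_iff₀ (Real.rpow_pos_of_pos hp β)] at this
      exact this.trans (by gcongr; exact le_abs_self C)
    intro δ hδ z
    by_cases hz : z ∈ K
    · exact key1 δ hδ z hz
    -- The base point lies outside `K`. If the endpoint lies inside, the bound is read off by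
    -- running the flow backwards from it; otherwise both values vanish.
    by_cases hz' : φ δ z ∈ K
    · have := key1 (-δ) (by simpa using hδ) _ hz'
      rwa [hφ.neg_apply, abs_neg, abs_sub_comm] at this
    · rw [hg _ hz, hg _ hz']; simp; positivity
  intro η hη
  have hlim : Tendsto (fun δ : ℝ => |C| * |δ| ^ β) (𝓝 0) (𝓝 0) := by
    have : ContinuousAt (fun δ : ℝ => |C| * |δ| ^ β) 0 := by
      refine ContinuousAt.mul continuousAt_const ?_
      exact ContinuousAt.rpow_const continuous_abs.continuousAt (Or.inr hβ.le)
    simpa [ContinuousAt, Real.zero_rpow hβ.ne'] using this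
  obtain ⟨ρ, hρ, hρ'⟩ := Metric.eventually_nhds_iff.1 (hlim.eventually (ge_mem_nhds hη))
  refine ⟨min ρ r, lt_min hρ hr, fun δ hδ z => ?_⟩
  refine (key δ (hδ.trans_le (min_le_right _ _)) z).trans (hρ' ?_)
  simpa using hδ.trans_le (min_le_left _ _)

end DerivAlong

/-! ### Hörmander's condition and controllability -/

section Kalman

variable {p₀ d : ℕ} (hp : p₀ ≤ d) (B : Matrix (Fin d) (Fin d) ℝ)

/-- The span of the vectors `B^k e_i`, `i ≤ p₀`. -/
def kalmanSpace : Submodule ℝ (Euc d) :=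
  Submodule.span ℝ {v | ∃ (k : ℕ) (i : Fin p₀), v = (matOp B ^ k) (basisVec hp i)}

theorem matOp_mem_kalmanSpace {w : Euc d} (hw : w ∈ kalmanSpace hp B) :
    matOp B w ∈ kalmanSpace hp B := by
  unfold kalmanSpace at hw
  induction hw using Submodule.span_induction with
  | mem v hv =>
    obtain ⟨k, i, rfl⟩ := hv
    exact Submodule.subset_span ⟨k + 1, i, by rw [pow_succ']; rfl⟩
  | zero => simp
  | add u v _ _ hu hv => rw [map_add]; exact add_mem hu hv
  | smul c v _ hv => rw [map_smul]; exact Submodule.smul_mem _ _ hv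

/-- Fields of the form (c, cBx + w), with w in the Kalman space, are stable under brackets: the
terms quadratic in B cancel, leaving the constant field (0, c'Bw - cBw'), and the Kalman space is
B-invariant. -/
theorem LieGenerated.eq_affine {v : ℝ × Euc d → ℝ × Euc d}
    (h : LieGenerated (Set.range (fieldDx hp) ∪ {fieldY B}) v) :
    ∃ (c : ℝ), ∃ w ∈ kalmanSpace hp B, v = fun z => (c, c • matOp B z.2 + w) := by
  have hfd : ∀ (c : ℝ) (w : Euc d) (z u : ℝ × Euc d),
      fderiv ℝ (fun z : ℝ × Euc d => (c, c • matOp B z.2 + w)) z u = (0, c • matOp B u.2) := by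
    intro c w z u
    have h1 : HasFDerivAt (fun z : ℝ × Euc d => c • matOp B z.2 + w)
        (c • (matOp B).comp (ContinuousLinearMap.snd ℝ ℝ (Euc d))) z :=
      ((((matOp B).comp (ContinuousLinearMap.snd ℝ ℝ (Euc d))).hasFDerivAt).const_smul c).add_const w
    have h2 := (hasFDerivAt_const c z).prodMk h1
    rw [h2.fderiv]; simp
  induction h with
  | of v hv =>
    rcases hv with ⟨i, rfl⟩ | hv
    · exact ⟨0, basisVec hp i, Submodule.subset_span ⟨0, i, by simp⟩, by ext z <;> simp [fieldDx]⟩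
    · rw [Set.mem_singleton_iff] at hv
      subst hv
      exact ⟨1, 0, zero_mem _, by ext z <;> simp [fieldY]⟩
  | zero => exact ⟨0, 0, zero_mem _, by ext z <;> simp⟩
  | add v w _ _ hv hw =>
    obtain ⟨c, u, hu, rfl⟩ := hv
    obtain ⟨c', u', hu', rfl⟩ := hw
    exact ⟨c + c', u + u', add_mem hu hu', by ext z <;> simp; ring⟩
  | smul k v _ hv =>
    obtain ⟨c, u, hu, rfl⟩ := hv
    exact ⟨k * c, k • u, Submodule.smul_mem _ _ hu, by ext z <;> simp; ring⟩
  | bracket v w _ _ hv hw =>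
    obtain ⟨c, u, hu, rfl⟩ := hv
    obtain ⟨c', u', hu', rfl⟩ := hw
    refine ⟨0, c' • matOp B u - c • matOp B u', sub_mem
      (Submodule.smul_mem _ _ (matOp_mem_kalmanSpace hp B hu))
      (Submodule.smul_mem _ _ (matOp_mem_kalmanSpace hp B hu')), ?_⟩
    funext z
    rw [VectorField.lieBracket, hfd, hfd]
    refine Prod.ext (by simp) ?_
    simp only [Prod.mk_sub_mk, map_add, map_smul, zero_smul, zero_add, smul_add]
    rw [smul_comm c c']; abel

/-- At the origin the affine form leaves only values in ℝ × `kalmanSpace`, so rank d + 1 there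
forces the second factor to be everything. -/
theorem kalmanSpace_eq_top (h : HormanderCondition hp B) : kalmanSpace hp B = ⊤ := by
  have h0 := h 0
  have hle : Submodule.span ℝ ((fun v : ℝ × Euc d → ℝ × Euc d => v 0) ''
      {v | LieGenerated (Set.range (fieldDx hp) ∪ {fieldY B}) v}) ≤
      (⊤ : Submodule ℝ ℝ).prod (kalmanSpace hp B) := by
    rw [Submodule.span_le]
    rintro _ ⟨v, hv, rfl⟩
    obtain ⟨c, w, hw, rfl⟩ := LieGenerated.eq_affine hp B hv
    simpa using hw
  have h1 := Submodule.eq_top_of_finrank_eq (h0.trans (by simp [add_comm] : d + 1 =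
    Module.finrank ℝ (ℝ × Euc d)))
  rw [h1, top_le_iff] at hle
  refine eq_top_iff.2 fun w _ => ?_
  have : ((0 : ℝ), w) ∈ (⊤ : Submodule ℝ ℝ).prod (kalmanSpace hp B) := hle ▸ Submodule.mem_top
  exact this.2

end Kalman

/-! ### From intrinsic Hölder regularity to ordinary continuity -/

section IntrinsicContinuity

variable {p₀ d : ℕ} (hp : p₀ ≤ d) (B : Matrix (Fin d) (Fin d) ℝ)

/-- A linear form that kills e^{δB} e_i for all small δ also kills every derivative at δ = 0, that
is every B^k e_i, and these span by Hörmander's condition. -/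
theorem span_expB_eq_top (h : HormanderCondition hp B) {ρ : ℝ} (hρ : 0 < ρ) :
    Submodule.span ℝ {v : Euc d | ∃ δ : ℝ, |δ| < ρ ∧ ∃ i : Fin p₀, v = expB B δ (basisVec hp i)}
      = ⊤ := by
  by_contra hne
  obtain ⟨l, hl0, hl⟩ := Submodule.exists_le_ker_of_lt_top _ (lt_top_iff_ne_top.2 hne)
  set L : Euc d →L[ℝ] ℝ := LinearMap.toContinuousLinearMap l
  -- The induction on `k` covers the whole interval |δ| < ρ, because differentiating at δ needs the
  -- vanishing on a neighbourhood of δ.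
  have key : ∀ (k : ℕ) (i : Fin p₀) (δ : ℝ), |δ| < ρ →
      L ((matOp B ^ k) (expB B δ (basisVec hp i))) = 0 := by
    intro k i
    induction k with
    | zero =>
      intro δ hδ
      exact hl (Submodule.subset_span ⟨δ, hδ, i, rfl⟩)
    | succ k ih =>
      intro δ hδ
      have h1 : HasDerivAt (fun η => expB B η (basisVec hp i))
          (matOp B (expB B δ (basisVec hp i))) δ :=
        (ContinuousLinearMap.apply ℝ (Euc d) (basisVec hp i)).hasFDerivAt.comp_hasDerivAt δ
          (hasDerivAt_expB B δ)
      have h2 : HasDerivAt (fun η => L ((matOp B ^ k) (expB B η (basisVec hp i))))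
          (L ((matOp B ^ k) (matOp B (expB B δ (basisVec hp i))))) δ :=
        (L.comp (matOp B ^ k)).hasFDerivAt.comp_hasDerivAt δ h1
      have h3 : HasDerivAt (fun η => L ((matOp B ^ k) (expB B η (basisVec hp i)))) 0 δ := by
        refine (hasDerivAt_const δ (0 : ℝ)).congr_of_eventuallyEq ?_
        have : ∀ᶠ η in 𝓝 δ, |η| < ρ := continuous_abs.continuousAt.eventually_lt_const hδ
        filter_upwards [this] with η hη using ih η hη
      have h4 := h2.unique h3
      rw [pow_succ]
      exact h4
  apply hl0
  have : kalmanSpace hp B ≤ LinearMap.ker l := by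
    refine Submodule.span_le.2 ?_
    rintro _ ⟨k, i, rfl⟩
    have := key k i 0 (by simpa using hρ)
    rw [expB_zero] at this
    exact this
  rw [kalmanSpace_eq_top hp B h, top_le_iff, LinearMap.ker_eq_top] at this
  exact this

/-- Under Hörmander's condition, uniform continuity along the fields implies continuity. -/
theorem continuous_of_unifContAlong (h : HormanderCondition hp B) {g : ℝ × Euc d → ℝ}
    (hY : UnifContAlong (flowY B) g) (hX : ∀ i, UnifContAlong (flowDx hp i) g) : Continuous g := by
  refine continuous_iff_continuousAt.2 fun z₀ => ?_
  rw [ContinuousAt, Metric.tendsto_nhds]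
  intro ε hε
  -- The path from `z₀` uses one move along Y and then at most d translations, each made of three
  -- moves along the fields: 1 + 3d increments of size η add up to ε/2.
  set η : ℝ := ε / (2 * (1 + 3 * d)) with hη
  have hη0 : 0 < η := by positivity
  obtain ⟨ρY, hρY, hYη⟩ := hY η hη0
  choose ρX hρX hXη using fun i => hX i η hη0
  obtain ⟨ρ, hρ, hρle⟩ : ∃ ρ > 0, ρ ≤ ρY ∧ ∀ i, ρ ≤ ρX i := by
    have : ∀ᶠ ρ : ℝ in 𝓝[>] 0, ρ ≤ ρY ∧ ∀ i, ρ ≤ ρX i := by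
      refine Eventually.and ?_ (eventually_all.2 fun i => ?_)
      · exact nhdsWithin_le_nhds (ge_mem_nhds hρY)
      · exact nhdsWithin_le_nhds (ge_mem_nhds (hρX i))
    obtain ⟨ρ, h1, h2⟩ := (this.and self_mem_nhdsWithin).exists
    exact ⟨ρ, h2, h1⟩
  have hspan := span_expB_eq_top hp B h hρ
  let b := Module.Basis.ofSpan hspan.ge
  have : Fintype _ := FiniteDimensional.fintypeBasisIndex b
  have hb : ∀ k, ∃ δ : ℝ, |δ| < ρ ∧ ∃ i : Fin p₀, b k = expB B δ (basisVec hp i) := fun k =>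
    Module.Basis.ofSpan_subset hspan.ge ⟨k, rfl⟩
  -- translation by a small multiple of a basis vector
  have step : ∀ k (c : ℝ), |c| < ρ → ∀ (t : ℝ) (x : Euc d),
      |g (t, x + c • b k) - g (t, x)| ≤ 3 * η := by
    intro k c hc t x
    obtain ⟨δ, hδ, i, hbk⟩ := hb k
    -- Conjugation: back along Y for time δ, across by c along ∂_i, forward along Y for time δ. The
    -- net effect is a translation by c e^{δB} e_i at unchanged time.
    set z1 := flowY B (-δ) (t, x) with hz1
    set z2 := flowDx hp i c z1 with hz2
    have hz3 : flowY B δ z2 = (t, x + c • b k) := by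
      simp [hz2, hz1, flowY_eq, flowDx, hbk]
    have e1 := hYη (-δ) (by simpa using hδ.trans_le hρle.1) (t, x)
    have e2 := hXη i c (hc.trans_le (hρle.2 i)) z1
    have e3 := hYη δ (hδ.trans_le hρle.1) z2
    rw [hz3] at e3
    rw [← hz1] at e1
    rw [← hz2] at e2
    rw [abs_le] at *
    constructor <;> linarith [e1.1, e1.2, e2.1, e2.2, e3.1, e3.2]
  have steps : ∀ (c : _ → ℝ), (∀ k, |c k| < ρ) → ∀ (t : ℝ) (x : Euc d) (s : Finset _),
      |g (t, x + ∑ k ∈ s, c k • b k) - g (t, x)| ≤ s.card * (3 * η) := by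
    intro c hc t x s
    classical
    induction s using Finset.induction_on with
    | empty => simp
    | insert k s hk ih =>
      rw [Finset.sum_insert hk, Finset.card_insert_of_notMem hk, add_comm (c k • b k), ← add_assoc]
      have := step k (c k) (hc k) t (x + ∑ k ∈ s, c k • b k)
      push_cast
      rw [abs_le] at *
      constructor <;> linarith [this.1, this.2, ih.1, ih.2]
  -- After moving from `z₀` along Y to the time of `z`, a spatial gap remains; its coordinates in
  -- the basis `b` are continuous in `z` and vanish at `z₀`.
  have hcont : ∀ k, Tendsto (fun z : ℝ × Euc d => b.coord k (z.2 - expB B (z.1 - z₀.1) z₀.2))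
      (𝓝 z₀) (𝓝 0) := by
    intro k
    have : Continuous fun z : ℝ × Euc d => b.coord k (z.2 - expB B (z.1 - z₀.1) z₀.2) := by
      have h1 := LinearMap.continuous_of_finiteDimensional (b.coord k)
      exact h1.comp (by fun_prop)
    simpa using this.tendsto z₀
  have hev : ∀ᶠ z : ℝ × Euc d in 𝓝 z₀,
      (∀ k, |b.coord k (z.2 - expB B (z.1 - z₀.1) z₀.2)| < ρ) ∧ |z.1 - z₀.1| < ρ := by
    refine Eventually.and (eventually_all.2 fun k => ?_) ?_
    · have := (hcont k).abs
      rw [abs_zero] at this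
      exact this.eventually_lt_const hρ
    · have : Continuous fun z : ℝ × Euc d => |z.1 - z₀.1| := by fun_prop
      exact this.continuousAt.eventually_lt_const (by simpa using hρ)
  filter_upwards [hev] with z hz
  have e1 := hYη (z.1 - z₀.1) (hz.2.trans_le hρle.1) z₀
  have e2 := steps _ hz.1 z.1 (expB B (z.1 - z₀.1) z₀.2) Finset.univ
  have hsum : ∑ k, b.coord k (z.2 - expB B (z.1 - z₀.1) z₀.2) • b k
      = z.2 - expB B (z.1 - z₀.1) z₀.2 := by
    simpa using b.sum_repr (z.2 - expB B (z.1 - z₀.1) z₀.2)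
  rw [hsum, Finset.card_univ, ← Module.finrank_eq_card_basis b, finrank_euclideanSpace_fin,
    add_sub_cancel] at e2
  have e3 : flowY B (z.1 - z₀.1) z₀ = (z.1, expB B (z.1 - z₀.1) z₀.2) := by simp [flowY_eq]
  rw [e3] at e1
  have e4 : (1 + 3 * (d : ℝ)) * η = ε / 2 := by rw [hη]; field_simp
  rw [Real.dist_eq]
  have : |g z - g z₀| ≤ ε / 2 := by
    rw [← e4]
    rw [abs_le] at *
    constructor <;> nlinarith [e1.1, e1.2, e2.1, e2.2]
  linarith

/-- `f` is continuous along with `∂_i f`, `∂_i ∂_j f` and `Y f`, which exist everywhere. -/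
structure IntrinsicC2 (f : ℝ × Euc d → ℝ) : Prop where
  cont : Continuous f
  hasDx : ∀ i, HasDerivAlong (flowDx hp i) f (derivDx hp i f)
  contDx : ∀ i, Continuous (derivDx hp i f)
  hasDxx : ∀ i j, HasDerivAlong (flowDx hp i) (derivDx hp j f) (derivDx hp i (derivDx hp j f))
  contDxx : ∀ i j, Continuous (derivDx hp i (derivDx hp j f))
  hasY : HasDerivAlong (flowY B) f (derivY B f)
  contY : Continuous (derivY B f)

theorem eventuallyEq_zero_along {Z : Type*} [TopologicalSpace Z] {φ : ℝ → Z → Z} (hφ : IsFlow φ)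
    {f : Z → ℝ} {K : Set Z} (hK : IsClosed K) (hf : ∀ z ∉ K, f z = 0) {z : Z} (hz : z ∉ K) :
    (fun δ => f (φ δ z)) =ᶠ[𝓝 0] fun _ => 0 := by
  have h1 : Continuous fun δ => φ δ z := hφ.cont.comp (by fun_prop : Continuous fun δ : ℝ => (δ, z))
  have h2 : ∀ᶠ δ in 𝓝 (0 : ℝ), φ δ z ∈ Kᶜ :=
    h1.continuousAt.eventually_mem (hK.isOpen_compl.mem_nhds (by rwa [hφ.zero]))
  filter_upwards [h2] with δ hδ using hf _ hδ

theorem derivDx_eq_zero_off {f : ℝ × Euc d → ℝ} {K : Set (ℝ × Euc d)} (hK : IsClosed K)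
    (hf : ∀ z ∉ K, f z = 0) (i : Fin p₀) : ∀ z ∉ K, derivDx hp i f z = 0 := fun z hz => by
  rw [derivDx, (eventuallyEq_zero_along (isFlow_flowDx hp i) hK hf hz).deriv_eq, deriv_const]

theorem derivY_eq_zero_off {f : ℝ × Euc d → ℝ} {K : Set (ℝ × Euc d)} (hK : IsClosed K)
    (hf : ∀ z ∉ K, f z = 0) : ∀ z ∉ K, derivY B f z = 0 := fun z hz => by
  rw [derivY, (eventuallyEq_zero_along (isFlow_flowY B) hK hf hz).deriv_eq, deriv_const]

/-- Off the closed set `K` the function is zero along the flow for small parameters, hence trivially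
differentiable; the assumption on `Q` is needed only at points of `K`. -/
theorem hasDerivAlong_of_zero_off {Z : Type*} [TopologicalSpace Z] {φ : ℝ → Z → Z} (hφ : IsFlow φ)
    {f : Z → ℝ} {K Q : Set Z} (hK : IsClosed K) (hKQ : K ⊆ Q) (hf : ∀ z ∉ K, f z = 0)
    (h : ∀ z ∈ Q, DifferentiableAt ℝ (fun δ : ℝ => f (φ δ z)) 0) :
    HasDerivAlong φ f fun z => deriv (fun δ => f (φ δ z)) 0 := by
  intro z
  by_cases hz : z ∈ K
  · exact (h z (hKQ hz)).hasDerivAt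
  · exact ((differentiableAt_const (0 : ℝ)).congr_of_eventuallyEq
      (eventuallyEq_zero_along hφ hK hf hz)).hasDerivAt

/-- By compactness of `K` one time interval keeps all the curves issued from `K` inside the open set
`Q`. -/
theorem radiusOn_pos {Q K : Set (ℝ × Euc d)} (hQ : IsOpen Q) (hK : IsCompact K) (hKQ : K ⊆ Q)
    (hne : K.Nonempty) : 0 < radiusOn hp B Q K := by
  have hev : ∀ᶠ δ : ℝ in 𝓝 0, ∀ z ∈ K, (∀ i : Fin p₀, flowDx hp i δ z ∈ Q) ∧ flowY B δ z ∈ Q := by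
    refine hK.eventually_forall_of_forall_eventually fun z hz => ?_
    refine Eventually.and (eventually_all.2 fun i => ?_) ?_
    · exact (continuous_flowDx hp i).continuousAt.eventually_mem
        (hQ.mem_nhds (by simpa using hKQ hz))
    · exact (continuous_flowY B).continuousAt.eventually_mem
        (hQ.mem_nhds (by simpa using hKQ hz))
  obtain ⟨ε, hε, hε'⟩ := Metric.eventually_nhds_iff.1 hev
  have hr : 0 < min (ε / 2) 1 := by positivity
  refine hr.trans_le (le_csInf (hne.image _) ?_)
  rintro _ ⟨z, hz, rfl⟩
  refine le_csSup ⟨1, fun r hr => hr.1.2⟩ ⟨⟨hr, min_le_right _ _⟩, fun δ hδ => hε' ?_ z hz⟩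
  rw [Real.dist_eq, sub_zero]
  have := abs_le.2 hδ
  have := min_le_left (ε / 2) 1
  linarith

theorem HolderAlong.unifContAlong {Q K : Set (ℝ × Euc d)} (hQ : IsOpen Q) (hK : IsCompact K)
    (hKQ : K ⊆ Q) {φ : ℝ → ℝ × Euc d → ℝ × Euc d} (hφ : IsFlow φ) {β : ℝ} (hβ : 0 < β)
    {g : ℝ × Euc d → ℝ} (hg : ∀ z ∉ K, g z = 0) (h : HolderAlong hp B Q φ β g) :
    UnifContAlong φ g := by
  -- The empty case is apart because `radiusOn` of the empty set is `sInf ∅ = 0`, which allows no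
  -- increment.
  rcases K.eq_empty_or_nonempty with rfl | hne
  · exact fun η hη => ⟨1, one_pos, fun δ _ z => by rw [hg _ (by simp), hg _ (by simp)]; simpa using hη.le⟩
  obtain ⟨C, hC⟩ := h K (by rwa [hK.isClosed.closure_eq]) (by rwa [hK.isClosed.closure_eq])
  exact unifContAlong_of_holder hφ hg hβ (radiusOn_pos hp B hQ hK hKQ hne) hC

theorem exists_bound_of_zero_off {Z : Type*} [TopologicalSpace Z] {g : Z → ℝ} {K : Set Z}
    (hK : IsCompact K) (hc : Continuous g) (hg : ∀ z ∉ K, g z = 0) : ∃ C, ∀ z, |g z| ≤ C := by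
  obtain ⟨C, hC⟩ := hK.exists_bound_of_continuousOn hc.continuousOn
  refine ⟨max C 0, fun z => ?_⟩
  by_cases hz : z ∈ K
  · exact (hC z hz).trans (le_max_left _ _)
  · rw [hg z hz]; simp

/-- Continuity descends from the top order. Yf and ∂_i∂_j f are Hölder along all the fields. Then
∂_j f is Hölder along Y with exponent (1+α)/2 and Lipschitz along ∂_i because ∂_i∂_j f is bounded.
Finally `f` is Lipschitz along every field. All the Hölder bounds are taken on the compact support,
which is an admissible `V`. -/
theorem IntrinsicHolder.intrinsicC2 (hB : HormanderCondition hp B) {Q : Set (ℝ × Euc d)}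
    (hQ : IsOpen Q) {α : ℝ} (hα : 0 < α) {f : ℝ × Euc d → ℝ} (hf : IntrinsicHolder hp B Q α 2 f)
    (hfc : HasCompactSupport f) (hfs : tsupport f ⊆ Q) : IntrinsicC2 hp B f := by
  obtain ⟨⟨hY, hYf⟩, hX⟩ := hf
  set K := tsupport f with hKdef
  have hK : IsCompact K := hfc
  have hKc : IsClosed K := hK.isClosed
  have h0 : ∀ z ∉ K, f z = 0 := fun z hz => image_eq_zero_of_notMem_tsupport hz
  have h1 := fun i => derivDx_eq_zero_off hp hKc h0 i
  have h2 := fun i j => derivDx_eq_zero_off hp hKc (h1 j) i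
  have hYz := derivY_eq_zero_off B hKc h0
  have cont0 : ∀ g : ℝ × Euc d → ℝ, (∀ z ∉ K, g z = 0) → IntrinsicHolder hp B Q α 0 g →
      Continuous g := fun g hg hgH => continuous_of_unifContAlong hp B hB
    (HolderAlong.unifContAlong hp B hQ hK hfs (isFlow_flowY B) (by positivity) hg hgH.1)
    (fun i => HolderAlong.unifContAlong hp B hQ hK hfs (isFlow_flowDx hp i) hα hg (hgH.2 i))
  have hasDx : ∀ i, HasDerivAlong (flowDx hp i) f (derivDx hp i f) := fun i =>
    hasDerivAlong_of_zero_off (isFlow_flowDx hp i) hKc hfs h0 (hX i).1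
  have hasDxx : ∀ i j, HasDerivAlong (flowDx hp i) (derivDx hp j f)
      (derivDx hp i (derivDx hp j f)) := fun i j =>
    hasDerivAlong_of_zero_off (isFlow_flowDx hp i) hKc hfs (h1 j) ((hX j).2.2 i).1
  have hasY : HasDerivAlong (flowY B) f (derivY B f) :=
    hasDerivAlong_of_zero_off (isFlow_flowY B) hKc hfs h0 hY
  have contY := cont0 _ hYz hYf
  have contDxx : ∀ i j, Continuous (derivDx hp i (derivDx hp j f)) := fun i j =>
    cont0 _ (h2 i j) ((hX j).2.2 i).2
  have contDx : ∀ i, Continuous (derivDx hp i f) := fun j => by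
    refine continuous_of_unifContAlong hp B hB
      (HolderAlong.unifContAlong hp B hQ hK hfs (isFlow_flowY B) (by positivity) (h1 j)
        (hX j).2.1) fun i => ?_
    obtain ⟨C, hC⟩ := exists_bound_of_zero_off hK (contDxx i j) (h2 i j)
    exact (hasDxx i j).unifContAlong (isFlow_flowDx hp i) hC
  have cont : Continuous f := by
    obtain ⟨C, hC⟩ := exists_bound_of_zero_off hK contY hYz
    refine continuous_of_unifContAlong hp B hB (hasY.unifContAlong (isFlow_flowY B) hC) fun i => ?_
    obtain ⟨C, hC⟩ := exists_bound_of_zero_off hK (contDx i) (h1 i)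
    exact (hasDx i).unifContAlong (isFlow_flowDx hp i) hC
  exact ⟨cont, hasDx, contDx, hasDxx, contDxx, hasY, contY⟩

end IntrinsicContinuity

/-! ### Squares and the carré du champ -/

section Square

variable {p₀ d : ℕ} (hp : p₀ ≤ d) (B : Matrix (Fin d) (Fin d) ℝ)

theorem HasDerivAlong.derivDx_eq {i : Fin p₀} {f g : ℝ × Euc d → ℝ}
    (h : HasDerivAlong (flowDx hp i) f g) : derivDx hp i f = g := funext fun z => (h z).deriv

theorem HasDerivAlong.derivY_eq {f g : ℝ × Euc d → ℝ}
    (h : HasDerivAlong (flowY B) f g) : derivY B f = g := funext fun z => (h z).deriv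

theorem HasDerivAlong.mul {Z : Type*} [TopologicalSpace Z] {φ : ℝ → Z → Z} (hφ : IsFlow φ)
    {f g f' g' : Z → ℝ} (hf : HasDerivAlong φ f f') (hg : HasDerivAlong φ g g') :
    HasDerivAlong φ (fun z => f z * g z) fun z => f' z * g z + f z * g' z := fun z => by
  simpa [hφ.zero] using (hf z).fun_mul (hg z)

variable {hp B}

theorem IntrinsicC2.derivDx_mul_self {f : ℝ × Euc d → ℝ} (hf : IntrinsicC2 hp B f) (i : Fin p₀) :
    HasDerivAlong (flowDx hp i) (fun z => f z * f z) fun z => 2 * (f z * derivDx hp i f z) := by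
  convert (hf.hasDx i).mul (isFlow_flowDx hp i) (hf.hasDx i) using 2
  ring

theorem IntrinsicC2.derivDxx_mul_self {f : ℝ × Euc d → ℝ} (hf : IntrinsicC2 hp B f)
    (i j : Fin p₀) : HasDerivAlong (flowDx hp i) (fun z => 2 * (f z * derivDx hp j f z)) fun z =>
      2 * (derivDx hp i f z * derivDx hp j f z + f z * derivDx hp i (derivDx hp j f) z) :=
  fun z => ((hf.hasDx i).mul (isFlow_flowDx hp i) (hf.hasDxx i j) z).const_mul 2

theorem IntrinsicC2.derivY_mul_self {f : ℝ × Euc d → ℝ} (hf : IntrinsicC2 hp B f) :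
    HasDerivAlong (flowY B) (fun z => f z * f z) fun z => 2 * (f z * derivY B f z) := by
  convert hf.hasY.mul (isFlow_flowY B) hf.hasY using 2
  ring

/-- This lets Dynkin's formula apply to f², the source of the second moment. Only continuity of the
derivatives has to be preserved, so no Hölder estimate for products is needed. -/
theorem IntrinsicC2.mul_self {f : ℝ × Euc d → ℝ} (hf : IntrinsicC2 hp B f) :
    IntrinsicC2 hp B fun z => f z * f z := by
  have e1 := fun i => (hf.derivDx_mul_self i).derivDx_eq
  have e2 := fun i j => (hf.derivDxx_mul_self i j).derivDx_eq
  have e3 := hf.derivY_mul_self.derivY_eq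
  have c1 := hf.cont
  have c2 := hf.contDx
  have c3 := hf.contDxx
  have c4 := hf.contY
  refine ⟨by fun_prop, fun i => ?_, fun i => ?_, fun i j => ?_, fun i j => ?_, ?_, ?_⟩
  · rw [e1]; exact hf.derivDx_mul_self i
  · rw [e1]; fun_prop
  · rw [e1, e2]; exact hf.derivDxx_mul_self i j
  · rw [e1, e2]; fun_prop
  · rw [e3]; exact hf.derivY_mul_self
  · rw [e3]; fun_prop

/-- The carré du champ identity `𝓛 f² = 2 f 𝓛 f + ∑ a_{ij} ∂_i f ∂_j f`. -/
theorem IntrinsicC2.opL_mul_self {f : ℝ × Euc d → ℝ} (hf : IntrinsicC2 hp B f)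
    (a : Fin p₀ → Fin p₀ → ℝ × Euc d → ℝ) (b : Fin p₀ → ℝ × Euc d → ℝ) (z : ℝ × Euc d) :
    opL hp B a b (fun z => f z * f z) z
      = 2 * (f z * opL hp B a b f z) + energyDensity hp a f z := by
  have e1 := fun i => (hf.derivDx_mul_self i).derivDx_eq
  have e2 := fun i j => (hf.derivDxx_mul_self i j).derivDx_eq
  have e3 := hf.derivY_mul_self.derivY_eq
  simp only [opL, energyDensity, e1, e2, e3, mul_add, Finset.mul_sum]
  have h : ∀ (A A' : Fin p₀ → Fin p₀ → ℝ) (A'' : Fin p₀ → Fin p₀ → ℝ) (C C' : Fin p₀ → ℝ) (u v : ℝ),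
      (∀ i j, A i j = A' i j + A'' i j) → (∀ i, C i = C' i) → u = v →
      ∑ i, ∑ j, A i j + ∑ i, C i + u = ∑ i, ∑ j, A' i j + ∑ i, C' i + v + ∑ i, ∑ j, A'' i j := by
    intro A A' A'' C C' u v h1 h2 h3
    simp only [h1, h2, h3, Finset.sum_add_distrib]; ring
  refine h _ _ _ _ _ _ _ (fun i j => ?_) (fun i => ?_) ?_ <;> ring

end Square

/-! ### Intrinsic mollification -/

section Mollify

variable {p₀ d : ℕ} (hp : p₀ ≤ d) (B : Matrix (Fin d) (Fin d) ℝ)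

/-- The left translations `z ↦ (t, x - e^{tB} y)`, which commute with the flows of the fields. -/
noncomputable def leftShift (y : Euc d) (z : ℝ × Euc d) : ℝ × Euc d := (z.1, z.2 - expB B z.1 y)

/-- Since e^{(t+δ)B} y = e^{δB} e^{tB} y, the shift is transported by Y. A plain translation of x
would not commute with Y. -/
theorem flowY_leftShift (δ : ℝ) (y : Euc d) (z : ℝ × Euc d) :
    leftShift B y (flowY B δ z) = flowY B δ (leftShift B y z) := by
  simp only [leftShift, flowY_eq, map_sub, ← expB_add_apply, add_comm]

theorem flowDx_leftShift (i : Fin p₀) (δ : ℝ) (y : Euc d) (z : ℝ × Euc d) :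
    leftShift B y (flowDx hp i δ z) = flowDx hp i δ (leftShift B y z) := by
  simp only [leftShift, flowDx, Prod.mk.injEq, true_and]; abel

theorem continuous_leftShift : Continuous fun q : Euc d × (ℝ × Euc d) => leftShift B q.1 q.2 := by
  unfold leftShift; fun_prop

/-- The mollification `∫ φ(y) g(t, x - e^{tB} y) dy`. -/
noncomputable def mollify (φ : ContDiffBump (0 : Euc d)) (g : ℝ × Euc d → ℝ) (z : ℝ × Euc d) : ℝ :=
  ∫ y, φ.normed volume y * g (leftShift B y z)

variable (φ : ContDiffBump (0 : Euc d)) {B}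

theorem integrable_mollify {g : ℝ × Euc d → ℝ} (hg : Continuous g) (z : ℝ × Euc d) :
    Integrable fun y => φ.normed volume y * g (leftShift B y z) := by
  have h1 : Continuous fun y => leftShift B y z :=
    (continuous_leftShift B).comp (by fun_prop : Continuous fun y : Euc d => (y, z))
  refine Continuous.integrable_of_hasCompactSupport (φ.continuous_normed.mul (hg.comp h1)) ?_
  exact φ.hasCompactSupport_normed.mul_right

theorem abs_mollify_le {g : ℝ × Euc d → ℝ} {C : ℝ} (hC : ∀ z, |g z| ≤ C)
    (z : ℝ × Euc d) : |mollify B φ g z| ≤ C := by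
  have h1 : ‖mollify B φ g z‖ ≤ ∫ y : Euc d, φ.normed volume y * C := by
    refine norm_integral_le_of_norm_le ((φ.integrable_normed (μ := volume)).mul_const C) (ae_of_all _ fun y => ?_)
    rw [norm_mul, Real.norm_of_nonneg (φ.nonneg_normed y)]
    exact mul_le_mul_of_nonneg_left (hC _) (φ.nonneg_normed y)
  rwa [integral_mul_const, φ.integral_normed, one_mul, Real.norm_eq_abs] at h1

theorem continuous_mollify {g : ℝ × Euc d → ℝ} (hg : Continuous g) {C : ℝ} (hC : ∀ z, |g z| ≤ C) :
    Continuous (mollify B φ g) := by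
  refine continuous_of_dominated (bound := fun y => φ.normed volume y * C)
    (fun z => (integrable_mollify φ hg z).aestronglyMeasurable) (fun z => ae_of_all _ fun y => ?_)
    (φ.integrable_normed.mul_const C) (ae_of_all _ fun y => ?_)
  · rw [norm_mul, Real.norm_of_nonneg (φ.nonneg_normed y)]
    exact mul_le_mul_of_nonneg_left (hC _) (φ.nonneg_normed y)
  · exact continuous_const.mul (hg.comp ((continuous_leftShift B).comp
      (by fun_prop : Continuous fun z : ℝ × Euc d => (y, z))))

/-- Because the shifts commute with the flow, differentiating under the integral puts the derivative
on `f` itself, with no commutator term. -/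
theorem HasDerivAlong.mollify {ψ : ℝ → ℝ × Euc d → ℝ × Euc d} (hψ : IsFlow ψ)
    (hcomm : ∀ δ y z, leftShift B y (ψ δ z) = ψ δ (leftShift B y z)) {f g : ℝ × Euc d → ℝ}
    (hf : Continuous f) (hg : Continuous g) {C : ℝ} (hC : ∀ z, |g z| ≤ C)
    (h : HasDerivAlong ψ f g) : HasDerivAlong ψ (mollify B φ f) (mollify B φ g) := by
  intro z
  have := (hasDerivAt_integral_of_dominated_loc_of_deriv_le (μ := (volume : Measure (Euc d)))
    (F := fun δ y => φ.normed volume y * f (leftShift B y (ψ δ z)))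
    (F' := fun δ y => φ.normed volume y * g (leftShift B y (ψ δ z)))
    (x₀ := (0 : ℝ)) (s := univ) (bound := fun y => φ.normed volume y * C) univ_mem
    (Eventually.of_forall fun δ => (integrable_mollify φ hf _).aestronglyMeasurable)
    (integrable_mollify φ hf _) (integrable_mollify φ hg _).aestronglyMeasurable
    (ae_of_all _ fun y δ _ => ?_) (φ.integrable_normed.mul_const C)
    (ae_of_all _ fun y δ _ => ?_)).2
  · simp only [hψ.zero] at this
    exact this
  · rw [norm_mul, Real.norm_of_nonneg (φ.nonneg_normed y)]
    exact mul_le_mul_of_nonneg_left (hC _) (φ.nonneg_normed y)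
  · simp only [hcomm]
    exact (h.hasDerivAt hψ (leftShift B y z) δ).const_mul _

/-- At fixed t, in the coordinate e^{-tB} x, the mollification is a Euclidean convolution;
smoothness in x and the approximation estimate are inherited from it. -/
theorem mollify_eq_convolution (g : ℝ × Euc d → ℝ) (t : ℝ) (x : Euc d) :
    mollify B φ g (t, x) = (convolution (φ.normed volume) (fun u => g (t, expB B t u))
      (ContinuousLinearMap.lsmul ℝ ℝ) volume) (expB B (-t) x) := by
  simp only [mollify, convolution, leftShift, ContinuousLinearMap.lsmul_apply, smul_eq_mul, map_sub,
    expB_apply_neg]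

theorem contDiff_mollify {g : ℝ × Euc d → ℝ} (hg : Continuous g) (t : ℝ) (n : ℕ∞) :
    ContDiff ℝ n fun x => mollify B φ g (t, x) := by
  simp only [mollify_eq_convolution]
  refine ContDiff.comp (g := convolution (φ.normed volume) (fun u => g (t, expB B t u))
      (ContinuousLinearMap.lsmul ℝ ℝ) volume) ?_ (expB B (-t)).contDiff
  refine φ.hasCompactSupport_normed.contDiff_convolution_left _ φ.contDiff_normed ?_
  exact (by fun_prop : Continuous fun u => g (t, expB B t u)).locallyIntegrable

theorem dist_mollify_le {g : ℝ × Euc d → ℝ} (hg : Continuous g) (z : ℝ × Euc d) {ε : ℝ}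
    (h : ∀ y : Euc d, ‖y‖ < φ.rOut → |g (leftShift B y z) - g z| ≤ ε) :
    |mollify B φ g z - g z| ≤ ε := by
  have hc : Continuous fun u => g (z.1, expB B z.1 u) := by fun_prop
  have := φ.dist_normed_convolution_le (μ := volume) (g := fun u => g (z.1, expB B z.1 u))
    (x₀ := expB B (-z.1) z.2) (ε := ε) hc.aestronglyMeasurable fun u hu => ?_
  · rw [← mollify_eq_convolution, Real.dist_eq, expB_apply_neg] at this
    exact this
  · have := h (expB B (-z.1) z.2 - u) (by
      rw [← dist_eq_norm, dist_comm]; exact hu)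
    rw [Real.dist_eq, expB_apply_neg]
    simpa [leftShift] using this

theorem mollify_eq_zero {g : ℝ × Euc d → ℝ} {z : ℝ × Euc d}
    (h : ∀ y : Euc d, ‖y‖ ≤ φ.rOut → g (leftShift B y z) = 0) : mollify B φ g z = 0 := by
  unfold mollify
  refine integral_eq_zero_of_ae (ae_of_all _ fun y => ?_)
  by_cases hy : ‖y‖ ≤ φ.rOut
  · simp [h y hy]
  · have : φ.normed volume y = 0 := by
      rw [ContDiffBump.normed_def, φ.zero_of_le_dist (by rw [dist_zero_right]; exact (not_le.1 hy).le),
        zero_div]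
    simp [this]

theorem tendsto_mollify {ι : Type*} {l : Filter ι} {φ : ι → ContDiffBump (0 : Euc d)}
    (hφ : Tendsto (fun n => (φ n).rOut) l (𝓝 0)) {g : ℝ × Euc d → ℝ} (hg : Continuous g)
    (z : ℝ × Euc d) : Tendsto (fun n => mollify B (φ n) g z) l (𝓝 (g z)) := by
  rw [Metric.tendsto_nhds]
  intro ε hε
  have h1 : Continuous fun y => g (leftShift B y z) :=
    hg.comp ((continuous_leftShift B).comp (by fun_prop : Continuous fun y : Euc d => (y, z)))
  have h2 := h1.tendsto 0
  rw [Metric.tendsto_nhds_nhds] at h2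
  obtain ⟨ρ, hρ, h3⟩ := h2 (ε / 2) (by positivity)
  filter_upwards [hφ.eventually_lt_const hρ] with n hn
  have : |mollify B (φ n) g z - g z| ≤ ε / 2 := by
    refine dist_mollify_le (φ n) hg z fun y hy => ?_
    have h4 := h3 (x := y) (by rw [dist_zero_right]; exact hy.trans hn)
    have e : leftShift B 0 z = z := by simp [leftShift]
    rw [e, Real.dist_eq] at h4
    exact h4.le
  rw [Real.dist_eq]; linarith

/-- All the mollifications with small radius must live in one compact subset of `Q`, where the
coefficients are bounded. `K'` is the image of a closed ball times `K` under the shifts, and the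
shift by `-y` undoes the shift by `y`. -/
theorem exists_compact_leftShift {Q K : Set (ℝ × Euc d)} (hQ : IsOpen Q) (hK : IsCompact K)
    (hKQ : K ⊆ Q) : ∃ r > 0, ∃ K' : Set (ℝ × Euc d), IsCompact K' ∧ K ⊆ K' ∧ K' ⊆ Q ∧
      ∀ z ∉ K', ∀ y : Euc d, ‖y‖ ≤ r → leftShift B y z ∉ K := by
  have hinv : ∀ (y : Euc d) (z : ℝ × Euc d), leftShift B (-y) (leftShift B y z) = z := by
    intro y z; simp [leftShift]
  have hev : ∀ᶠ y : Euc d in 𝓝 0, ∀ z ∈ K, leftShift B y z ∈ Q := by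
    refine hK.eventually_forall_of_forall_eventually fun z hz => ?_
    exact (continuous_leftShift B).continuousAt.eventually_mem
      (hQ.mem_nhds (by simpa [leftShift] using hKQ hz))
  obtain ⟨ε, hε, hε'⟩ := Metric.eventually_nhds_iff.1 hev
  refine ⟨ε / 2, by positivity, (fun q : Euc d × (ℝ × Euc d) => leftShift B q.1 q.2) ''
    (Metric.closedBall 0 (ε / 2) ×ˢ K), ?_, ?_, ?_, ?_⟩
  · exact ((isCompact_closedBall _ _).prod hK).image (continuous_leftShift B)
  · intro z hz
    exact ⟨(0, z), ⟨by simp; positivity, hz⟩, by simp [leftShift]⟩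
  · rintro _ ⟨⟨y, z⟩, ⟨hy, hz⟩, rfl⟩
    refine hε' (y := y) ?_ z hz
    have : dist y 0 ≤ ε / 2 := hy
    linarith
  · intro z hz y hy hmem
    exact hz ⟨(-y, leftShift B y z), ⟨by simpa using hy, hmem⟩, hinv y z⟩

end Mollify

/-! ### The generator on smooth functions -/

section Generator

/-- Two applications of the mean value inequality along the segment θ ↦ x + θv, first to the
derivative of `g` and then to `g`, bound the Taylor remainder by the oscillation of the second
derivative. The constant is not sharp. -/
theorem abs_taylor_two_le {E : Type*} [NormedAddCommGroup E] [NormedSpace ℝ E] {g : E → ℝ}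
    (hg : ContDiff ℝ 2 g) (x v : E) {ε : ℝ}
    (h : ∀ θ ∈ Icc (0 : ℝ) 1,
      ‖fderiv ℝ (fderiv ℝ g) (x + θ • v) - fderiv ℝ (fderiv ℝ g) x‖ ≤ ε) :
    |g (x + v) - g x - fderiv ℝ g x v - 1 / 2 * fderiv ℝ (fderiv ℝ g) x v v| ≤ ε * ‖v‖ ^ 2 := by
  have hε : 0 ≤ ε := le_trans (by positivity) (h 0 (by simp))
  have hd1 : Differentiable ℝ g := hg.differentiable (by norm_num)
  have hd2 : Differentiable ℝ (fderiv ℝ g) :=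
    (hg.fderiv_right (m := 1) (by norm_num)).differentiable (by norm_num)
  have hline : ∀ θ : ℝ, HasDerivAt (fun θ : ℝ => x + θ • v) v θ := fun θ => by
    simpa using ((hasDerivAt_id θ).smul_const v).const_add x
  have h1 : ∀ θ : ℝ, HasDerivAt (fun θ : ℝ => g (x + θ • v)) (fderiv ℝ g (x + θ • v) v) θ :=
    fun θ => (hd1 _).hasFDerivAt.comp_hasDerivAt θ (hline θ)
  have h2 : ∀ θ : ℝ, HasDerivAt (fun θ : ℝ => fderiv ℝ g (x + θ • v) v)
      (fderiv ℝ (fderiv ℝ g) (x + θ • v) v v) θ := fun θ =>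
    (ContinuousLinearMap.apply ℝ ℝ v).hasFDerivAt.comp_hasDerivAt θ
      ((hd2 _).hasFDerivAt.comp_hasDerivAt θ (hline θ))
  set q := fderiv ℝ (fderiv ℝ g) x v v with hq
  have h3 : ∀ θ : ℝ, HasDerivAt (fun θ : ℝ => fderiv ℝ g (x + θ • v) v - θ * q)
      (fderiv ℝ (fderiv ℝ g) (x + θ • v) v v - q) θ := fun θ => by
    exact ((h2 θ).sub ((hasDerivAt_id' θ).mul_const q)).congr_deriv (by rw [one_mul])
  have b3 : ∀ θ ∈ Icc (0 : ℝ) 1, ‖fderiv ℝ (fderiv ℝ g) (x + θ • v) v v - q‖ ≤ ε * ‖v‖ ^ 2 := by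
    intro θ hθ
    have e : fderiv ℝ (fderiv ℝ g) (x + θ • v) v v - q
        = (fderiv ℝ (fderiv ℝ g) (x + θ • v) - fderiv ℝ (fderiv ℝ g) x) v v := by simp [hq]
    rw [e]
    refine (ContinuousLinearMap.le_opNorm₂ _ v v).trans ?_
    rw [pow_two, ← mul_assoc]
    gcongr
    exact h θ hθ
  have b2 : ∀ θ ∈ Icc (0 : ℝ) 1, ‖fderiv ℝ g (x + θ • v) v - fderiv ℝ g x v - θ * q‖
      ≤ ε * ‖v‖ ^ 2 := by
    intro θ hθ
    have := Convex.norm_image_sub_le_of_norm_hasDerivWithin_le (s := Icc (0 : ℝ) 1) (x := 0)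
      (y := θ) (fun θ _ => (h3 θ).hasDerivWithinAt) b3 (convex_Icc 0 1) (by simp) hθ
    simp only [zero_smul, add_zero, zero_mul, sub_zero] at this
    have e : fderiv ℝ g (x + θ • v) v - fderiv ℝ g x v - θ * q
        = fderiv ℝ g (x + θ • v) v - θ * q - fderiv ℝ g x v := by ring
    rw [e]
    refine this.trans (mul_le_of_le_one_right (by positivity) ?_)
    rw [Real.norm_eq_abs, abs_le]
    exact ⟨by linarith [hθ.1], hθ.2⟩
  have h4 : ∀ θ : ℝ, HasDerivAt (fun θ : ℝ => g (x + θ • v) - θ * fderiv ℝ g x v - θ ^ 2 / 2 * q)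
      (fderiv ℝ g (x + θ • v) v - fderiv ℝ g x v - θ * q) θ := fun θ => by
    have e1 := (hasDerivAt_id' θ).mul_const (fderiv ℝ g x v)
    have e2 := (((hasDerivAt_id' θ).fun_pow 2).div_const 2).mul_const q
    exact (((h1 θ).sub e1).sub e2).congr_deriv (by simp)
  have := Convex.norm_image_sub_le_of_norm_hasDerivWithin_le (s := Icc (0 : ℝ) 1) (x := 0)
    (y := 1) (fun θ _ => (h4 θ).hasDerivWithinAt) b2 (convex_Icc 0 1) (by simp) (by simp)
  simp only [one_smul, one_mul, one_pow, zero_smul, add_zero, zero_mul, sub_zero, norm_one, mul_one,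
    ne_eq, OfNat.ofNat_ne_zero, not_false_eq_true, zero_pow, zero_div] at this
  rw [Real.norm_eq_abs] at this
  convert this using 2
  ring

theorem exists_modulus_of_zero_off {E F : Type*} [NormedAddCommGroup E]
    [NormedAddCommGroup F] {u : E → F} (hu : Continuous u) {K : Set E} (hK : IsCompact K)
    (huK : ∀ x ∉ K, ‖u x‖ = 0) {ε : ℝ} (hε : 0 < ε) :
    ∃ δ > 0, ∀ x y, ‖y - x‖ < δ → ‖u y - u x‖ ≤ ε := by
  have huc : HasCompactSupport u := HasCompactSupport.intro hK fun x hx => norm_eq_zero.1 (huK x hx)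
  obtain ⟨δ, hδ, h⟩ :=
    Metric.uniformContinuous_iff.1 (huc.uniformContinuous_of_continuous hu) ε hε
  refine ⟨δ, hδ, fun x y hxy => ?_⟩
  have := h (a := y) (b := x) (by rwa [dist_eq_norm])
  rw [dist_eq_norm] at this
  exact this.le

theorem fderiv_fderiv_eq_zero {E : Type*} [NormedAddCommGroup E] [NormedSpace ℝ E] {g : E → ℝ}
    {x : E} (hx : x ∉ tsupport g) : fderiv ℝ (fderiv ℝ g) x = 0 :=
  image_eq_zero_of_notMem_tsupport
    (fun h => hx (tsupport_fderiv_subset ℝ (tsupport_fderiv_subset ℝ h)))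

theorem exists_modulus_fderiv {E : Type*} [NormedAddCommGroup E] [NormedSpace ℝ E] {g : E → ℝ}
    (hg : ContDiff ℝ 2 g) (hgc : HasCompactSupport g) {ε : ℝ} (hε : 0 < ε) :
    ∃ δ > 0, ∀ x y, ‖y - x‖ < δ → ‖fderiv ℝ (fderiv ℝ g) y - fderiv ℝ (fderiv ℝ g) x‖ ≤ ε := by
  have hg1 : ContDiff ℝ 1 (fderiv ℝ g) := hg.fderiv_right (by norm_num)
  have hg2 : Continuous (fderiv ℝ (fderiv ℝ g)) := hg1.continuous_fderiv one_ne_zero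
  exact exists_modulus_of_zero_off (F := E →L[ℝ] E →L[ℝ] ℝ) hg2 hgc
    (fun x hx => by
      rw [fderiv_fderiv_eq_zero hx]; exact ContinuousLinearMap.opNorm_zero) hε

theorem exists_bound_fderiv {E : Type*} [NormedAddCommGroup E] [NormedSpace ℝ E] {g : E → ℝ}
    (hg : ContDiff ℝ 2 g) (hgc : HasCompactSupport g) :
    ∃ M : ℝ, (∀ x, |g x| ≤ M) ∧ (∀ x v, ‖v‖ = 1 → |fderiv ℝ g x v| ≤ M) ∧
      ∀ x v w, ‖v‖ = 1 → ‖w‖ = 1 → |fderiv ℝ (fderiv ℝ g) x v w| ≤ M := by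
  have hg1 : ContDiff ℝ 1 (fderiv ℝ g) := hg.fderiv_right (by norm_num)
  have hg2 : Continuous (fderiv ℝ (fderiv ℝ g)) := hg1.continuous_fderiv one_ne_zero
  have hgc2 : HasCompactSupport (fderiv ℝ (fderiv ℝ g)) := (hgc.fderiv ℝ).fderiv ℝ
  have e0 : ∃ C, ∀ x, ‖g x‖ ≤ C := hgc.exists_bound_of_continuous hg.continuous
  have e1 : ∃ C, ∀ x, ‖fderiv ℝ g x‖ ≤ C :=
    HasCompactSupport.exists_bound_of_continuous (hgc.fderiv ℝ) hg1.continuous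
  have e2 : ∃ C, ∀ x, ‖fderiv ℝ (fderiv ℝ g) x‖ ≤ C :=
    HasCompactSupport.exists_bound_of_continuous (f := fderiv ℝ (fderiv ℝ g)) hgc2 hg2
  obtain ⟨C0, h0⟩ := e0
  obtain ⟨C1, h1⟩ := e1
  obtain ⟨C2, h2⟩ := e2
  refine ⟨max C0 (max C1 C2), fun x => ?_, fun x v hv => ?_, fun x v w hv hw => ?_⟩
  · exact le_max_of_le_left (h0 x)
  · have h3 : ‖fderiv ℝ g x v‖ ≤ ‖fderiv ℝ g x‖ * ‖v‖ := (fderiv ℝ g x).le_opNorm v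
    rw [hv, mul_one] at h3
    exact le_max_of_le_right (le_max_of_le_left (h3.trans (h1 x)))
  · have h3 : ‖fderiv ℝ (fderiv ℝ g) x v w‖ ≤ ‖fderiv ℝ (fderiv ℝ g) x‖ * ‖v‖ * ‖w‖ :=
      (fderiv ℝ (fderiv ℝ g) x).le_opNorm₂ v w
    rw [hv, hw, mul_one, mul_one] at h3
    exact le_max_of_le_right (le_max_of_le_right (h3.trans (h2 x)))

variable {d : ℕ}

theorem euc_eq_sum_single (v : Euc d) :
    v = ∑ i, v i • (EuclideanSpace.single i (1 : ℝ) : Euc d) := by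
  simpa using (EuclideanSpace.basisFun (Fin d) ℝ).sum_repr v |>.symm

/-- The second order operator `∑ β_i ∂_i + ½ ∑ A_{ij} ∂_{ij}` on `C²` functions of `x`. -/
noncomputable def genOp (β : Fin d → Euc d → ℝ) (A : Fin d → Fin d → Euc d → ℝ) (g : Euc d → ℝ)
    (x : Euc d) : ℝ :=
  ∑ i, β i x * fderiv ℝ g x (EuclideanSpace.single i 1) +
    1 / 2 * ∑ i, ∑ j, A i j x *
      fderiv ℝ (fderiv ℝ g) x (EuclideanSpace.single i 1) (EuclideanSpace.single j 1)

theorem integrableOn_ball_of_bound {μ : Measure (Euc d)} [IsProbabilityMeasure μ] {x : Euc d}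
    {δ : ℝ} {u : Euc d → ℝ} (hu : Continuous u) {C : ℝ} (hC : ∀ ξ, ‖ξ - x‖ < δ → |u ξ| ≤ C) :
    IntegrableOn u {ξ | ‖ξ - x‖ < δ} μ := by
  have hS : MeasurableSet {ξ : Euc d | ‖ξ - x‖ < δ} :=
    (isOpen_lt (by fun_prop) continuous_const).measurableSet
  refine Measure.integrableOn_of_bounded (M := C) (measure_ne_top _ _)
    hu.aestronglyMeasurable ?_
  exact (ae_restrict_iff' hS).2 (ae_of_all _ fun ξ hξ => hC ξ hξ)

/-- Inside the ball, `g` is replaced by its second order Taylor polynomial, whose integral is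
`genOp` with the truncated moments as coefficients; the error is ε times the integral of |ξ - x|².
Outside, |g(ξ) - g(x)| ≤ 2M. -/
theorem abs_integral_sub_genOp_le {μ : Measure (Euc d)} [IsProbabilityMeasure μ] {g : Euc d → ℝ}
    (hg : ContDiff ℝ 2 g) (x : Euc d) {δ ε M : ℝ} (hδ : 0 < δ) (hM : ∀ ξ, |g ξ| ≤ M)
    (h : ∀ y, ‖y - x‖ < δ → ‖fderiv ℝ (fderiv ℝ g) y - fderiv ℝ (fderiv ℝ g) x‖ ≤ ε) :
    |∫ ξ, (g ξ - g x) ∂μ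
      - genOp (fun i _ => ∫ ξ in {ξ | ‖ξ - x‖ < δ}, (ξ - x) i ∂μ)
        (fun i j _ => ∫ ξ in {ξ | ‖ξ - x‖ < δ}, (ξ - x) i * (ξ - x) j ∂μ) g x|
      ≤ ε * ∑ i, ∫ ξ in {ξ | ‖ξ - x‖ < δ}, (ξ - x) i * (ξ - x) i ∂μ
        + 2 * M * μ.real {ξ | δ / 2 < ‖ξ - x‖} := by
  set S : Set (Euc d) := {ξ | ‖ξ - x‖ < δ} with hSdef
  have hS : MeasurableSet S := (isOpen_lt (by fun_prop) continuous_const).measurableSet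
  have hgc : Continuous g := hg.continuous
  have hM0 : 0 ≤ M := (abs_nonneg _).trans (hM x)
  have hco : ∀ (ξ : Euc d) i, |(ξ - x) i| ≤ ‖ξ - x‖ := fun ξ i => by
    simpa using PiLp.norm_apply_le (ξ - x) i
  have hc1 : ∀ i, Continuous fun ξ : Euc d => (ξ - x) i := fun i => by fun_prop
  have int1 : ∀ i, IntegrableOn (fun ξ : Euc d => (ξ - x) i) S μ := fun i =>
    integrableOn_ball_of_bound (C := δ) (hc1 i) fun ξ hξ => (hco ξ i).trans hξ.le
  have int2 : ∀ i j, IntegrableOn (fun ξ : Euc d => (ξ - x) i * (ξ - x) j) S μ := fun i j =>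
    integrableOn_ball_of_bound (C := δ * δ) ((hc1 i).mul (hc1 j)) fun ξ hξ => by
      rw [abs_mul]
      exact mul_le_mul ((hco ξ i).trans hξ.le) ((hco ξ j).trans hξ.le) (abs_nonneg _) hδ.le
  have intg : Integrable (fun ξ => g ξ - g x) μ :=
    (Integrable.of_bound hgc.aestronglyMeasurable M (ae_of_all _ hM)).sub (integrable_const _)
  set G : Euc d → ℝ := fun ξ => genOp (fun i _ => (ξ - x) i)
    (fun i j _ => (ξ - x) i * (ξ - x) j) g x with hG
  have intG : IntegrableOn G S μ := by
    refine Integrable.add (integrable_finsetSum _ fun i _ => (int1 i).mul_const _)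
      (Integrable.const_mul (integrable_finsetSum _ fun i _ =>
        integrable_finsetSum _ fun j _ => (int2 i j).mul_const _) _)
  have hGint : ∫ ξ in S, G ξ ∂μ = genOp (fun i _ => ∫ ξ in S, (ξ - x) i ∂μ)
        (fun i j _ => ∫ ξ in S, (ξ - x) i * (ξ - x) j ∂μ) g x := by
    simp only [hG, genOp]
    rw [integral_add, integral_const_mul, integral_finsetSum, integral_finsetSum]
    · congr 1
      · exact Finset.sum_congr rfl fun i _ => integral_mul_const _ _
      · congr 1
        refine Finset.sum_congr rfl fun i _ => ?_
        rw [integral_finsetSum]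
        · exact Finset.sum_congr rfl fun j _ => integral_mul_const _ _
        · exact fun j _ => (int2 i j).mul_const _
    · exact fun i _ => integrable_finsetSum _ fun j _ => (int2 i j).mul_const _
    · exact fun i _ => (int1 i).mul_const _
    · exact integrable_finsetSum _ fun i _ => (int1 i).mul_const _
    · exact (integrable_finsetSum _ fun i _ =>
        integrable_finsetSum _ fun j _ => (int2 i j).mul_const _).const_mul _
  have hGeq : ∀ ξ, G ξ = fderiv ℝ g x (ξ - x)
      + 1 / 2 * fderiv ℝ (fderiv ℝ g) x (ξ - x) (ξ - x) := by
    intro ξ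
    conv_rhs => rw [euc_eq_sum_single (ξ - x)]
    simp only [hG, genOp, map_sum, map_smul, smul_eq_mul, _root_.sum_apply,
      _root_.smul_apply, Finset.mul_sum]
    congr 1
    rw [Finset.sum_comm]
    refine Finset.sum_congr rfl fun i _ => Finset.sum_congr rfl fun j _ => ?_
    ring
  have hR : ∀ ξ ∈ S, ‖(g ξ - g x) - G ξ‖ ≤ ε * ∑ i, (ξ - x) i * (ξ - x) i := by
    intro ξ hξ
    have := abs_taylor_two_le hg x (ξ - x) (ε := ε) fun θ hθ => h _ ?_
    · rw [add_sub_cancel] at this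
      rw [hGeq, Real.norm_eq_abs, ← sub_sub]
      refine this.trans_eq ?_
      rw [EuclideanSpace.real_norm_sq_eq]
      simp only [pow_two]
    · rw [add_sub_cancel_left, norm_smul, Real.norm_of_nonneg hθ.1]
      exact (mul_le_of_le_one_left (norm_nonneg _) hθ.2).trans_lt hξ
  have e1 : |∫ ξ in S, (g ξ - g x - G ξ) ∂μ| ≤ ε * ∑ i, ∫ ξ in S, (ξ - x) i * (ξ - x) i ∂μ := by
    rw [← integral_finsetSum _ fun i _ => int2 i i, ← integral_const_mul, ← Real.norm_eq_abs]
    refine norm_integral_le_of_norm_le ((integrable_finsetSum _ fun i _ => int2 i i).const_mul ε) ?_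
    exact (ae_restrict_iff' hS).2 (ae_of_all _ hR)
  -- The complement of the open ball is ‖ξ - x‖ ≥ δ, while the jump condition concerns a strict
  -- inequality; hence the radius δ/2.
  have e2 : |∫ ξ in Sᶜ, (g ξ - g x) ∂μ| ≤ 2 * M * μ.real {ξ | δ / 2 < ‖ξ - x‖} := by
    rw [← Real.norm_eq_abs]
    refine (norm_setIntegral_le_of_norm_le_const (C := 2 * M) (measure_lt_top _ _)
      fun ξ _ => ?_).trans ?_
    · refine (norm_sub_le _ _).trans ?_
      have := hM ξ
      have := hM x
      simp only [Real.norm_eq_abs]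
      linarith
    · gcongr
      · finiteness
      · intro ξ hξ
        have : δ ≤ ‖ξ - x‖ := not_lt.1 hξ
        show δ / 2 < ‖ξ - x‖
        linarith
  rw [← hGint, ← integral_add_compl hS intg]
  rw [integral_sub intg.integrableOn intG] at e1
  rw [abs_le] at *
  constructor <;> linarith [e1.1, e1.2, e2.1, e2.2]

theorem genOp_eq_zero {β : Fin d → Euc d → ℝ} {A : Fin d → Fin d → Euc d → ℝ} {g : Euc d → ℝ}
    {x : Euc d} (hx : x ∉ tsupport g) : genOp β A g x = 0 := by
  have h1 : fderiv ℝ g x = 0 := image_eq_zero_of_notMem_tsupport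
    (fun h => hx (tsupport_fderiv_subset ℝ h))
  have h2 : fderiv ℝ (fderiv ℝ g) x = 0 := image_eq_zero_of_notMem_tsupport
    (fun h => hx (tsupport_fderiv_subset ℝ (tsupport_fderiv_subset ℝ h)))
  simp [genOp, h1, h2]

theorem abs_genOp_sub_le {β β' : Fin d → Euc d → ℝ} {A A' : Fin d → Fin d → Euc d → ℝ}
    {g : Euc d → ℝ} {x : Euc d} {η M : ℝ} (hη : 0 ≤ η)
    (hM1 : ∀ i, |fderiv ℝ g x (EuclideanSpace.single i 1)| ≤ M)
    (hM2 : ∀ i j, |fderiv ℝ (fderiv ℝ g) x (EuclideanSpace.single i 1)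
      (EuclideanSpace.single j 1)| ≤ M)
    (hβ : ∀ i, |β i x - β' i x| ≤ η) (hA : ∀ i j, |A i j x - A' i j x| ≤ η) :
    |genOp β A g x - genOp β' A' g x| ≤ η * (M * (d + d ^ 2)) := by
  have e : genOp β A g x - genOp β' A' g x = genOp (fun i x => β i x - β' i x)
      (fun i j x => A i j x - A' i j x) g x := by
    simp only [genOp, sub_mul, Finset.sum_sub_distrib]; ring
  rw [e, genOp]
  refine (abs_add_le _ _).trans ?_
  have h1 : |∑ i, (β i x - β' i x) * fderiv ℝ g x (EuclideanSpace.single i 1)| ≤ d * (η * M) := by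
    refine (Finset.abs_sum_le_sum_abs _ _).trans ?_
    refine (Finset.sum_le_card_nsmul _ _ (η * M) fun i _ => ?_).trans_eq (by simp)
    rw [abs_mul]
    exact mul_le_mul (hβ i) (hM1 i) (abs_nonneg _) hη
  have h2 : |∑ i, ∑ j, (A i j x - A' i j x) * fderiv ℝ (fderiv ℝ g) x (EuclideanSpace.single i 1)
      (EuclideanSpace.single j 1)| ≤ d * (d * (η * M)) := by
    refine (Finset.abs_sum_le_sum_abs _ _).trans ?_
    refine (Finset.sum_le_card_nsmul _ _ (d * (η * M)) fun i _ => ?_).trans_eq (by simp)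
    refine (Finset.abs_sum_le_sum_abs _ _).trans ?_
    refine (Finset.sum_le_card_nsmul _ _ (η * M) fun j _ => ?_).trans_eq (by simp)
    rw [abs_mul]
    exact mul_le_mul (hA i j) (hM2 i j) (abs_nonneg _) hη
  rw [abs_mul, abs_of_pos (by norm_num : (0 : ℝ) < 1 / 2)]
  have := abs_nonneg (∑ i, ∑ j, (A i j x - A' i j x) * fderiv ℝ (fderiv ℝ g) x
    (EuclideanSpace.single i 1) (EuclideanSpace.single j 1))
  nlinarith

/-- If the local moments of the kernels `κ h` are those of a diffusion on `D`, then
`h⁻¹ ∫ (g(ξ) - g(x)) κ_h(x,dξ)` tends to the generator applied to `g`, uniformly in `x`. -/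
theorem eventually_generator {κ : ℝ → Kernel (Euc d) (Euc d)}
    (hκ : ∀ᶠ h in 𝓝[>] (0 : ℝ), IsMarkovKernel (κ h)) {D : Set (Euc d)} (hD : IsOpen D)
    {β : Fin d → Euc d → ℝ} {A : Fin d → Fin d → Euc d → ℝ}
    (hA : ∀ i, ∀ H : Set (Euc d), IsCompact H → H ⊆ D → ∃ C, ∀ x ∈ H, |A i i x| ≤ C)
    (hinto : ∀ δ : ℝ, 0 < δ → ∀ H : Set (Euc d), IsCompact H → H ⊆ D → TendstoUniformlyOn
      (fun h x => (κ h x).real ({ξ | δ < ‖ξ - x‖} ∩ H) / h) (fun _ => 0) (𝓝[>] 0) univ)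
    (hfrom : ∀ δ : ℝ, 0 < δ → ∀ H : Set (Euc d), IsCompact H → H ⊆ D → TendstoUniformlyOn
      (fun h x => (κ h x).real {ξ | δ < ‖ξ - x‖} / h) (fun _ => 0) (𝓝[>] 0) H)
    (hdrift : ∀ δ : ℝ, 0 < δ → ∀ H : Set (Euc d), IsCompact H → H ⊆ D → ∀ i, TendstoUniformlyOn
      (fun h x => (∫ ξ in {ξ | ‖ξ - x‖ < δ}, (ξ - x) i ∂(κ h x)) / h) (β i) (𝓝[>] 0) H)
    (hdiff : ∀ δ : ℝ, 0 < δ → ∀ H : Set (Euc d), IsCompact H → H ⊆ D → ∀ i j, TendstoUniformlyOn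
      (fun h x => (∫ ξ in {ξ | ‖ξ - x‖ < δ}, (ξ - x) i * (ξ - x) j ∂(κ h x)) / h) (A i j)
      (𝓝[>] 0) H)
    {g : Euc d → ℝ} (hg : ContDiff ℝ 2 g) (hgc : HasCompactSupport g) (hgD : tsupport g ⊆ D)
    {ε : ℝ} (hε : 0 < ε) :
    ∀ᶠ h in 𝓝[>] (0 : ℝ), ∀ x, |(∫ ξ, (g ξ - g x) ∂(κ h x)) / h - genOp β A g x| ≤ ε := by
  set K := tsupport g with hKdef
  have hK : IsCompact K := hgc
  obtain ⟨δ₀, hδ₀, hthick⟩ := hK.exists_cthickening_subset_open hD hgD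
  -- Points of `H` are treated by the local moments; points outside `H` are at distance more than δ₀
  -- from the support.
  set H := Metric.cthickening δ₀ K with hHdef
  have hH : IsCompact H := hK.cthickening
  obtain ⟨M, hM, hM1, hM2⟩ : ∃ M : ℝ, (∀ x, |g x| ≤ M) ∧
      (∀ x i, |fderiv ℝ g x (EuclideanSpace.single i 1)| ≤ M) ∧
      ∀ x i j, |fderiv ℝ (fderiv ℝ g) x (EuclideanSpace.single i 1)
        (EuclideanSpace.single j 1)| ≤ M := by
    obtain ⟨M, h0, h1, h2⟩ := exists_bound_fderiv hg hgc
    exact ⟨M, h0, fun x i => h1 x _ (by simp), fun x i j => h2 x _ _ (by simp) (by simp)⟩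
  have hM0 : 0 ≤ M := (abs_nonneg _).trans (hM 0)
  obtain ⟨CA, hCA0, hCA⟩ : ∃ CA : ℝ, 0 ≤ CA ∧ ∀ x ∈ H, ∀ i, A i i x ≤ CA := by
    choose C hC using fun i => hA i H hH hthick
    refine ⟨∑ i, |C i|, Finset.sum_nonneg fun i _ => abs_nonneg _, fun x hx i => ?_⟩
    refine (le_abs_self _).trans ((hC i x hx).trans ((le_abs_self _).trans ?_))
    exact Finset.single_le_sum (f := fun i => |C i|) (fun i _ => abs_nonneg _) (Finset.mem_univ i)
  -- The Taylor error is at most ε₁ times the normalized second moment, which is below d(CA + 1) for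
  -- small h; half of ε is reserved for it.
  set ε₁ := ε / (2 * (d * (CA + 1) + 1)) with hε₁
  have hε₁0 : 0 < ε₁ := by positivity
  have hε₁e : ε₁ * (d * (CA + 1)) ≤ ε / 2 := by
    rw [hε₁, div_mul_eq_mul_div, div_le_iff₀ (by positivity)]
    have : 0 ≤ (d : ℝ) * (CA + 1) := by positivity
    nlinarith
  obtain ⟨δ, hδ, hunif⟩ : ∃ δ > 0, ∀ x y, ‖y - x‖ < δ →
      ‖fderiv ℝ (fderiv ℝ g) y - fderiv ℝ (fderiv ℝ g) x‖ ≤ ε₁ := by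
    exact exists_modulus_fderiv hg hgc hε₁0
  -- `L` collects the factors of η: M(d + d²) from replacing truncated moments by their limits and
  -- 2M from the jumps out of the ball.
  set L := M * (d + d ^ 2) + 2 * M with hL
  have hL0 : 0 ≤ L := by positivity
  obtain ⟨η, hη0, hη1, hηL⟩ : ∃ η : ℝ, 0 < η ∧ η ≤ 1 ∧ η * L ≤ ε / 2 := by
    refine ⟨min 1 (ε / (2 * (L + 1))), by positivity, min_le_left _ _, ?_⟩
    refine (mul_le_mul_of_nonneg_right (min_le_right _ _) hL0).trans ?_
    rw [div_mul_eq_mul_div, div_le_iff₀ (by positivity)]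
    nlinarith
  have ev1 := Metric.tendstoUniformlyOn_iff.1 (hinto δ₀ hδ₀ K hK hgD) η hη0
  have ev2 := Metric.tendstoUniformlyOn_iff.1 (hfrom (δ / 2) (by positivity) H hH hthick) η hη0
  have ev3 := eventually_all.2 fun i =>
    Metric.tendstoUniformlyOn_iff.1 (hdrift δ hδ H hH hthick i) η hη0
  have ev4 := eventually_all.2 fun i => eventually_all.2 fun j =>
    Metric.tendstoUniformlyOn_iff.1 (hdiff δ hδ H hH hthick i j) η hη0
  filter_upwards [ev1, ev2, ev3, ev4, hκ, self_mem_nhdsWithin] with h h1 h2 h3 h4 _ hh x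
  have hh : 0 < h := hh
  simp only [Real.dist_eq, zero_sub, abs_neg] at h1 h2 h3 h4
  by_cases hx : x ∈ H
  · have key := abs_integral_sub_genOp_le (μ := κ h x) hg x hδ hM (fun y hy => hunif x y hy)
    have e1 := abs_genOp_sub_le (x := x) (g := g) (β := fun i x =>
        (∫ ξ in {ξ | ‖ξ - x‖ < δ}, (ξ - x) i ∂(κ h x)) / h) (β' := β)
      (A := fun i j x => (∫ ξ in {ξ | ‖ξ - x‖ < δ}, (ξ - x) i * (ξ - x) j ∂(κ h x)) / h) (A' := A)
      hη0.le (hM1 x) (hM2 x) (fun i => by rw [abs_sub_comm]; exact (h3 i x hx).le)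
      (fun i j => by rw [abs_sub_comm]; exact (h4 i j x hx).le)
    have e2 : genOp (fun i x => (∫ ξ in {ξ | ‖ξ - x‖ < δ}, (ξ - x) i ∂(κ h x)) / h)
        (fun i j x => (∫ ξ in {ξ | ‖ξ - x‖ < δ}, (ξ - x) i * (ξ - x) j ∂(κ h x)) / h) g x
        = genOp (fun i _ => ∫ ξ in {ξ | ‖ξ - x‖ < δ}, (ξ - x) i ∂(κ h x))
        (fun i j _ => ∫ ξ in {ξ | ‖ξ - x‖ < δ}, (ξ - x) i * (ξ - x) j ∂(κ h x)) g x / h := by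
      simp only [genOp, div_mul_eq_mul_div, ← Finset.sum_div]; ring
    rw [e2] at e1
    have e3 : (∑ i, ∫ ξ in {ξ | ‖ξ - x‖ < δ}, (ξ - x) i * (ξ - x) i ∂(κ h x)) / h
        ≤ d * (CA + 1) := by
      rw [Finset.sum_div]
      refine (Finset.sum_le_card_nsmul _ _ (CA + 1) fun i _ => ?_).trans_eq (by simp; ring)
      have := (abs_le.1 (h4 i i x hx).le).1
      linarith [hCA x hx i]
    have e4 : (κ h x).real {ξ | δ / 2 < ‖ξ - x‖} / h ≤ η := (le_abs_self _).trans (h2 x hx).le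
    have key' := div_le_div_of_nonneg_right key hh.le
    rw [← abs_of_pos hh, ← abs_div, abs_of_pos hh, sub_div, add_div, mul_div_assoc,
      mul_div_assoc] at key'
    have e5 := mul_le_mul_of_nonneg_left e3 hε₁0.le
    have e6 := mul_le_mul_of_nonneg_left e4 (by positivity : 0 ≤ 2 * M)
    have e7 := abs_sub_le ((∫ ξ, (g ξ - g x) ∂(κ h x)) / h) _ _ |>.trans (add_le_add key' e1)
    refine e7.trans ?_
    rw [hL] at hηL
    linarith
  -- Far from the support both g(x) and the generator vanish, and g(ξ) ≠ 0 requires a jump longer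
  -- than δ₀ into `K`; this is where the limit uniform over all starting points enters.
  · have hxK : x ∉ K := fun h => hx (Metric.self_subset_cthickening K h)
    have hgx : g x = 0 := image_eq_zero_of_notMem_tsupport hxK
    rw [genOp_eq_zero hxK, sub_zero, abs_div, abs_of_pos hh, div_le_iff₀ hh]
    have hsub : ∀ ξ ∈ K, δ₀ < ‖ξ - x‖ := by
      intro ξ hξ
      by_contra hle
      apply hx
      refine Metric.mem_cthickening_of_dist_le x ξ δ₀ K hξ ?_
      rw [dist_comm, dist_eq_norm]
      exact not_lt.1 hle
    have e1 : ∫ ξ, (g ξ - g x) ∂(κ h x) = ∫ ξ in {ξ | δ₀ < ‖ξ - x‖} ∩ K, g ξ ∂(κ h x) := by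
      simp only [hgx, sub_zero]
      refine (setIntegral_eq_integral_of_forall_compl_eq_zero fun ξ hξ => ?_).symm
      refine image_eq_zero_of_notMem_tsupport fun hξK => hξ ⟨hsub ξ hξK, hξK⟩
    have e2 : |∫ ξ in {ξ | δ₀ < ‖ξ - x‖} ∩ K, g ξ ∂(κ h x)|
        ≤ M * (κ h x).real ({ξ | δ₀ < ‖ξ - x‖} ∩ K) := by
      rw [← Real.norm_eq_abs]
      exact norm_setIntegral_le_of_norm_le_const (measure_lt_top _ _) fun ξ _ => hM ξ
    have e3 := (le_abs_self _).trans (h1 x trivial).le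
    rw [div_le_iff₀ hh] at e3
    rw [e1]
    refine e2.trans ((mul_le_mul_of_nonneg_left e3 hM0).trans ?_)
    rw [← mul_assoc]
    refine mul_le_mul_of_nonneg_right ?_ hh.le
    have : 0 ≤ M * (d + (d : ℝ) ^ 2) := by positivity
    rw [hL] at hηL
    nlinarith

end Generator

/-! ### The operator on compactly supported functions -/

section Operator

variable {p₀ d : ℕ} {hp : p₀ ≤ d} {B : Matrix (Fin d) (Fin d) ℝ} {T₀ : ℝ} {D : Set (Euc d)}

/-- The coefficient is Borel only on the strip and arbitrary elsewhere; the other factor vanishes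
off a subset of the strip, so the product is Borel on the whole space. -/
theorem LocBounded.measurable_mul {c : ℝ × Euc d → ℝ} (hD : IsOpen D) (hc : LocBounded T₀ D c)
    {K : Set (ℝ × Euc d)} (hKD : K ⊆ Ioo 0 T₀ ×ˢ D) {u : ℝ × Euc d → ℝ} (hu : Measurable u)
    (hu0 : ∀ z ∉ K, u z = 0) : Measurable fun z => c z * u z := by
  have hS : MeasurableSet (Ico 0 T₀ ×ˢ D : Set (ℝ × Euc d)) :=
    measurableSet_Ico.prod hD.measurableSet
  refine measurable_of_restrict_of_restrict_compl hS ?_ ?_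
  · exact hc.1.mul (hu.comp measurable_subtype_coe)
  · have : ((Ico 0 T₀ ×ˢ D : Set (ℝ × Euc d))ᶜ).domRestrict (fun z => c z * u z) = fun _ => 0 := by
      funext z
      have : u z = 0 := hu0 z fun hz => z.2 ⟨Ioo_subset_Ico_self (hKD hz).1, (hKD hz).2⟩
      simp [this]
    rw [this]
    exact measurable_const

theorem LocBounded.exists_bound {c : ℝ × Euc d → ℝ} (hc : LocBounded T₀ D c)
    {K : Set (ℝ × Euc d)} (hK : IsCompact K) (hKD : K ⊆ Ioo 0 T₀ ×ˢ D) :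
    ∃ C, 0 ≤ C ∧ ∀ z ∈ K, |c z| ≤ C := by
  obtain ⟨C, hC⟩ := hc.2 K hK (hKD.trans (prod_mono Ioo_subset_Ico_self subset_rfl))
  exact ⟨max C 0, le_max_right _ _, fun z hz => (hC z hz).trans (le_max_left _ _)⟩

theorem measurable_opL (hD : IsOpen D) {a : Fin p₀ → Fin p₀ → ℝ × Euc d → ℝ}
    {b : Fin p₀ → ℝ × Euc d → ℝ} (ha : ∀ i j, LocBounded T₀ D (a i j))
    (hb : ∀ i, LocBounded T₀ D (b i)) {K : Set (ℝ × Euc d)} (hK : IsClosed K)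
    (hKD : K ⊆ Ioo 0 T₀ ×ˢ D) {f : ℝ × Euc d → ℝ} (hf : IntrinsicC2 hp B f)
    (hf0 : ∀ z ∉ K, f z = 0) : Measurable (opL hp B a b f) := by
  unfold opL
  refine Measurable.add (Measurable.add (Measurable.const_mul ?_ _) ?_) hf.contY.measurable
  · refine Finset.measurable_fun_sum _ fun i _ => Finset.measurable_fun_sum _ fun j _ => ?_
    exact (ha i j).measurable_mul hD hKD (hf.contDxx i j).measurable
      (derivDx_eq_zero_off hp hK (derivDx_eq_zero_off hp hK hf0 j) i)
  · refine Finset.measurable_fun_sum _ fun i _ => ?_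
    exact (hb i).measurable_mul hD hKD (hf.contDx i).measurable (derivDx_eq_zero_off hp hK hf0 i)

theorem measurable_energyDensity (hD : IsOpen D) {a : Fin p₀ → Fin p₀ → ℝ × Euc d → ℝ}
    (ha : ∀ i j, LocBounded T₀ D (a i j)) {K : Set (ℝ × Euc d)} (hK : IsClosed K)
    (hKD : K ⊆ Ioo 0 T₀ ×ˢ D) {f : ℝ × Euc d → ℝ} (hf : IntrinsicC2 hp B f)
    (hf0 : ∀ z ∉ K, f z = 0) : Measurable (energyDensity hp a f) := by
  unfold energyDensity
  refine Finset.measurable_fun_sum _ fun i _ => Finset.measurable_fun_sum _ fun j _ => ?_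
  exact ((ha i j).measurable_mul hD hKD (hf.contDx i).measurable
    (derivDx_eq_zero_off hp hK hf0 i)).mul (hf.contDx j).measurable

/-- A bound for `𝓛 f` in terms of bounds for the coefficients and for the derivatives of `f`. -/
theorem abs_opL_le {a : Fin p₀ → Fin p₀ → ℝ × Euc d → ℝ} {b : Fin p₀ → ℝ × Euc d → ℝ}
    {f : ℝ × Euc d → ℝ} {z : ℝ × Euc d} {A Cb : ℝ} {C : ℝ} (hA : 0 ≤ A) (hb : 0 ≤ Cb)
    (ha : ∀ i j, derivDx hp i (derivDx hp j f) z ≠ 0 → |a i j z| ≤ A)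
    (hb' : ∀ i, derivDx hp i f z ≠ 0 → |b i z| ≤ Cb)
    (h2 : ∀ i j, |derivDx hp i (derivDx hp j f) z| ≤ C) (h1 : ∀ i, |derivDx hp i f z| ≤ C)
    (hY : |derivY B f z| ≤ C) : |opL hp B a b f z| ≤ p₀ * (p₀ * (A * C)) + p₀ * (Cb * C) + C := by
  have hmul : ∀ {u v M : ℝ}, 0 ≤ M → (v ≠ 0 → |u| ≤ M) → |v| ≤ C → |u * v| ≤ M * C := by
    intro u v M hM hu hv
    by_cases h0 : v = 0
    · subst h0
      simpa using mul_nonneg hM ((abs_nonneg _).trans hv)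
    · rw [abs_mul]; exact mul_le_mul (hu h0) hv (abs_nonneg _) hM
  have e1 : |∑ i, ∑ j, a i j z * derivDx hp i (derivDx hp j f) z| ≤ p₀ * (p₀ * (A * C)) := by
    refine (Finset.abs_sum_le_sum_abs _ _).trans ?_
    refine (Finset.sum_le_card_nsmul _ _ (p₀ * (A * C)) fun i _ => ?_).trans_eq (by simp)
    refine (Finset.abs_sum_le_sum_abs _ _).trans ?_
    refine (Finset.sum_le_card_nsmul _ _ (A * C) fun j _ => ?_).trans_eq (by simp)
    exact hmul hA (ha i j) (h2 i j)
  have e2 : |∑ i, b i z * derivDx hp i f z| ≤ p₀ * (Cb * C) := by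
    refine (Finset.abs_sum_le_sum_abs _ _).trans ?_
    refine (Finset.sum_le_card_nsmul _ _ (Cb * C) fun i _ => ?_).trans_eq (by simp)
    exact hmul hb (hb' i) (h1 i)
  unfold opL
  refine (abs_add_le _ _).trans (add_le_add ((abs_add_le _ _).trans (add_le_add ?_ e2)) hY)
  rw [abs_mul, abs_of_pos (by norm_num : (0 : ℝ) < 1 / 2)]
  have := abs_nonneg (∑ i, ∑ j, a i j z * derivDx hp i (derivDx hp j f) z)
  linarith

/-- Bounds, uniform over a class of functions with common support, for `𝓛 f`. -/
theorem exists_bound_opL {a : Fin p₀ → Fin p₀ → ℝ × Euc d → ℝ}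
    {b : Fin p₀ → ℝ × Euc d → ℝ} (ha : ∀ i j, LocBounded T₀ D (a i j))
    (hb : ∀ i, LocBounded T₀ D (b i)) {K : Set (ℝ × Euc d)} (hK : IsCompact K)
    (hKD : K ⊆ Ioo 0 T₀ ×ˢ D) (C : ℝ) : ∃ C', ∀ f : ℝ × Euc d → ℝ, (∀ z ∉ K, f z = 0) →
      (∀ i j z, |derivDx hp i (derivDx hp j f) z| ≤ C) → (∀ i z, |derivDx hp i f z| ≤ C) →
      (∀ z, |derivY B f z| ≤ C) → ∀ z, |opL hp B a b f z| ≤ C' := by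
  choose A hA0 hA using fun i j => (ha i j).exists_bound hK hKD
  choose Cb hb0 hCb using fun i => (hb i).exists_bound hK hKD
  refine ⟨p₀ * (p₀ * ((∑ i, ∑ j, A i j) * C)) + p₀ * ((∑ i, Cb i) * C) + C,
    fun f hf0 h2 h1 hY z => ?_⟩
  have hz1 := fun i => derivDx_eq_zero_off hp hK.isClosed hf0 i
  refine abs_opL_le (Finset.sum_nonneg fun i _ => Finset.sum_nonneg fun j _ => hA0 i j)
    (Finset.sum_nonneg fun i _ => hb0 i) (fun i j h0 => ?_) (fun i h0 => ?_) (fun i j => h2 i j z)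
    (fun i => h1 i z) (hY z)
  · have hz : z ∈ K := by
      by_contra hz
      exact h0 (derivDx_eq_zero_off hp hK.isClosed (hz1 j) i z hz)
    refine (hA i j z hz).trans ((Finset.single_le_sum (f := fun j => A i j) (fun j _ => hA0 i j)
      (Finset.mem_univ j)).trans ?_)
    exact Finset.single_le_sum (f := fun i => ∑ j, A i j)
      (fun i _ => Finset.sum_nonneg fun j _ => hA0 i j) (Finset.mem_univ i)
  · have hz : z ∈ K := by
      by_contra hz
      exact h0 (hz1 i z hz)
    exact (hCb i z hz).trans (Finset.single_le_sum (f := Cb) (fun i _ => hb0 i) (Finset.mem_univ i))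

theorem IntrinsicC2.exists_bound {K : Set (ℝ × Euc d)} (hK : IsCompact K) {f : ℝ × Euc d → ℝ}
    (hf : IntrinsicC2 hp B f) (hf0 : ∀ z ∉ K, f z = 0) : ∃ C, (∀ z, |f z| ≤ C) ∧
      (∀ i j z, |derivDx hp i (derivDx hp j f) z| ≤ C) ∧ (∀ i z, |derivDx hp i f z| ≤ C) ∧
      (∀ z, |derivY B f z| ≤ C) := by
  have hz1 := fun i => derivDx_eq_zero_off hp hK.isClosed hf0 i
  obtain ⟨C0, h0⟩ := exists_bound_of_zero_off hK hf.cont hf0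
  obtain ⟨C1, h1⟩ := exists_bound_of_zero_off hK hf.contY (derivY_eq_zero_off B hK.isClosed hf0)
  choose C2 h2 using fun i => exists_bound_of_zero_off hK (hf.contDx i) (hz1 i)
  choose C3 h3 using fun i j => exists_bound_of_zero_off hK (hf.contDxx i j)
    (derivDx_eq_zero_off hp hK.isClosed (hz1 j) i)
  have hC0 : 0 ≤ C0 := (abs_nonneg _).trans (h0 0)
  have hC1 : 0 ≤ C1 := (abs_nonneg _).trans (h1 0)
  have hC2 : ∀ i, 0 ≤ C2 i := fun i => (abs_nonneg _).trans (h2 i 0)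
  have hC3 : ∀ i j, 0 ≤ C3 i j := fun i j => (abs_nonneg _).trans (h3 i j 0)
  have s2 : 0 ≤ ∑ i, C2 i := Finset.sum_nonneg fun i _ => hC2 i
  have s3 : ∀ i, 0 ≤ ∑ j, C3 i j := fun i => Finset.sum_nonneg fun j _ => hC3 i j
  have s4 : 0 ≤ ∑ i, ∑ j, C3 i j := Finset.sum_nonneg fun i _ => s3 i
  refine ⟨C0 + C1 + ∑ i, C2 i + ∑ i, ∑ j, C3 i j, fun z => ?_, fun i j z => ?_, fun i z => ?_,
    fun z => ?_⟩
  · linarith [h0 z]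
  · have e1 := Finset.single_le_sum (f := fun j => C3 i j) (fun j _ => hC3 i j) (Finset.mem_univ j)
    have e2 := Finset.single_le_sum (f := fun i => ∑ j, C3 i j) (fun i _ => s3 i)
      (Finset.mem_univ i)
    linarith [h3 i j z]
  · have e1 := Finset.single_le_sum (f := C2) (fun i _ => hC2 i) (Finset.mem_univ i)
    linarith [h2 i z]
  · linarith [h1 z]

theorem sum_dite_lt_mul (hp : p₀ ≤ d) (u : Fin p₀ → ℝ) (c : Fin d → ℝ) :
    ∑ i : Fin d, (if h : (i : ℕ) < p₀ then u ⟨i, h⟩ else 0) * c i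
      = ∑ i : Fin p₀, u i * c (Fin.castLE hp i) := by
  obtain ⟨k, rfl⟩ := Nat.exists_eq_add_of_le hp
  rw [Fin.sum_univ_add]
  simp
  rfl

theorem derivDx_eq_fderiv {f : ℝ × Euc d → ℝ} {s : ℝ} (hf : Differentiable ℝ fun x => f (s, x))
    (i : Fin p₀) (x : Euc d) :
    derivDx hp i f (s, x) = fderiv ℝ (fun x => f (s, x)) x (basisVec hp i) := by
  have h1 : HasDerivAt (fun δ : ℝ => x + δ • basisVec hp i) (basisVec hp i) 0 := by
    simpa using ((hasDerivAt_id (0 : ℝ)).smul_const (basisVec hp i)).const_add x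
  have h2 : HasFDerivAt (fun x => f (s, x)) (fderiv ℝ (fun x => f (s, x)) x)
      (x + (0 : ℝ) • basisVec hp i) := by
    simpa using (hf x).hasFDerivAt
  exact (h2.comp_hasDerivAt (0 : ℝ) h1).deriv

/-- The local drift `1_{i ≤ p₀} b_i(s,x) + (Bx)_i`. -/
noncomputable def driftAt (B : Matrix (Fin d) (Fin d) ℝ) (b : Fin p₀ → ℝ × Euc d → ℝ) (s : ℝ)
    (i : Fin d) (x : Euc d) : ℝ :=
  (if h : (i : ℕ) < p₀ then b ⟨i, h⟩ (s, x) else 0) + matOp B x i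

/-- The local covariance `1_{i,j ≤ p₀} a_{ij}(s,x)`. -/
noncomputable def diffusionAt (a : Fin p₀ → Fin p₀ → ℝ × Euc d → ℝ) (s : ℝ)
    (i j : Fin d) (x : Euc d) : ℝ :=
  if h : (i : ℕ) < p₀ ∧ (j : ℕ) < p₀ then a ⟨i, h.1⟩ ⟨j, h.2⟩ (s, x) else 0

/-- Formally Y - ⟨Bx, ∇⟩ is ∂_t, but ∂_t f may not exist, so the spatial generator is written as 𝓛f
- Yf + ⟨Bx, ∇f⟩, each term of which makes sense. The sums reduce to indices below p₀, apart from the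
linear drift. -/
theorem genOp_eq_opL {a : Fin p₀ → Fin p₀ → ℝ × Euc d → ℝ} {b : Fin p₀ → ℝ × Euc d → ℝ}
    {f : ℝ × Euc d → ℝ} {s : ℝ} (hf : ContDiff ℝ 2 fun x => f (s, x)) (x : Euc d) :
    genOp (driftAt B b s) (diffusionAt a s) (fun x => f (s, x)) x
      = opL hp B a b f (s, x) - derivY B f (s, x)
        + fderiv ℝ (fun x => f (s, x)) x (matOp B x) := by
  have hd : Differentiable ℝ fun x => f (s, x) := hf.differentiable (by norm_num)
  have hd2 : Differentiable ℝ (fderiv ℝ fun x => f (s, x)) :=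
    (hf.fderiv_right (m := 1) (by norm_num)).differentiable (by norm_num)
  have e1 : ∀ i : Fin p₀, (fun x => derivDx hp i f (s, x))
      = fun x => fderiv ℝ (fun x => f (s, x)) x (basisVec hp i) :=
    fun i => funext fun x => derivDx_eq_fderiv hd i x
  have e2 : ∀ i j : Fin p₀, derivDx hp i (derivDx hp j f) (s, x)
      = fderiv ℝ (fderiv ℝ fun x => f (s, x)) x (basisVec hp i) (basisVec hp j) := by
    intro i j
    have hd3 : HasFDerivAt (fun x => fderiv ℝ (fun x => f (s, x)) x (basisVec hp j))
        ((ContinuousLinearMap.apply ℝ ℝ (basisVec hp j)).comp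
          (fderiv ℝ (fderiv ℝ fun x => f (s, x)) x)) x :=
      (ContinuousLinearMap.apply ℝ ℝ (basisVec hp j)).hasFDerivAt.comp x (hd2 x).hasFDerivAt
    rw [derivDx_eq_fderiv, e1, hd3.fderiv]
    · rfl
    · rw [e1]
      exact fun y => ((ContinuousLinearMap.apply ℝ ℝ (basisVec hp j)).hasFDerivAt.comp y
        (hd2 y).hasFDerivAt).differentiableAt
  have e3 : fderiv ℝ (fun x => f (s, x)) x (matOp B x)
      = ∑ i, matOp B x i * fderiv ℝ (fun x => f (s, x)) x (EuclideanSpace.single i 1) := by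
    conv_lhs => rw [euc_eq_sum_single (matOp B x)]
    simp only [map_sum, map_smul, smul_eq_mul]
  have e4 : ∀ i j : Fin d, diffusionAt a s i j x = if h : (i : ℕ) < p₀ then
      (if h' : (j : ℕ) < p₀ then a ⟨i, h⟩ ⟨j, h'⟩ (s, x) else 0) else 0 := by
    intro i j
    unfold diffusionAt
    split_ifs <;> simp_all
  have e5 : ∑ i, ∑ j, diffusionAt a s i j x * fderiv ℝ (fderiv ℝ fun x => f (s, x)) x
        (EuclideanSpace.single i 1) (EuclideanSpace.single j 1)
      = ∑ i, ∑ j, a i j (s, x) * derivDx hp i (derivDx hp j f) (s, x) := by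
    have h1 : ∀ i, ∑ j, diffusionAt a s i j x * fderiv ℝ (fderiv ℝ fun x => f (s, x)) x
        (EuclideanSpace.single i 1) (EuclideanSpace.single j 1)
        = (if h : (i : ℕ) < p₀ then ∑ j, a ⟨i, h⟩ j (s, x) *
          fderiv ℝ (fderiv ℝ fun x => f (s, x)) x
            (EuclideanSpace.single i 1) (basisVec hp j) else 0) * 1 := by
      intro i
      simp only [e4, mul_one]
      split_ifs with h
      · exact sum_dite_lt_mul hp (fun j => a ⟨i, h⟩ j (s, x)) _
      · simp
    have h2 := sum_dite_lt_mul hp (fun i => ∑ j, a i j (s, x) *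
          fderiv ℝ (fderiv ℝ fun x => f (s, x)) x (basisVec hp i) (basisVec hp j)) fun _ => 1
    simp only [h1, e2]
    refine Eq.trans ?_ (h2.trans (by simp))
    rfl
  have e6 := sum_dite_lt_mul hp (fun i => b i (s, x))
    (fun i => fderiv ℝ (fun x => f (s, x)) x (EuclideanSpace.single i 1))
  rw [genOp, e5, e3]
  simp only [driftAt, add_mul, Finset.sum_add_distrib]
  rw [e6, opL]
  simp only [derivDx_eq_fderiv hd]
  simp only [basisVec]
  ring

theorem IsLocalDiffusion.eventually_generator {Ω : Type*} {M : ContMarkovProcess d T₀ Ω}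
    {a : Fin p₀ → Fin p₀ → ℝ × Euc d → ℝ} {b : Fin p₀ → ℝ × Euc d → ℝ}
    (hM : IsLocalDiffusion hp M D B a b) (hD : IsOpen D) {s : ℝ} (hs : 0 ≤ s) (hsT : s < T₀)
    {g : Euc d → ℝ} (hg : ContDiff ℝ 2 g) (hgc : HasCompactSupport g) (hgD : tsupport g ⊆ D)
    {ε : ℝ} (hε : 0 < ε) :
    ∀ᶠ h in 𝓝[>] (0 : ℝ), ∀ x, |(∫ ξ, (g ξ - g x) ∂(M.p s (s + h) x)) / h
      - genOp (driftAt B b s) (diffusionAt a s) g x| ≤ ε := by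
  refine _root_.eventually_generator (κ := fun h => M.p s (s + h)) (D := D) ?_ hD ?_ ?_ ?_ ?_ ?_
    hg hgc hgD hε
  · have h1 : ∀ᶠ h in 𝓝[>] (0 : ℝ), h < T₀ - s :=
      nhdsWithin_le_nhds (gt_mem_nhds (by linarith))
    filter_upwards [h1, self_mem_nhdsWithin] with h h1 h2
    have h2 : 0 < h := h2
    exact M.isMarkovKernel s (s + h) hs (by linarith) (by linarith)
  · intro i H hH hHD
    unfold diffusionAt
    by_cases h : (i : ℕ) < p₀
    · obtain ⟨C, hC⟩ := (hM.locBounded_a ⟨i, h⟩ ⟨i, h⟩).2 ({s} ×ˢ H) (isCompact_singleton.prod hH)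
        (Set.prod_mono (singleton_subset_iff.2 (mem_Ico.2 ⟨hs, hsT⟩)) hHD)
      exact ⟨C, fun x hx => by simpa [h] using hC (s, x) ⟨rfl, hx⟩⟩
    · exact ⟨0, fun x _ => by simp [h]⟩
  · intro δ hδ H hH hHD
    simpa only [add_sub_cancel_left] using (hM.lim_jump_into s hs hsT δ hδ H hH hHD).1
  · intro δ hδ H hH hHD
    simpa only [add_sub_cancel_left] using (hM.lim_jump_from s hs hsT δ hδ H hH hHD).1
  · intro δ hδ H hH hHD i
    have := (hM.lim_drift s hs hsT δ hδ H hH hHD i).1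
    simp only [add_sub_cancel_left] at this
    exact this
  · intro δ hδ H hH hHD i j
    have := (hM.lim_diffusion s hs hsT δ hδ H hH hHD i j).1
    simp only [add_sub_cancel_left] at this
    exact this

end Operator

/-! ### Markov processes under a fixed law -/

section Markov

/-- Under the law `P`, the process `Z` on `[t, T₀[` has continuous paths, is adapted to `F` and is
Markov with transition kernels `p`. -/
structure IsMarkovUnder {Ω : Type*} {mΩ : MeasurableSpace Ω} {d : ℕ} (P : Measure Ω)
    (F : ℝ → MeasurableSpace Ω) (Z : ℝ → Ω → Euc d) (p : ℝ → ℝ → Kernel (Euc d) (Euc d))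
    (t T₀ : ℝ) : Prop where
  le : ∀ s ∈ Ico t T₀, F s ≤ mΩ
  mono : ∀ s ∈ Ico t T₀, ∀ T ∈ Ico t T₀, s ≤ T → F s ≤ F T
  adapted : ∀ s ∈ Ico t T₀, Measurable[F s] (Z s)
  cont : ∀ ω, ContinuousOn (fun s => Z s ω) (Ico t T₀)
  kernel : ∀ s T, t ≤ s → s < T → T < T₀ → IsMarkovKernel (p s T)
  markov : ∀ s T, t ≤ s → s < T → T < T₀ → ∀ A : Set (Euc d), MeasurableSet A →
    P⟦Z T ⁻¹' A | F s⟧ =ᵐ[P] fun ω => (p s T (Z s ω)).real A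

variable {Ω : Type*} {mΩ : MeasurableSpace Ω} {d : ℕ} {P : Measure Ω}
  {F : ℝ → MeasurableSpace Ω} {Z : ℝ → Ω → Euc d} {p : ℝ → ℝ → Kernel (Euc d) (Euc d)} {t T₀ : ℝ}

theorem integral_kernel_comp {α β : Type*} {mα : MeasurableSpace α} {mβ : MeasurableSpace β}
    {κ : Kernel α β} {μ : Measure α} [IsFiniteMeasure μ] [IsMarkovKernel κ] {g : β → ℝ}
    (hg : Integrable g (κ ∘ₘ μ)) : ∫ y, g y ∂(κ ∘ₘ μ) = ∫ x, ∫ y, g y ∂(κ x) ∂μ := by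
  rw [Measure.comp_eq_comp_const_apply] at hg ⊢
  rw [Kernel.integral_comp hg, Kernel.const_apply]

theorem IsMarkovUnder.measurable (h : IsMarkovUnder P F Z p t T₀) {s : ℝ} (hs : s ∈ Ico t T₀) :
    Measurable (Z s) := (h.adapted s hs).mono (h.le s hs) le_rfl

/-- The Markov property for single Borel sets, integrated over a past event `S`, becomes an identity
of finite measures, so it can be tested against functions. -/
theorem IsMarkovUnder.map_eq_comp [IsProbabilityMeasure P] (h : IsMarkovUnder P F Z p t T₀) {s T : ℝ} (hs : t ≤ s)
    (hsT : s < T) (hT : T < T₀) {S : Set Ω} (hS : MeasurableSet[F s] S) :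
    (P.restrict S).map (Z T) = (p s T) ∘ₘ ((P.restrict S).map (Z s)) := by
  have hs' : s ∈ Ico t T₀ := ⟨hs, hsT.trans hT⟩
  have hT' : T ∈ Ico t T₀ := ⟨hs.trans hsT.le, hT⟩
  have := h.kernel s T hs hsT hT
  have hmS : MeasurableSet S := h.le s hs' S hS
  ext A hA
  rw [Measure.map_apply (h.measurable hT') hA, Measure.bind_apply hA (p s T).aemeasurable,
    lintegral_map ((p s T).measurable_coe hA) (h.measurable hs')]
  have hmA : MeasurableSet (Z T ⁻¹' A) := h.measurable hT' hA
  have e1 : ∫ ω in S, (p s T (Z s ω)).real A ∂P = (P.restrict S).real (Z T ⁻¹' A) := by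
    rw [← setIntegral_congr_ae hmS ((h.markov s T hs hsT hT A hA).mono fun ω hω _ => hω),
      setIntegral_condExp (h.le s hs') ((integrable_const _).indicator hmA) hS,
      integral_indicator hmA]
    simp
  have e2 : Integrable (fun ω => (p s T (Z s ω)).real A) (P.restrict S) := by
    refine Integrable.of_bound (C := 1) ?_ (ae_of_all _ fun ω => ?_)
    · exact (((p s T).measurable_coe hA).comp (h.measurable hs')).ennreal_toReal.aestronglyMeasurable
    · rw [Real.norm_of_nonneg measureReal_nonneg]
      exact measureReal_le_one
  have e3 := ofReal_integral_eq_lintegral_ofReal e2 (ae_of_all _ fun ω => measureReal_nonneg)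
  rw [e1, ofReal_measureReal] at e3
  rw [e3]
  exact lintegral_congr fun ω => ofReal_measureReal

/-- The conditional expectation of g(Z_T) given the past is the kernel average at Z_s, as its
integrals over past events show; the bounded past weight is then pulled out. -/
theorem IsMarkovUnder.integral_mul [IsProbabilityMeasure P] (h : IsMarkovUnder P F Z p t T₀) {s T : ℝ} (hs : t ≤ s)
    (hsT : s < T) (hT : T < T₀) {W : Ω → ℝ} (hW : StronglyMeasurable[F s] W) {C : ℝ}
    (hWC : ∀ ω, |W ω| ≤ C) {g : Euc d → ℝ} (hg : Continuous g) {M : ℝ} (hgM : ∀ x, |g x| ≤ M) :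
    ∫ ω, W ω * g (Z T ω) ∂P = ∫ ω, W ω * ∫ ξ, g ξ ∂(p s T (Z s ω)) ∂P := by
  have hs' : s ∈ Ico t T₀ := ⟨hs, hsT.trans hT⟩
  have hT' : T ∈ Ico t T₀ := ⟨hs.trans hsT.le, hT⟩
  have := h.kernel s T hs hsT hT
  have hle := h.le s hs'
  set κg : Euc d → ℝ := fun x => ∫ ξ, g ξ ∂(p s T x) with hκg
  have hκm : StronglyMeasurable κg := StronglyMeasurable.integral_kernel hg.stronglyMeasurable
  have hκb : ∀ x, ‖κg x‖ ≤ M := fun x => by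
    refine (norm_integral_le_of_norm_le_const (ae_of_all _ hgM)).trans_eq ?_
    simp
  have hIntT : Integrable (fun ω => g (Z T ω)) P :=
    Integrable.of_bound (hg.measurable.comp (h.measurable hT')).aestronglyMeasurable M
      (ae_of_all _ fun ω => hgM _)
  have hκF : StronglyMeasurable[F s] fun ω => κg (Z s ω) :=
    hκm.comp_measurable (h.adapted s hs')
  have hIntS : Integrable (fun ω => κg (Z s ω)) P :=
    Integrable.of_bound (hκF.mono hle).aestronglyMeasurable M (ae_of_all _ fun ω => hκb _)
  have hce : (fun ω => κg (Z s ω)) =ᵐ[P] P[fun ω => g (Z T ω) | F s] := by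
    refine ae_eq_condExp_of_forall_setIntegral_eq hle hIntT (fun S _ _ => hIntS.integrableOn)
      (fun S hS _ => ?_) hκF.aestronglyMeasurable
    have e := h.map_eq_comp hs hsT hT hS
    rw [← integral_map (φ := Z s) (f := κg) (h.measurable hs').aemeasurable
        hκm.aestronglyMeasurable,
      ← integral_map (φ := Z T) (f := g) (h.measurable hT').aemeasurable
        hg.aestronglyMeasurable, e, integral_kernel_comp]
    rw [← e]
    exact Integrable.of_bound hg.aestronglyMeasurable M (ae_of_all _ hgM)
  have h1 := condExp_stronglyMeasurable_mul_of_bound hle hW hIntT C (ae_of_all _ hWC)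
  have h2 : ∫ ω, W ω * g (Z T ω) ∂P = ∫ ω, (P[W * fun ω => g (Z T ω) | F s]) ω ∂P :=
    (integral_condExp hle).symm
  rw [h2]
  refine integral_congr_ae ?_
  filter_upwards [h1, hce] with ω h3 h4
  rw [h3, Pi.mul_apply, ← h4]

/-- The process stopped outside `[t, T]`. -/
def clampPath (Z : ℝ → Ω → Euc d) (t T : ℝ) (u : ℝ) (ω : Ω) : Euc d := Z (max t (min u T)) ω

theorem clampPath_eq {t T u : ℝ} (hu : u ∈ Icc t T) : clampPath Z t T u = Z u := by
  funext ω
  rw [clampPath, min_eq_left hu.2, max_eq_right hu.1]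

theorem IsMarkovUnder.continuous_clampPath (h : IsMarkovUnder P F Z p t T₀) {T : ℝ}
    (hT : T ∈ Ico t T₀) (ω : Ω) : Continuous fun u => clampPath Z t T u ω := by
  refine (h.cont ω).comp_continuous (f := fun u => max t (min u T)) (by fun_prop) fun u => ?_
  exact ⟨le_max_left _ _, max_lt (hT.1.trans_lt hT.2) ((min_le_right _ _).trans_lt hT.2)⟩

/-- Continuous paths together with adaptedness give joint measurability in time and ω. Clamping time
to [t, T] makes the paths continuous on all of ℝ and keeps them measurable for `F T`. -/
theorem IsMarkovUnder.measurable_clampPath (h : IsMarkovUnder P F Z p t T₀) {T : ℝ}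
    (hT : T ∈ Ico t T₀) :
    Measurable[Prod.instMeasurableSpace (m₂ := F T)] (Function.uncurry (clampPath Z t T)) := by
  refine measurable_uncurry_of_continuous_of_measurable (m := F T)
    (h.continuous_clampPath hT) fun u => ?_
  have hu : max t (min u T) ∈ Ico t T₀ :=
    ⟨le_max_left _ _, max_lt (hT.1.trans_lt hT.2) ((min_le_right _ _).trans_lt hT.2)⟩
  exact (h.adapted _ hu).mono (h.mono _ hu T hT (max_le hT.1 (min_le_right _ _))) le_rfl

theorem IsMarkovUnder.measurable_comp_clampPath (h : IsMarkovUnder P F Z p t T₀) {T : ℝ}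
    (hT : T ∈ Ico t T₀) {L : ℝ × Euc d → ℝ} (hL : Measurable L) :
    Measurable[Prod.instMeasurableSpace (m₂ := F T)]
      fun q : ℝ × Ω => L (q.1, clampPath Z t T q.1 q.2) := by
  have h1 := h.measurable_clampPath hT
  let _ := F T
  exact hL.comp (measurable_fst.prodMk h1)

theorem IsMarkovUnder.measurable_comp_clampPath' (h : IsMarkovUnder P F Z p t T₀) {T : ℝ}
    (hT : T ∈ Ico t T₀) {L : ℝ × Euc d → ℝ} (hL : Measurable L) :
    Measurable fun q : ℝ × Ω => L (q.1, clampPath Z t T q.1 q.2) :=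
  (h.measurable_comp_clampPath hT hL).mono
    (sup_le_sup le_rfl (MeasurableSpace.comap_mono (h.le T hT))) le_rfl

theorem integral_comp_clampPath {L : ℝ × Euc d → ℝ} {r T' T : ℝ} (hr : t ≤ r) (hrT : r ≤ T')
    (hT : T' ≤ T) (ω : Ω) : ∫ u in r..T', L (u, Z u ω) = ∫ u in r..T', L (u, clampPath Z t T u ω) := by
  refine intervalIntegral.integral_congr fun u hu => ?_
  rw [uIcc_of_le hrT] at hu
  simp only [clampPath_eq (⟨hr.trans hu.1, hu.2.trans hT⟩ : u ∈ Icc t T)]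

/-- The time integral of a bounded measurable function along the process. -/
theorem IsMarkovUnder.intervalIntegrable (h : IsMarkovUnder P F Z p t T₀) {T : ℝ}
    (hT : T ∈ Ico t T₀) {L : ℝ × Euc d → ℝ} (hL : Measurable L) {C : ℝ} (hC : ∀ z, |L z| ≤ C)
    {r : ℝ} (hr : t ≤ r) (hrT : r ≤ T) (ω : Ω) :
    IntervalIntegrable (fun u => L (u, Z u ω)) volume r T := by
  have h1 : IntervalIntegrable (fun u => L (u, clampPath Z t T u ω)) volume r T := by
    have hm : Measurable fun u => L (u, clampPath Z t T u ω) :=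
      hL.comp (measurable_id.prodMk (h.continuous_clampPath hT ω).measurable)
    rw [intervalIntegrable_iff]
    exact Measure.integrableOn_of_bounded (by simp) hm.aestronglyMeasurable
      (ae_of_all _ fun u => hC _)
  refine h1.congr ?_
  rw [uIoc_of_le hrT]
  refine fun u hu => ?_
  simp only [clampPath_eq (⟨hr.trans hu.1.le, hu.2⟩ : u ∈ Icc t T)]

theorem IsMarkovUnder.stronglyMeasurable_integral (h : IsMarkovUnder P F Z p t T₀) {T : ℝ}
    (hT : T ∈ Ico t T₀) {L : ℝ × Euc d → ℝ} (hL : Measurable L) {r : ℝ} (hr : t ≤ r)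
    (hrT : r ≤ T) : StronglyMeasurable[F T] fun ω => ∫ u in r..T, L (u, Z u ω) := by
  have e : (fun ω => ∫ u in r..T, L (u, Z u ω))
      = fun ω => ∫ u in Ioc r T, L (u, clampPath Z t T u ω) := by
    funext ω
    rw [integral_comp_clampPath hr hrT le_rfl, intervalIntegral.integral_of_le hrT]
  rw [e]
  have h1 := h.measurable_comp_clampPath hT hL
  let _ := F T
  exact h1.stronglyMeasurable.integral_prod_left'

theorem abs_integral_path_le {L : ℝ × Euc d → ℝ} {C : ℝ} (hC : ∀ z, |L z| ≤ C)
    {r T : ℝ} (hrT : r ≤ T) (ω : Ω) : |∫ u in r..T, L (u, Z u ω)| ≤ C * (T - r) := by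
  have := intervalIntegral.norm_integral_le_of_norm_le_const (a := r) (b := T)
    (f := fun u => L (u, Z u ω)) (C := C) fun u _ => hC _
  rwa [abs_of_nonneg (sub_nonneg.2 hrT)] at this

/-- Fubini's theorem for a weighted time integral along the process. -/
theorem IsMarkovUnder.integral_swap [IsProbabilityMeasure P] (h : IsMarkovUnder P F Z p t T₀) {T : ℝ}
    (hT : T ∈ Ico t T₀) {L : ℝ × Euc d → ℝ} (hL : Measurable L) {C : ℝ} (hC : ∀ z, |L z| ≤ C)
    {W : Ω → ℝ} (hW : Measurable W) {C' : ℝ} (hWC : ∀ ω, |W ω| ≤ C') {r : ℝ} (hr : t ≤ r)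
    (hrT : r ≤ T) :
    IntervalIntegrable (fun u => ∫ ω, W ω * L (u, Z u ω) ∂P) volume r T ∧
    ∫ u in r..T, ∫ ω, W ω * L (u, Z u ω) ∂P = ∫ ω, W ω * (∫ u in r..T, L (u, Z u ω)) ∂P := by
  have hm : Measurable fun q : ℝ × Ω => W q.2 * L (q.1, clampPath Z t T q.1 q.2) :=
    (hW.comp measurable_snd).mul (h.measurable_comp_clampPath' hT hL)
  have hb : ∀ q : ℝ × Ω, ‖W q.2 * L (q.1, clampPath Z t T q.1 q.2)‖ ≤ C' * C := fun q => by
    rw [norm_mul]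
    exact mul_le_mul (hWC _) (hC _) (norm_nonneg _) ((abs_nonneg _).trans (hWC q.2))
  have : IsFiniteMeasure (volume.restrict (uIoc r T)) := ⟨by simp⟩
  have hInt : Integrable (Function.uncurry fun u ω => W ω * L (u, clampPath Z t T u ω))
      ((volume.restrict (uIoc r T)).prod P) :=
    Integrable.of_bound hm.aestronglyMeasurable (C' * C) (ae_of_all _ hb)
  have heq : ∀ u ∈ Icc r T, ∫ ω, W ω * L (u, Z u ω) ∂P
      = ∫ ω, W ω * L (u, clampPath Z t T u ω) ∂P := by
    intro u hu
    simp only [clampPath_eq (⟨hr.trans hu.1, hu.2⟩ : u ∈ Icc t T)]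
  constructor
  · have h1 : IntervalIntegrable (fun u => ∫ ω, W ω * L (u, clampPath Z t T u ω) ∂P) volume r T := by
      rw [intervalIntegrable_iff]
      exact hInt.integral_prod_left
    refine h1.congr ?_
    rw [uIoc_of_le hrT]
    exact fun u hu => (heq u (Ioc_subset_Icc_self hu)).symm
  · rw [intervalIntegral.integral_congr (g := fun u => ∫ ω, W ω * L (u, clampPath Z t T u ω) ∂P),
      intervalIntegral_integral_swap hInt]
    · refine integral_congr_ae (ae_of_all _ fun ω => ?_)
      simp only [intervalIntegral.integral_const_mul]
      rw [integral_comp_clampPath (Z := Z) hr hrT le_rfl]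
    · intro u hu
      rw [uIcc_of_le hrT] at hu
      exact heq u hu

end Markov

/-! ### Dynkin's formula -/

section Dynkin

/-- The base point moves with δ, so the derivative at one point is not enough. The mean value
theorem turns the quotient into a value of `v` on the orbit at a parameter in (0, δ), and joint
continuity concludes. -/
theorem HasDerivAlong.tendsto_quotient {V : Type*} [TopologicalSpace V] {ψ : ℝ → V → V}
    (hψ : IsFlow ψ) {u v : V → ℝ} (h : HasDerivAlong ψ u v) (hv : Continuous v) {w : ℝ → V} {z : V}
    (hw : Tendsto w (𝓝[>] 0) (𝓝 z)) :
    Tendsto (fun δ => (u (ψ δ (w δ)) - u (w δ)) / δ) (𝓝[>] 0) (𝓝 (v z)) := by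
  rw [Metric.tendsto_nhds]
  intro ε hε
  have hc : ∀ᶠ q in 𝓝 (0 : ℝ) ×ˢ 𝓝 z, dist (v (ψ q.1 q.2)) (v z) < ε := by
    rw [← nhds_prod_eq]
    have h1 : Continuous fun q : ℝ × V => dist (v (ψ q.1 q.2)) (v z) :=
      (hv.comp hψ.cont).dist continuous_const
    exact h1.continuousAt.eventually_lt_const (by simpa [hψ.zero] using hε)
  obtain ⟨pa, ha, pb, hb, hab⟩ := eventually_prod_iff.1 hc
  obtain ⟨ρ, hρ, hρ'⟩ := Metric.eventually_nhds_iff.1 ha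
  have h1 : ∀ᶠ δ in 𝓝[>] (0 : ℝ), δ < ρ := nhdsWithin_le_nhds (gt_mem_nhds hρ)
  filter_upwards [h1, hw.eventually hb, self_mem_nhdsWithin] with δ h2 h3 h4
  have h4 : 0 < δ := h4
  have hd := h.hasDerivAt hψ (w δ)
  obtain ⟨θ, hθ, he⟩ := exists_hasDerivAt_eq_slope (fun η => u (ψ η (w δ)))
    (fun η => v (ψ η (w δ))) h4 (fun η _ => (hd η).continuousAt.continuousWithinAt)
    fun η _ => hd η
  simp only [hψ.zero, sub_zero] at he
  rw [← he]
  refine hab (hρ' ?_) h3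
  rw [Real.dist_eq, sub_zero, abs_of_pos hθ.1]
  exact hθ.2.trans h2

variable {d : ℕ} (B : Matrix (Fin d) (Fin d) ℝ)

theorem isFlow_expB_neg : IsFlow fun δ (x : Euc d) => expB B (-δ) x where
  cont := by fun_prop
  zero x := by simp
  add δ η x := by rw [neg_add, expB_add_apply]

/-- Pulling back by e^{-δB} at a frozen time gives the correction that later cancels the linear
drift of the generator. -/
theorem hasDerivAlong_expB_neg {g : Euc d → ℝ} (hg : Differentiable ℝ g) :
    HasDerivAlong (fun δ (x : Euc d) => expB B (-δ) x) g fun x => -fderiv ℝ g x (matOp B x) := by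
  intro x
  have h0 : HasDerivAt (fun δ => expB B δ x) (matOp B x) (-(0 : ℝ)) := by
    have h := (ContinuousLinearMap.apply ℝ (Euc d) x).hasFDerivAt.comp_hasDerivAt (-(0 : ℝ))
      (hasDerivAt_expB B (-(0 : ℝ)))
    refine h.congr_deriv ?_
    rw [neg_zero, expB_zero, mul_one]
    rfl
  have h1 : HasDerivAt (fun δ : ℝ => expB B (-δ) x) (-matOp B x) 0 := by
    have := HasDerivAt.scomp (h := fun δ : ℝ => -δ) (0 : ℝ) h0 (hasDerivAt_neg (0 : ℝ))
    exact this.congr_deriv (by rw [neg_smul, one_smul])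
  have h2 : HasFDerivAt g (fderiv ℝ g x) (expB B (-(0 : ℝ)) x) := by
    simpa using (hg x).hasFDerivAt
  exact (h2.comp_hasDerivAt (0 : ℝ) h1).congr_deriv (by rw [map_neg])

variable {Ω : Type*} {mΩ : MeasurableSpace Ω} {P : Measure Ω}
  {F : ℝ → MeasurableSpace Ω} {Z : ℝ → Ω → Euc d} {p : ℝ → ℝ → Kernel (Euc d) (Euc d)} {t T₀ : ℝ}

theorem IsMarkovUnder.tendsto_path (h : IsMarkovUnder P F Z p t T₀) {r : ℝ} (hr : r ∈ Ico t T₀)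
    (ω : Ω) : Tendsto (fun δ => Z (r + δ) ω) (𝓝[>] 0) (𝓝 (Z r ω)) := by
  have h1 := (h.cont ω r hr).tendsto
  refine h1.comp (tendsto_nhdsWithin_iff.2 ⟨?_, ?_⟩)
  · have : Tendsto (fun δ : ℝ => r + δ) (𝓝 0) (𝓝 (r + 0)) :=
      (continuous_const.add continuous_id).tendsto 0
    rw [add_zero] at this
    exact this.mono_left nhdsWithin_le_nhds
  · have h1 : ∀ᶠ δ in 𝓝[>] (0 : ℝ), δ < T₀ - r :=
      nhdsWithin_le_nhds (gt_mem_nhds (by linarith [hr.2]))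
    filter_upwards [h1, self_mem_nhdsWithin] with δ h1 h2
    have h2 : 0 < δ := h2
    exact ⟨by linarith [hr.1], by linarith⟩

theorem eventually_mem_Ico {r : ℝ} (hr : r ∈ Ico t T₀) :
    ∀ᶠ δ in 𝓝[>] (0 : ℝ), 0 < δ ∧ r + δ ∈ Ico t T₀ := by
  have h1 : ∀ᶠ δ in 𝓝[>] (0 : ℝ), δ < T₀ - r :=
    nhdsWithin_le_nhds (gt_mem_nhds (by linarith [hr.2]))
  filter_upwards [h1, self_mem_nhdsWithin] with δ h1 h2
  have h2 : 0 < δ := h2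
  exact ⟨h2, by linarith [hr.1], by linarith⟩

variable [IsProbabilityMeasure P]

/-- Differentiation of an expectation along a flow, at a moving random point. -/
theorem tendsto_integral_quotient {V : Type*} [TopologicalSpace V] {ψ : ℝ → V → V}
    (hψ : IsFlow ψ) {u v : V → ℝ} (h : HasDerivAlong ψ u v) (hv : Continuous v) {C : ℝ}
    (hC : ∀ z, |v z| ≤ C) {W : Ω → ℝ} (hW : Measurable W) {C' : ℝ} (hWC : ∀ ω, |W ω| ≤ C')
    {w : ℝ → Ω → V} {z : Ω → V} (hw : ∀ ω, Tendsto (fun δ => w δ ω) (𝓝[>] 0) (𝓝 (z ω)))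
    (hm : ∀ᶠ δ in 𝓝[>] (0 : ℝ), Measurable fun ω => u (ψ δ (w δ ω)) - u (w δ ω)) :
    Tendsto (fun δ => (∫ ω, W ω * (u (ψ δ (w δ ω)) - u (w δ ω)) ∂P) / δ) (𝓝[>] 0)
      (𝓝 (∫ ω, W ω * v (z ω) ∂P)) := by
  have h1 : Tendsto (fun δ => ∫ ω, W ω * ((u (ψ δ (w δ ω)) - u (w δ ω)) / δ) ∂P) (𝓝[>] 0)
      (𝓝 (∫ ω, W ω * v (z ω) ∂P)) := by
    refine tendsto_integral_filter_of_dominated_convergence (fun _ => C' * C) ?_ ?_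
      (integrable_const _) (ae_of_all _ fun ω => ?_)
    · filter_upwards [hm] with δ hδ
      exact (hW.mul (hδ.div_const δ)).aestronglyMeasurable
    · filter_upwards [self_mem_nhdsWithin] with δ hδ
      have hδ : 0 < δ := hδ
      refine ae_of_all _ fun ω => ?_
      rw [norm_mul]
      refine mul_le_mul (hWC ω) ?_ (norm_nonneg _) ((abs_nonneg _).trans (hWC ω))
      rw [norm_div, Real.norm_eq_abs, Real.norm_eq_abs, abs_of_pos hδ, div_le_iff₀ hδ]
      exact (h.abs_sub_le hψ hC δ _).trans_eq (by rw [abs_of_pos hδ])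
    · exact (h.tendsto_quotient hψ hv (hw ω)).const_mul _
  refine h1.congr fun δ => ?_
  rw [← integral_div]
  exact integral_congr_ae (ae_of_all _ fun ω => by simp only [mul_div_assoc])

/-- The right derivative of `E[W g(Z_r)]` when the generator converges uniformly. -/
theorem IsMarkovUnder.tendsto_generator (h : IsMarkovUnder P F Z p t T₀) {r : ℝ}
    (hr : r ∈ Ico t T₀) {W : Ω → ℝ} (hW : StronglyMeasurable[F r] W) {C' : ℝ}
    (hWC : ∀ ω, |W ω| ≤ C') {g : Euc d → ℝ} (hg : Continuous g) {M : ℝ} (hgM : ∀ x, |g x| ≤ M)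
    {G : Euc d → ℝ} (hG : Measurable G) {M' : ℝ} (hGM : ∀ x, |G x| ≤ M')
    (hgen : ∀ ε > 0, ∀ᶠ δ in 𝓝[>] (0 : ℝ), ∀ x,
      |(∫ ξ, (g ξ - g x) ∂(p r (r + δ) x)) / δ - G x| ≤ ε) :
    Tendsto (fun δ => (∫ ω, W ω * (g (Z (r + δ) ω) - g (Z r ω)) ∂P) / δ) (𝓝[>] 0)
      (𝓝 (∫ ω, W ω * G (Z r ω) ∂P)) := by
  have hle := h.le r hr
  have hWm : Measurable W := (hW.mono hle).measurable
  have hC' : 0 < |C'| + 1 := by positivity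
  have hInt : ∀ {u : Ω → ℝ} {K : ℝ}, Measurable u → (∀ ω, |u ω| ≤ K) →
      Integrable (fun ω => W ω * u ω) P := fun {u K} hu hK =>
    (Integrable.of_bound hu.aestronglyMeasurable K (ae_of_all _ hK)).bdd_mul
      hWm.aestronglyMeasurable (ae_of_all _ hWC)
  rw [Metric.tendsto_nhds]
  intro ε hε
  filter_upwards [hgen (ε / (2 * (|C'| + 1))) (by positivity), eventually_mem_Ico hr]
    with δ h1 ⟨hδ, hrδ⟩
  have := h.kernel r (r + δ) hr.1 (by linarith) hrδ.2
  have hgint : ∀ x, Integrable g (p r (r + δ) x) := fun x =>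
    Integrable.of_bound hg.aestronglyMeasurable M (ae_of_all _ hgM)
  have hκm : Measurable fun ω => ∫ ξ, g ξ ∂(p r (r + δ) (Z r ω)) :=
    (StronglyMeasurable.integral_kernel hg.stronglyMeasurable).measurable.comp (h.measurable hr)
  have hκb : ∀ ω, |∫ ξ, g ξ ∂(p r (r + δ) (Z r ω))| ≤ M := fun ω => by
    rw [← Real.norm_eq_abs]
    refine (norm_integral_le_of_norm_le_const (ae_of_all _ hgM)).trans_eq ?_
    simp
  have hgr : Measurable fun ω => g (Z r ω) := hg.measurable.comp (h.measurable hr)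
  have hgδ : Measurable fun ω => g (Z (r + δ) ω) := hg.measurable.comp (h.measurable hrδ)
  -- By the Markov property the increment is replaced by its mean under the kernel started at Z_r,
  -- to which the uniform limit `hgen` applies.
  have e1 : ∫ ω, W ω * (g (Z (r + δ) ω) - g (Z r ω)) ∂P
      = ∫ ω, W ω * ∫ ξ, (g ξ - g (Z r ω)) ∂(p r (r + δ) (Z r ω)) ∂P := by
    simp only [integral_sub (hgint _) (integrable_const _), mul_sub]
    rw [integral_sub (hInt hgδ fun ω => hgM _) (hInt hgr fun ω => hgM _),
      integral_sub (hInt hκm hκb) (hInt (by simpa using hgr) fun ω => by simpa using hgM _),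
      h.integral_mul hr.1 (by linarith) hrδ.2 hW hWC hg hgM]
    simp
  have hdm : Measurable fun ω => ∫ ξ, (g ξ - g (Z r ω)) ∂(p r (r + δ) (Z r ω)) := by
    simp only [integral_sub (hgint _) (integrable_const _)]
    exact hκm.sub (by simpa using hgr)
  have hdb : ∀ ω, |∫ ξ, (g ξ - g (Z r ω)) ∂(p r (r + δ) (Z r ω))| ≤ 2 * M := fun ω => by
    simp only [integral_sub (hgint _) (integrable_const _)]
    refine (abs_sub _ _).trans ?_
    simpa [two_mul] using add_le_add (hκb ω) (hgM (Z r ω))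
  have e2 : (∫ ω, W ω * (g (Z (r + δ) ω) - g (Z r ω)) ∂P) / δ - ∫ ω, W ω * G (Z r ω) ∂P
      = ∫ ω, W ω * ((∫ ξ, (g ξ - g (Z r ω)) ∂(p r (r + δ) (Z r ω))) / δ - G (Z r ω)) ∂P := by
    rw [e1, ← integral_div, ← integral_sub]
    · refine integral_congr_ae (ae_of_all _ fun ω => ?_)
      simp only; ring
    · exact (hInt hdm hdb).div_const δ
    · exact hInt (hG.comp (h.measurable hr)) fun ω => hGM _
  rw [Real.dist_eq, e2]
  have e3 : ‖∫ ω, W ω * ((∫ ξ, (g ξ - g (Z r ω)) ∂(p r (r + δ) (Z r ω))) / δ - G (Z r ω)) ∂P‖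
      ≤ (|C'| + 1) * (ε / (2 * (|C'| + 1))) := by
    refine (norm_integral_le_of_norm_le_const (ae_of_all _ fun ω => ?_)).trans_eq
      (by rw [probReal_univ, mul_one])
    rw [norm_mul]
    refine mul_le_mul ((hWC ω).trans ?_) (h1 _) (norm_nonneg _) hC'.le
    linarith [le_abs_self C']
  rw [Real.norm_eq_abs] at e3
  refine e3.trans_lt ?_
  have : (|C'| + 1) * (ε / (2 * (|C'| + 1))) = ε / 2 := by field_simp
  rw [this]; linarith

variable {p₀ : ℕ} {hp : p₀ ≤ d} {B} {D : Set (Euc d)} {Ω' : Type*} {M : ContMarkovProcess d T₀ Ω'}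
  {a : Fin p₀ → Fin p₀ → ℝ × Euc d → ℝ} {b : Fin p₀ → ℝ × Euc d → ℝ}

theorem integral_add_add {Ω : Type*} {mΩ : MeasurableSpace Ω} {P : Measure Ω} {u v w : Ω → ℝ}
    (hu : Integrable u P) (hv : Integrable v P) (hw : Integrable w P) :
    ∫ ω, u ω ∂P + ∫ ω, v ω ∂P + ∫ ω, w ω ∂P = ∫ ω, u ω + v ω + w ω ∂P := by
  rw [← integral_add hu hv]
  exact (integral_add (hu.add hv) hw).symm

theorem section_support {K : Set (ℝ × Euc d)} (hK : IsCompact K) (hKD : K ⊆ Ioo 0 T₀ ×ˢ D)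
    {f : ℝ × Euc d → ℝ} (hf0 : ∀ z ∉ K, f z = 0) (s : ℝ) :
    HasCompactSupport (fun x => f (s, x)) ∧ tsupport (fun x => f (s, x)) ⊆ D := by
  have hKs : IsCompact ((fun x : Euc d => (s, x)) ⁻¹' K) := by
    refine (hK.image continuous_snd).of_isClosed_subset
      (hK.isClosed.preimage (by fun_prop)) fun x hx => ⟨(s, x), hx, rfl⟩
  have hsub : tsupport (fun x => f (s, x)) ⊆ (fun x : Euc d => (s, x)) ⁻¹' K := by
    refine closure_minimal (fun x hx => ?_) hKs.isClosed
    by_contra hxK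
    exact hx (hf0 _ hxK)
  exact ⟨hKs.of_isClosed_subset (isClosed_tsupport _) hsub, fun x hx => (hKD (hsub hx)).2⟩

/-- The right derivative of `E[W f(r, Z_r)]` is `E[W 𝓛f(r, Z_r)]` if `f` is smooth in `x`. -/
theorem IsMarkovUnder.tendsto_opL (h : IsMarkovUnder P F Z M.p t T₀) (ht : 0 ≤ t)
    (hM : IsLocalDiffusion hp M D B a b) (hD : IsOpen D) {K : Set (ℝ × Euc d)} (hK : IsCompact K)
    (hKD : K ⊆ Ioo 0 T₀ ×ˢ D) {f : ℝ × Euc d → ℝ} (hf : IntrinsicC2 hp B f)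
    (hf0 : ∀ z ∉ K, f z = 0) (hfx : ∀ s, ContDiff ℝ 2 fun x => f (s, x)) {r : ℝ}
    (hr : r ∈ Ico t T₀) {W : Ω → ℝ} (hW : StronglyMeasurable[F r] W) {C' : ℝ}
    (hWC : ∀ ω, |W ω| ≤ C') :
    Tendsto (fun δ => (∫ ω, W ω * (f (r + δ, Z (r + δ) ω) - f (r, Z r ω)) ∂P) / δ) (𝓝[>] 0)
      (𝓝 (∫ ω, W ω * opL hp B a b f (r, Z r ω) ∂P)) := by
  have hWm : Measurable W := (hW.mono (h.le r hr)).measurable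
  have hInt : ∀ {u : Ω → ℝ} {K : ℝ}, Measurable u → (∀ ω, |u ω| ≤ K) →
      Integrable (fun ω => W ω * u ω) P := fun {u K} hu hK =>
    (Integrable.of_bound hu.aestronglyMeasurable K (ae_of_all _ hK)).bdd_mul
      hWm.aestronglyMeasurable (ae_of_all _ hWC)
  obtain ⟨C, hC, hC2, hC1, hCY⟩ := hf.exists_bound hK hf0
  obtain ⟨CL, hCL⟩ := exists_bound_opL (hp := hp) (B := B) hM.locBounded_a hM.locBounded_b hK hKD C
  have hLm := measurable_opL hD hM.locBounded_a hM.locBounded_b hK.isClosed hKD hf hf0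
  have hLb := hCL f hf0 hC2 hC1 hCY
  have hZr := h.measurable hr
  set g : Euc d → ℝ := fun x => f (r, x) with hg
  have hgd : ContDiff ℝ 2 g := hfx r
  have hgc : Continuous g := hgd.continuous
  obtain ⟨hgs, hgD⟩ := section_support hK hKD hf0 r
  set v : Euc d → ℝ := fun x => -fderiv ℝ g x (matOp B x) with hv
  have hvc : Continuous v := by
    have := hgd.continuous_fderiv (by norm_num)
    exact (this.clm_apply (matOp B).continuous).neg
  obtain ⟨Cv, hCv⟩ : ∃ Cv, ∀ x, |v x| ≤ Cv := by
    refine exists_bound_of_zero_off (K := tsupport g) hgs hvc fun x hx => ?_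
    have : fderiv ℝ g x = 0 := image_eq_zero_of_notMem_tsupport
      fun h => hx (tsupport_fderiv_subset ℝ h)
    simp [hv, this]
  set G : Euc d → ℝ := genOp (driftAt B b r) (diffusionAt a r) g with hG
  have hGeq : ∀ x, G x = opL hp B a b f (r, x) - derivY B f (r, x) - v x := fun x => by
    rw [hG, genOp_eq_opL (hp := hp) (hfx r), hv]; simp only [hg]; ring
  have hGm : Measurable G := by
    have : G = fun x => opL hp B a b f (r, x) - derivY B f (r, x) - v x := funext hGeq
    rw [this]
    exact ((hLm.comp measurable_prodMk_left).sub
      (hf.contY.measurable.comp measurable_prodMk_left)).sub hvc.measurable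
  have hGb : ∀ x, |G x| ≤ CL + C + Cv := fun x => by
    rw [hGeq]
    exact (abs_sub _ _).trans (add_le_add ((abs_sub _ _).trans (add_le_add (hLb _) (hCY _)))
      (hCv x))
  -- The three limits `t3`, `t2`, `t1` treat the increments from (r, Z_r) to (r, Z_{r+δ}), then to
  -- (r, e^{-δB} Z_{r+δ}), then along Y to (r+δ, Z_{r+δ}).
  have t3 := h.tendsto_generator hr hW hWC hgc (fun x => hC (r, x)) hGm hGb fun ε hε =>
    hM.eventually_generator hD (ht.trans hr.1) hr.2 hgd hgs hgD hε
  have t2 := tendsto_integral_quotient (P := P) (isFlow_expB_neg B)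
    (hasDerivAlong_expB_neg B (hgd.differentiable (by norm_num))) hvc hCv hWm hWC
    (w := fun δ ω => Z (r + δ) ω) (z := fun ω => Z r ω) (h.tendsto_path hr) (by
      filter_upwards [eventually_mem_Ico hr] with δ hδ
      have := h.measurable hδ.2
      exact (hgc.measurable.comp ((expB B (-δ)).continuous.measurable.comp this)).sub
        (hgc.measurable.comp this))
  have t1 := tendsto_integral_quotient (P := P) (isFlow_flowY B) hf.hasY hf.contY hCY hWm hWC
    (w := fun δ ω => (r, expB B (-δ) (Z (r + δ) ω))) (z := fun ω => (r, Z r ω)) (fun ω => by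
      refine Tendsto.prodMk_nhds tendsto_const_nhds ?_
      have c : Continuous fun q : ℝ × Euc d => expB B (-q.1) q.2 := by fun_prop
      have := (c.tendsto (0, Z r ω)).comp
        ((tendsto_id.mono_left nhdsWithin_le_nhds).prodMk_nhds (h.tendsto_path hr ω))
      simpa [Function.comp_def] using this) (by
      filter_upwards [eventually_mem_Ico hr] with δ hδ
      have := h.measurable hδ.2
      have h1 : Measurable fun ω => (r, expB B (-δ) (Z (r + δ) ω)) :=
        measurable_const.prodMk ((expB B (-δ)).continuous.measurable.comp this)
      have h2 : Continuous (flowY B δ) := (continuous_flowY B).comp (by fun_prop :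
        Continuous fun z : ℝ × Euc d => (δ, z))
      exact (hf.cont.measurable.comp (h2.measurable.comp h1)).sub (hf.cont.measurable.comp h1))
  have t := (t1.add t2).add t3
  -- Here Yf and the correction `v` cancel against their opposites in `G`, leaving 𝓛f.
  have elim : ∫ ω, W ω * derivY B f (r, Z r ω) ∂P + ∫ ω, W ω * v (Z r ω) ∂P
      + ∫ ω, W ω * G (Z r ω) ∂P = ∫ ω, W ω * opL hp B a b f (r, Z r ω) ∂P := by
    have i1 := hInt (hf.contY.measurable.comp (measurable_const.prodMk hZr)) (K := C)
      fun ω => hCY (r, Z r ω)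
    have i2 := hInt (hvc.measurable.comp hZr) (K := Cv) fun ω => hCv (Z r ω)
    have i3 := hInt (hGm.comp hZr) fun ω => hGb (Z r ω)
    simp only [Function.comp_def] at i1 i2 i3
    rw [integral_add_add i1 i2 i3]
    refine integral_congr_ae (ae_of_all _ fun ω => ?_)
    simp only [hGeq]; ring
  rw [elim] at t
  refine t.congr' ?_
  filter_upwards [eventually_mem_Ico hr] with δ hδ
  have hZ := h.measurable hδ.2
  have m1 : Measurable fun ω => f (r + δ, Z (r + δ) ω) :=
    hf.cont.measurable.comp (measurable_const.prodMk hZ)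
  have m2 : Measurable fun ω => f (r, expB B (-δ) (Z (r + δ) ω)) :=
    hf.cont.measurable.comp
      (measurable_const.prodMk ((expB B (-δ)).continuous.measurable.comp hZ))
  have m3 : Measurable fun ω => f (r, Z (r + δ) ω) :=
    hf.cont.measurable.comp (measurable_const.prodMk hZ)
  have m4 : Measurable fun ω => f (r, Z r ω) :=
    hf.cont.measurable.comp (measurable_const.prodMk hZr)
  have hsub : ∀ x y : ℝ × Euc d, |f x - f y| ≤ C + C := fun x y =>
    (abs_sub _ _).trans (add_le_add (hC x) (hC y))
  have i1 := hInt (m1.sub m2) fun ω => hsub _ _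
  have i2 := hInt (m2.sub m3) fun ω => hsub _ _
  have i3 := hInt (m3.sub m4) fun ω => hsub _ _
  simp only [Pi.sub_apply] at i1 i2 i3
  have hflow : ∀ ω, flowY B δ (r, expB B (-δ) (Z (r + δ) ω)) = (r + δ, Z (r + δ) ω) := fun ω => by
    simp [flowY_eq]
  simp only [hflow, hg]
  rw [← add_div, ← add_div, integral_add_add i1 i2 i3]
  congr 1
  refine integral_congr_ae (ae_of_all _ fun ω => ?_)
  ring

end Dynkin

/-! ### Integrated Dynkin formula: smooth case, then mollification -/

section DynkinFormula

variable {d : ℕ} {B : Matrix (Fin d) (Fin d) ℝ}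
  {Ω : Type*} {mΩ : MeasurableSpace Ω} {P : Measure Ω} [IsProbabilityMeasure P]
  {F : ℝ → MeasurableSpace Ω} {Z : ℝ → Ω → Euc d} {t T₀ : ℝ}
  {p₀ : ℕ} {hp : p₀ ≤ d} {D : Set (Euc d)} {Ω' : Type*} {M : ContMarkovProcess d T₀ Ω'}
  {a : Fin p₀ → Fin p₀ → ℝ × Euc d → ℝ} {b : Fin p₀ → ℝ × Euc d → ℝ}

/-- The function s ↦ E[W f(s, Z_s)] is continuous by dominated convergence and has at every interior
time the right derivative E[W 𝓛f(s, Z_s)]. Integrability of that derivative suffices for the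
fundamental theorem, so no continuity of the coefficients is required. -/
theorem IsMarkovUnder.dynkin_of_contDiff (h : IsMarkovUnder P F Z M.p t T₀) (ht : 0 ≤ t)
    (hM : IsLocalDiffusion hp M D B a b) (hD : IsOpen D) {K : Set (ℝ × Euc d)} (hK : IsCompact K)
    (hKD : K ⊆ Ioo 0 T₀ ×ˢ D) {f : ℝ × Euc d → ℝ} (hf : IntrinsicC2 hp B f)
    (hf0 : ∀ z ∉ K, f z = 0) (hfx : ∀ s, ContDiff ℝ 2 fun x => f (s, x)) {r T : ℝ}
    (hr : r ∈ Ico t T₀) (hT : T ∈ Ico t T₀) (hrT : r ≤ T) {W : Ω → ℝ}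
    (hW : StronglyMeasurable[F r] W) {C' : ℝ} (hWC : ∀ ω, |W ω| ≤ C') :
    ∫ ω, W ω * (f (T, Z T ω) - f (r, Z r ω)) ∂P
      = ∫ ω, W ω * (∫ u in r..T, opL hp B a b f (u, Z u ω)) ∂P := by
  have hWm : Measurable W := (hW.mono (h.le r hr)).measurable
  obtain ⟨C, hC, hC2, hC1, hCY⟩ := hf.exists_bound hK hf0
  obtain ⟨CL, hCL⟩ := exists_bound_opL (hp := hp) (B := B) hM.locBounded_a hM.locBounded_b hK hKD C
  have hLm := measurable_opL hD hM.locBounded_a hM.locBounded_b hK.isClosed hKD hf hf0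
  have hLb := hCL f hf0 hC2 hC1 hCY
  have hmem : ∀ s ∈ Icc r T, s ∈ Ico t T₀ := fun s hs => ⟨hr.1.trans hs.1, hs.2.trans_lt hT.2⟩
  have hfm : ∀ s ∈ Ico t T₀, Measurable fun ω => f (s, Z s ω) := fun s hs =>
    hf.cont.measurable.comp (measurable_const.prodMk (h.measurable hs))
  have hInt : ∀ s ∈ Ico t T₀, Integrable (fun ω => W ω * f (s, Z s ω)) P := fun s hs =>
    (Integrable.of_bound (hfm s hs).aestronglyMeasurable C (ae_of_all _ fun ω => hC _)).bdd_mul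
      hWm.aestronglyMeasurable (ae_of_all _ hWC)
  obtain ⟨hii, hswap⟩ := h.integral_swap hT hLm hLb hWm hWC hr.1 hrT
  rw [← hswap]
  simp only [mul_sub]
  rw [integral_sub (hInt T hT) (hInt r hr)]
  refine (intervalIntegral.integral_eq_sub_of_hasDeriv_right_of_le
    (f := fun s => ∫ ω, W ω * f (s, Z s ω) ∂P) hrT ?_ ?_ hii).symm
  · intro s hs
    refine continuousWithinAt_of_dominated (bound := fun _ => C' * C) ?_ ?_ (integrable_const _)
      (ae_of_all _ fun ω => ?_)
    · filter_upwards [self_mem_nhdsWithin] with u hu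
      exact (hInt u (hmem u hu)).aestronglyMeasurable
    · refine Eventually.of_forall fun u => ae_of_all _ fun ω => ?_
      rw [norm_mul]
      exact mul_le_mul (hWC ω) (hC _) (norm_nonneg _) ((abs_nonneg _).trans (hWC ω))
    · refine ContinuousWithinAt.mul continuousWithinAt_const ?_
      have h1 : ContinuousWithinAt (fun u => (u, Z u ω)) (Icc r T) s :=
        continuousWithinAt_id.prodMk ((h.cont ω s (hmem s hs)).mono hmem)
      exact hf.cont.continuousAt.comp_continuousWithinAt h1
  · intro s hs
    have hs' := hmem s (Ioo_subset_Icc_self hs)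
    -- A weight from the past at r also belongs to the past at every later s, so the derivative
    -- formula is available at each such time.
    have hWs : StronglyMeasurable[F s] W := hW.mono (h.mono r hr s hs' hs.1.le)
    have key := h.tendsto_opL ht hM hD hK hKD hf hf0 hfx hs' hWs hWC
    rw [hasDerivWithinAt_iff_tendsto_slope' (by simp)]
    have hmap : Tendsto (fun y : ℝ => y - s) (𝓝[>] s) (𝓝[>] 0) := by
      refine tendsto_nhdsWithin_iff.2 ⟨?_, ?_⟩
      · have : Tendsto (fun y : ℝ => y - s) (𝓝 s) (𝓝 (s - s)) :=
          (continuous_id.sub continuous_const).tendsto s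
        rw [sub_self] at this
        exact this.mono_left nhdsWithin_le_nhds
      · filter_upwards [self_mem_nhdsWithin] with y hy
        exact sub_pos.2 (mem_Ioi.1 hy)
    refine (key.comp hmap).congr' ?_
    have : ∀ᶠ y in 𝓝[>] s, y < T := nhdsWithin_le_nhds (gt_mem_nhds hs.2)
    filter_upwards [this, self_mem_nhdsWithin] with y hyT hy
    have hy : s < y := hy
    have hy' : y ∈ Ico t T₀ := hmem y ⟨hs.1.le.trans hy.le, hyT.le⟩
    simp only [Function.comp_apply, add_sub_cancel, mul_sub, slope_def_field]
    rw [integral_sub (hInt y hy') (hInt s hs')]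

theorem IntrinsicC2.mollify {f : ℝ × Euc d → ℝ} (hf : IntrinsicC2 hp B f)
    (φ : ContDiffBump (0 : Euc d)) {C : ℝ} (hC : ∀ z, |f z| ≤ C)
    (hC2 : ∀ i j z, |derivDx hp i (derivDx hp j f) z| ≤ C) (hC1 : ∀ i z, |derivDx hp i f z| ≤ C)
    (hCY : ∀ z, |derivY B f z| ≤ C) :
    IntrinsicC2 hp B (mollify B φ f) ∧
    (∀ i, derivDx hp i (mollify B φ f) = _root_.mollify B φ (derivDx hp i f)) ∧
    (∀ i j, derivDx hp i (derivDx hp j (mollify B φ f))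
      = _root_.mollify B φ (derivDx hp i (derivDx hp j f))) ∧
    derivY B (mollify B φ f) = _root_.mollify B φ (derivY B f) := by
  have hX := fun i => (hf.hasDx i).mollify φ (isFlow_flowDx hp i) (flowDx_leftShift hp B i) hf.cont
    (hf.contDx i) (hC1 i)
  have hXX := fun i j => (hf.hasDxx i j).mollify φ (isFlow_flowDx hp i) (flowDx_leftShift hp B i)
    (hf.contDx j) (hf.contDxx i j) (hC2 i j)
  have hY := hf.hasY.mollify φ (isFlow_flowY B) (flowY_leftShift B) hf.cont hf.contY hCY
  have e1 := fun i => (hX i).derivDx_eq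
  have e2 := fun i j => (hXX i j).derivDx_eq
  have e3 := hY.derivY_eq
  refine ⟨⟨continuous_mollify φ hf.cont hC, fun i => ?_, fun i => ?_, fun i j => ?_, fun i j => ?_,
    ?_, ?_⟩, e1, fun i j => ?_, e3⟩
  · rw [e1]; exact hX i
  · rw [e1]; exact continuous_mollify φ (hf.contDx i) (hC1 i)
  · rw [e1, e2]; exact hXX i j
  · rw [e1, e2]; exact continuous_mollify φ (hf.contDxx i j) (hC2 i j)
  · rw [e3]; exact hY
  · rw [e3]; exact continuous_mollify φ hf.contY hCY
  · rw [e1, e2]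

/-- Dynkin's formula, with a weight measurable with respect to the past. -/
theorem IsMarkovUnder.dynkin (h : IsMarkovUnder P F Z M.p t T₀) (ht : 0 ≤ t)
    (hM : IsLocalDiffusion hp M D B a b) (hD : IsOpen D) {K : Set (ℝ × Euc d)} (hK : IsCompact K)
    (hKD : K ⊆ Ioo 0 T₀ ×ˢ D) {f : ℝ × Euc d → ℝ} (hf : IntrinsicC2 hp B f)
    (hf0 : ∀ z ∉ K, f z = 0) {r T : ℝ}
    (hr : r ∈ Ico t T₀) (hT : T ∈ Ico t T₀) (hrT : r ≤ T) {W : Ω → ℝ}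
    (hW : StronglyMeasurable[F r] W) {C' : ℝ} (hWC : ∀ ω, |W ω| ≤ C') :
    ∫ ω, W ω * (f (T, Z T ω) - f (r, Z r ω)) ∂P
      = ∫ ω, W ω * (∫ u in r..T, opL hp B a b f (u, Z u ω)) ∂P := by
  have hWm : Measurable W := (hW.mono (h.le r hr)).measurable
  obtain ⟨C, hC, hC2, hC1, hCY⟩ := hf.exists_bound hK hf0
  obtain ⟨ρ, hρ, K', hK', hKK', hK'D, hsupp⟩ :=
    exists_compact_leftShift (B := B) (isOpen_Ioo.prod hD) hK hKD
  obtain ⟨CL, hCL⟩ := exists_bound_opL (hp := hp) (B := B) hM.locBounded_a hM.locBounded_b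
    hK' hK'D C
  -- The outer radii ρ/(n+1) tend to 0 and never exceed ρ, so every mollification vanishes off the
  -- same `K'`; the inner radius is half the outer one.
  let φ : ℕ → ContDiffBump (0 : Euc d) := fun n =>
    ⟨ρ / (n + 1) / 2, ρ / (n + 1), by positivity, half_lt_self (by positivity)⟩
  have hφρ : ∀ n, (φ n).rOut ≤ ρ := fun n => div_le_self hρ.le (by simp)
  have hφ0 : Tendsto (fun n => (φ n).rOut) atTop (𝓝 0) :=
    tendsto_const_div_atTop_nhds_zero_nat ρ |>.comp (tendsto_add_atTop_nat 1) |>.congr fun n => by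
      simp [φ]
  let fn : ℕ → ℝ × Euc d → ℝ := fun n => mollify B (φ n) f
  have hfn := fun n => hf.mollify (φ n) hC hC2 hC1 hCY
  have hfn0 : ∀ n, ∀ z ∉ K', fn n z = 0 := fun n z hz =>
    mollify_eq_zero (φ n) fun y hy => hf0 _ (hsupp z hz y (hy.trans (hφρ n)))
  have hfnb : ∀ n z, |fn n z| ≤ C := fun n z => abs_mollify_le (φ n) hC z
  have hLm : ∀ n, Measurable (opL hp B a b (fn n)) := fun n =>
    measurable_opL hD hM.locBounded_a hM.locBounded_b hK'.isClosed hK'D (hfn n).1 (hfn0 n)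
  have hLb : ∀ n z, |opL hp B a b (fn n) z| ≤ CL := fun n => by
    refine hCL (fn n) (hfn0 n) (fun i j z => ?_) (fun i z => ?_) fun z => ?_
    · rw [(hfn n).2.2.1]; exact abs_mollify_le (φ n) (hC2 i j) z
    · rw [(hfn n).2.1]; exact abs_mollify_le (φ n) (hC1 i) z
    · rw [(hfn n).2.2.2]; exact abs_mollify_le (φ n) hCY z
  have hfn_lim : ∀ z, Tendsto (fun n => fn n z) atTop (𝓝 (f z)) :=
    tendsto_mollify hφ0 hf.cont
  -- The coefficients multiply the derivatives pointwise and are not mollified, so convergence of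
  -- each derivative at `z` is enough.
  have hL_lim : ∀ z, Tendsto (fun n => opL hp B a b (fn n) z) atTop (𝓝 (opL hp B a b f z)) := by
    intro z
    simp only [opL, fn, (hfn _).2.2.1, (hfn _).2.2.2]
    simp only [(hfn _).2.1]
    refine Tendsto.add (Tendsto.add (Tendsto.const_mul _ ?_) ?_) (tendsto_mollify hφ0 hf.contY z)
    · refine tendsto_finsetSum _ fun i _ => tendsto_finsetSum _ fun j _ => ?_
      exact (tendsto_mollify hφ0 (hf.contDxx i j) z).const_mul _
    · refine tendsto_finsetSum _ fun i _ => ?_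
      exact (tendsto_mollify hφ0 (hf.contDx i) z).const_mul _
  have hdyn := fun n => h.dynkin_of_contDiff ht hM hD hK' hK'D (hfn n).1 (hfn0 n)
    (fun s => contDiff_mollify (φ n) hf.cont s 2) hr hT hrT hW hWC
  have lim1 : Tendsto (fun n => ∫ ω, W ω * (fn n (T, Z T ω) - fn n (r, Z r ω)) ∂P) atTop
      (𝓝 (∫ ω, W ω * (f (T, Z T ω) - f (r, Z r ω)) ∂P)) := by
    refine tendsto_integral_filter_of_dominated_convergence (fun _ => C' * (C + C))
      (Eventually.of_forall fun n => ?_) (Eventually.of_forall fun n => ae_of_all _ fun ω => ?_)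
      (integrable_const _) (ae_of_all _ fun ω => ((hfn_lim _).sub (hfn_lim _)).const_mul _)
    · have hm : ∀ s ∈ Ico t T₀, Measurable fun ω => fn n (s, Z s ω) := fun s hs =>
        (hfn n).1.cont.measurable.comp (measurable_const.prodMk (h.measurable hs))
      exact (hWm.mul ((hm T hT).sub (hm r hr))).aestronglyMeasurable
    · rw [norm_mul]
      exact mul_le_mul (hWC ω) ((norm_sub_le _ _).trans (add_le_add (hfnb n _) (hfnb n _)))
        (norm_nonneg _) ((abs_nonneg _).trans (hWC ω))
  have lim2 : Tendsto (fun n => ∫ ω, W ω * (∫ u in r..T, opL hp B a b (fn n) (u, Z u ω)) ∂P) atTop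
      (𝓝 (∫ ω, W ω * (∫ u in r..T, opL hp B a b f (u, Z u ω)) ∂P)) := by
    refine tendsto_integral_filter_of_dominated_convergence (fun _ => C' * (CL * (T - r)))
      (Eventually.of_forall fun n => ?_) (Eventually.of_forall fun n => ae_of_all _ fun ω => ?_)
      (integrable_const _) (ae_of_all _ fun ω => Tendsto.const_mul _ ?_)
    · exact (hWm.mul ((h.stronglyMeasurable_integral hT (hLm n) hr.1 hrT).mono
        (h.le T hT)).measurable).aestronglyMeasurable
    · rw [norm_mul]
      exact mul_le_mul (hWC ω) (abs_integral_path_le (hLb n) hrT ω)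
        (norm_nonneg _) ((abs_nonneg _).trans (hWC ω))
    · refine intervalIntegral.tendsto_integral_filter_of_dominated_convergence (fun _ => CL)
        (Eventually.of_forall fun n => ?_)
        (Eventually.of_forall fun n => ae_of_all _ fun u _ => hLb n _)
        intervalIntegrable_const (ae_of_all _ fun u _ => hL_lim _)
      exact (h.intervalIntegrable hT (hLm n) (hLb n) hr.1 hrT ω).def'.aestronglyMeasurable
  exact tendsto_nhds_unique lim1 (lim2.congr fun n => (hdyn n).symm)

end DynkinFormula

/-! ### The martingale and its second moment -/

/-- With G the primitive of ℓ based at `T`, the integrand is -G'G almost everywhere. G is absolutely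
continuous, so the product rule integrates it although ℓ is merely integrable; G(T) = 0 leaves
G(t)²/2. -/
theorem integral_mul_integral_tail {ℓ : ℝ → ℝ} {t T : ℝ}
    (hℓ : IntervalIntegrable ℓ volume t T) :
    ∫ u in t..T, ℓ u * (∫ v in u..T, ℓ v) = (∫ u in t..T, ℓ u) ^ 2 / 2 := by
  have hac := hℓ.absolutelyContinuousOnInterval_intervalIntegral (c := T) right_mem_uIcc
  have h1 := hac.integral_deriv_mul_eq_sub hac
  have h2 : ∫ u in t..T, ℓ u * (∫ v in u..T, ℓ v) = ∫ u in t..T, (-1 / 2) *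
      (deriv (fun x => ∫ v in T..x, ℓ v) u * (∫ v in T..u, ℓ v)
        + (∫ v in T..u, ℓ v) * deriv (fun x => ∫ v in T..x, ℓ v) u) := by
    refine intervalIntegral.integral_congr_ae ?_
    filter_upwards [hℓ.ae_hasDerivAt_integral] with u hu hu'
    rw [(hu (uIoc_subset_uIcc hu') T right_mem_uIcc).deriv, intervalIntegral.integral_symm T u]
    ring
  rw [h2, intervalIntegral.integral_const_mul, h1, intervalIntegral.integral_same,
    intervalIntegral.integral_symm t T]
  ring

section Martingale

variable {Ω : Type*} {mΩ : MeasurableSpace Ω} {d : ℕ} {P : Measure Ω}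
  {F : ℝ → MeasurableSpace Ω} {Z : ℝ → Ω → Euc d} {p : ℝ → ℝ → Kernel (Euc d) (Euc d)} {t T₀ : ℝ}
  {f L : ℝ × Euc d → ℝ} {C CL : ℝ}

/-- Dynkin's formula for the pair `(f, L)` along `Z`, conditionally on the past. -/
def IsDynkinPair (P : Measure Ω) (F : ℝ → MeasurableSpace Ω) (Z : ℝ → Ω → Euc d) (t T₀ : ℝ)
    (f L : ℝ × Euc d → ℝ) : Prop :=
  ∀ r ∈ Ico t T₀, ∀ T ∈ Ico t T₀, r ≤ T → ∀ (W : Ω → ℝ) (C : ℝ), StronglyMeasurable[F r] W →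
    (∀ ω, |W ω| ≤ C) → ∫ ω, W ω * (f (T, Z T ω) - f (r, Z r ω)) ∂P
      = ∫ ω, W ω * (∫ u in r..T, L (u, Z u ω)) ∂P

/-- `f(T, Z_T) - f(t, Z_t) - ∫_t^T L(u, Z_u) du`. -/
noncomputable def dynkinRemainder (Z : ℝ → Ω → Euc d) (t : ℝ) (f L : ℝ × Euc d → ℝ) (T : ℝ)
    (ω : Ω) : ℝ :=
  f (T, Z T ω) - f (t, Z t ω) - ∫ u in t..T, L (u, Z u ω)

theorem IsMarkovUnder.stronglyMeasurable_comp (h : IsMarkovUnder P F Z p t T₀)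
    (hf : Measurable f) {s T : ℝ} (hs : s ∈ Ico t T₀) (hT : T ∈ Ico t T₀) (hsT : s ≤ T) :
    StronglyMeasurable[F T] fun ω => f (s, Z s ω) := by
  have h1 := (h.adapted s hs).mono (h.mono s hs T hT hsT) le_rfl
  exact ((hf.comp measurable_prodMk_left).comp h1).stronglyMeasurable

theorem IsMarkovUnder.stronglyMeasurable_dynkinRemainder (h : IsMarkovUnder P F Z p t T₀)
    (hf : Measurable f) (hL : Measurable L) {T : ℝ} (hT : T ∈ Ico t T₀) :
    StronglyMeasurable[F T] (dynkinRemainder Z t f L T) :=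
  ((h.stronglyMeasurable_comp hf hT hT le_rfl).sub
    (h.stronglyMeasurable_comp hf ⟨le_rfl, hT.1.trans_lt hT.2⟩ hT hT.1)).sub
    (h.stronglyMeasurable_integral hT hL le_rfl hT.1)

theorem abs_dynkinRemainder_le (hfC : ∀ z, |f z| ≤ C) (hLC : ∀ z, |L z| ≤ CL) {T : ℝ}
    (hT : t ≤ T) (ω : Ω) : |dynkinRemainder Z t f L T ω| ≤ C + C + CL * (T - t) :=
  (abs_sub _ _).trans (add_le_add ((abs_sub _ _).trans (add_le_add (hfC _) (hfC _)))
    (abs_integral_path_le hLC hT ω))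

variable [IsProbabilityMeasure P]

theorem integrable_of_stronglyMeasurable_of_bound {m : MeasurableSpace Ω} (hm : m ≤ mΩ)
    {W : Ω → ℝ} (hW : StronglyMeasurable[m] W) (hWC : ∀ ω, |W ω| ≤ C) : Integrable W P :=
  Integrable.of_bound (hW.mono hm).aestronglyMeasurable C (ae_of_all _ hWC)

theorem IsMarkovUnder.integrable_dynkinRemainder (h : IsMarkovUnder P F Z p t T₀)
    (hf : Measurable f) (hfC : ∀ z, |f z| ≤ C) (hL : Measurable L) (hLC : ∀ z, |L z| ≤ CL)
    {T : ℝ} (hT : T ∈ Ico t T₀) : Integrable (dynkinRemainder Z t f L T) P :=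
  integrable_of_stronglyMeasurable_of_bound (h.le T hT)
    (h.stronglyMeasurable_dynkinRemainder hf hL hT) (abs_dynkinRemainder_le hfC hLC hT.1)

/-- The increment of the remainder over [r, T] is exactly the difference of the two integrands in
Dynkin's formula, so it is orthogonal to bounded past weights. -/
theorem IsDynkinPair.integral_mul_dynkinRemainder (hD : IsDynkinPair P F Z t T₀ f L)
    (h : IsMarkovUnder P F Z p t T₀) (hf : Measurable f) (hfC : ∀ z, |f z| ≤ C)
    (hL : Measurable L) (hLC : ∀ z, |L z| ≤ CL) {r T : ℝ} (hr : r ∈ Ico t T₀) (hT : T ∈ Ico t T₀)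
    (hrT : r ≤ T) {W : Ω → ℝ} {K : ℝ} (hW : StronglyMeasurable[F r] W) (hWK : ∀ ω, |W ω| ≤ K) :
    ∫ ω, W ω * dynkinRemainder Z t f L T ω ∂P = ∫ ω, W ω * dynkinRemainder Z t f L r ω ∂P := by
  have hWm := (hW.mono (h.le r hr)).aestronglyMeasurable (μ := P)
  have hb : ∀ᵐ ω ∂P, ‖W ω‖ ≤ K := ae_of_all _ hWK
  have i1 := (h.integrable_dynkinRemainder hf hfC hL hLC hT).bdd_mul hWm hb
  have i2 := (h.integrable_dynkinRemainder hf hfC hL hLC hr).bdd_mul hWm hb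
  have i3 : Integrable (fun ω => W ω * (f (T, Z T ω) - f (r, Z r ω))) P := by
    refine Integrable.bdd_mul ?_ hWm hb
    exact (integrable_of_stronglyMeasurable_of_bound (h.le T hT)
      (h.stronglyMeasurable_comp hf hT hT le_rfl) fun ω => hfC _).sub
      (integrable_of_stronglyMeasurable_of_bound (h.le T hT)
        (h.stronglyMeasurable_comp hf hr hT hrT) fun ω => hfC _)
  have i4 : Integrable (fun ω => W ω * (∫ u in r..T, L (u, Z u ω))) P := by
    refine Integrable.bdd_mul ?_ hWm hb
    exact integrable_of_stronglyMeasurable_of_bound (h.le T hT)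
      (h.stronglyMeasurable_integral hT hL hr.1 hrT) (abs_integral_path_le hLC hrT)
  have e := hD r hr T hT hrT W K hW hWK
  rw [← sub_eq_zero, ← integral_sub i3 i4] at e
  rw [← sub_eq_zero, ← integral_sub i1 i2, ← e]
  refine integral_congr_ae (ae_of_all _ fun ω => ?_)
  have := intervalIntegral.integral_add_adjacent_intervals
    (h.intervalIntegrable hr hL hLC le_rfl hr.1 ω) (h.intervalIntegrable hT hL hLC hr.1 hrT ω)
  simp only [dynkinRemainder, ← this]
  ring

theorem IsDynkinPair.condExp_dynkinRemainder (hD : IsDynkinPair P F Z t T₀ f L)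
    (h : IsMarkovUnder P F Z p t T₀) (hf : Measurable f) (hfC : ∀ z, |f z| ≤ C)
    (hL : Measurable L) (hLC : ∀ z, |L z| ≤ CL) {r T : ℝ} (hr : r ∈ Ico t T₀) (hT : T ∈ Ico t T₀)
    (hrT : r ≤ T) :
    P[dynkinRemainder Z t f L T | F r] =ᵐ[P] dynkinRemainder Z t f L r := by
  have ir := h.integrable_dynkinRemainder hf hfC hL hLC hr
  refine (ae_eq_condExp_of_forall_setIntegral_eq (h.le r hr)
    (h.integrable_dynkinRemainder hf hfC hL hLC hT) (fun S _ _ => ir.integrableOn)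
    (fun S hS _ => ?_)
    (h.stronglyMeasurable_dynkinRemainder hf hL hr).aestronglyMeasurable).symm
  have hSm := h.le r hr S hS
  have e := hD.integral_mul_dynkinRemainder h hf hfC hL hLC hr hT hrT
    (W := S.indicator fun _ => 1) (K := 1) (stronglyMeasurable_const.indicator hS) fun ω => by
      by_cases hω : ω ∈ S <;> simp [hω]
  have e' : ∀ g : Ω → ℝ, ∫ ω in S, g ω ∂P = ∫ ω, S.indicator (fun _ => 1) ω * g ω ∂P := by
    intro g
    rw [← integral_indicator hSm]
    refine integral_congr_ae (ae_of_all _ fun ω => ?_)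
    by_cases hω : ω ∈ S <;> simp [hω]
  rw [e', e', e]

theorem IsDynkinPair.integral_dynkinRemainder (hD : IsDynkinPair P F Z t T₀ f L)
    (h : IsMarkovUnder P F Z p t T₀) (hf : Measurable f) (hfC : ∀ z, |f z| ≤ C)
    (hL : Measurable L) (hLC : ∀ z, |L z| ≤ CL) {T : ℝ} (hT : T ∈ Ico t T₀) :
    ∫ ω, dynkinRemainder Z t f L T ω ∂P = 0 := by
  have e := hD.integral_mul_dynkinRemainder h hf hfC hL hLC (r := t)
    ⟨le_rfl, hT.1.trans_lt hT.2⟩ hT hT.1 (W := fun _ => 1) (K := 1) stronglyMeasurable_const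
    (by simp)
  simpa [dynkinRemainder] using e

/-- Writing the square as twice an integral over u < v lets L(u, Z_u), known at time u, act as a
weight for the later integral. Fubini exchanges time and expectation. -/
theorem IsMarkovUnder.integral_sq_integral (h : IsMarkovUnder P F Z p t T₀)
    (hL : Measurable L) (hLC : ∀ z, |L z| ≤ C) {T : ℝ} (hT : T ∈ Ico t T₀) :
    ∫ ω, (∫ u in t..T, L (u, Z u ω)) ^ 2 ∂P
      = 2 * ∫ u in t..T, ∫ ω, L (u, Z u ω) * (∫ v in u..T, L (v, Z v ω)) ∂P := by
  have hC : 0 ≤ C := (abs_nonneg _).trans (hLC 0)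
  set ℓ : ℝ → Ω → ℝ := fun u ω => L (u, clampPath Z t T u ω) with hℓdef
  have hℓm : Measurable fun q : ℝ × Ω => ℓ q.1 q.2 := h.measurable_comp_clampPath' hT hL
  have hℓu : ∀ ω, Measurable fun u => ℓ u ω := fun ω => hℓm.comp measurable_prodMk_right
  have hℓi : ∀ ω r s, IntervalIntegrable (fun u => ℓ u ω) volume r s := fun ω r s => by
    rw [intervalIntegrable_iff]
    exact Measure.integrableOn_of_bounded (by simp) (hℓu ω).aestronglyMeasurable
      (ae_of_all _ fun u => hLC _)
  -- Joint measurability of the primitive: it is continuous in the endpoint and measurable in ω.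
  have hGm : Measurable (Function.uncurry fun u ω => ∫ v in T..u, ℓ v ω) := by
    refine measurable_uncurry_of_continuous_of_measurable (fun ω => ?_) fun u => ?_
    · exact intervalIntegral.continuous_primitive (hℓi ω) T
    · simp only [intervalIntegral]
      exact (hℓm.stronglyMeasurable.integral_prod_left'.sub
        hℓm.stronglyMeasurable.integral_prod_left').measurable
  have hm : Measurable (Function.uncurry fun u ω => ℓ u ω * (∫ v in u..T, ℓ v ω)) := by
    refine hℓm.mul ?_
    simp only [intervalIntegral.integral_symm T]
    exact hGm.neg
  have : IsFiniteMeasure (volume.restrict (uIoc t T)) := ⟨by simp⟩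
  have hInt : Integrable (Function.uncurry fun u ω => ℓ u ω * (∫ v in u..T, ℓ v ω))
      ((volume.restrict (uIoc t T)).prod P) := by
    refine Integrable.of_bound hm.aestronglyMeasurable (C * (C * (T - t))) ?_
    refine (Measure.ae_prod_iff_ae_ae ?_).2 ?_
    · exact measurableSet_le hm.norm measurable_const
    · filter_upwards [ae_restrict_mem measurableSet_uIoc] with u hu
      rw [uIoc_of_le hT.1] at hu
      refine ae_of_all _ fun ω => ?_
      rw [Function.uncurry_apply_pair, norm_mul]
      have h1 := intervalIntegral.norm_integral_le_of_norm_le_const (a := u) (b := T)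
        (f := fun v => ℓ v ω) (C := C) fun u _ => hLC _
      rw [abs_of_nonneg (sub_nonneg.2 hu.2)] at h1
      exact mul_le_mul (hLC _) (h1.trans (by gcongr; exact hu.1.le)) (norm_nonneg _) hC
  have e1 : ∫ u in t..T, ∫ ω, L (u, Z u ω) * (∫ v in u..T, L (v, Z v ω)) ∂P
      = ∫ u in t..T, ∫ ω, ℓ u ω * (∫ v in u..T, ℓ v ω) ∂P := by
    refine intervalIntegral.integral_congr fun u hu => ?_
    rw [uIcc_of_le hT.1] at hu
    simp only [hℓdef, ← integral_comp_clampPath (Z := Z) hu.1 hu.2 le_rfl, clampPath_eq hu]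
  rw [e1, intervalIntegral_integral_swap hInt, ← integral_const_mul]
  refine integral_congr_ae (ae_of_all _ fun ω => ?_)
  simp only
  rw [integral_mul_integral_tail (hℓi ω t T), integral_comp_clampPath le_rfl hT.1 le_rfl]
  ring

/-- For each u, Dynkin's formula with weight L(u, Z_u) replaces the integral of L over [u, T] by
f(T, Z_T) - f(u, Z_u); integrating in u yields the two terms. -/
theorem IsDynkinPair.integral_sq_integral (hD : IsDynkinPair P F Z t T₀ f L)
    (h : IsMarkovUnder P F Z p t T₀) (hf : Measurable f) (hfC : ∀ z, |f z| ≤ C)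
    (hL : Measurable L) (hLC : ∀ z, |L z| ≤ CL) {T : ℝ} (hT : T ∈ Ico t T₀) :
    ∫ ω, (∫ u in t..T, L (u, Z u ω)) ^ 2 ∂P
      = 2 * (∫ ω, f (T, Z T ω) * (∫ u in t..T, L (u, Z u ω)) ∂P)
        - 2 * ∫ ω, (∫ u in t..T, f (u, Z u ω) * L (u, Z u ω)) ∂P := by
  have hm := h.le T hT
  have hfL : ∀ z, |f z * L z| ≤ C * CL := fun z => by
    rw [abs_mul]
    exact mul_le_mul (hfC z) (hLC z) (abs_nonneg _) ((abs_nonneg _).trans (hfC z))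
  have s1 := h.integral_swap hT hL hLC
    ((h.stronglyMeasurable_comp hf hT hT le_rfl).mono hm).measurable (fun ω => hfC _) le_rfl hT.1
  have s2 := h.integral_swap hT (hf.mul hL) hfL (W := fun _ => 1) measurable_const
    (C' := 1) (by simp) le_rfl hT.1
  simp only [one_mul, Pi.mul_apply] at s2
  rw [h.integral_sq_integral hL hLC hT, ← mul_sub, ← s1.2, ← s2.2,
    ← intervalIntegral.integral_sub s1.1 s2.1]
  congr 1
  refine intervalIntegral.integral_congr fun u hu => ?_
  rw [uIcc_of_le hT.1] at hu
  have hu' : u ∈ Ico t T₀ := ⟨hu.1, hu.2.trans_lt hT.2⟩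
  have iT := integrable_of_stronglyMeasurable_of_bound (P := P) hm
    (h.stronglyMeasurable_comp hf hT hT le_rfl) fun ω => hfC _
  have iL := h.stronglyMeasurable_comp hL hu' hT hu.2
  have i1 : Integrable (fun ω => f (T, Z T ω) * L (u, Z u ω)) P :=
    iT.mul_bdd (iL.mono hm).aestronglyMeasurable (ae_of_all _ fun ω => hLC _)
  have i2 := integrable_of_stronglyMeasurable_of_bound (P := P) hm
    (h.stronglyMeasurable_comp (hf.mul hL) hu' hT hu.2) fun ω => hfL _
  simp only [Pi.mul_apply] at i2
  have e := hD u hu' T hT hu.2 _ _ (h.stronglyMeasurable_comp hL hu' hu' le_rfl) fun ω => hLC _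
  rw [← e, ← integral_sub i1 i2]
  exact integral_congr_ae (ae_of_all _ fun ω => by ring)

/-- The second moment of the martingale attached to `(f, L)`, when `(f², 2fL + Γ)` satisfies
Dynkin's formula as well. -/
theorem IsDynkinPair.integral_sq_dynkinRemainder (hD : IsDynkinPair P F Z t T₀ f L)
    {Γ : ℝ × Euc d → ℝ}
    (hD2 : IsDynkinPair P F Z t T₀ (fun z => f z * f z) fun z => 2 * (f z * L z) + Γ z)
    (h : IsMarkovUnder P F Z p t T₀) (hf : Measurable f) (hfC : ∀ z, |f z| ≤ C)
    (hL : Measurable L) (hLC : ∀ z, |L z| ≤ CL) (hΓ : Measurable Γ) {CΓ : ℝ}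
    (hΓC : ∀ z, |Γ z| ≤ CΓ) {T : ℝ} (hT : T ∈ Ico t T₀) :
    ∫ ω, dynkinRemainder Z t f L T ω ^ 2 ∂P = ∫ ω, (∫ u in t..T, Γ (u, Z u ω)) ∂P := by
  have hm := h.le T hT
  have ht : t ∈ Ico t T₀ := ⟨le_rfl, hT.1.trans_lt hT.2⟩
  have hfL : ∀ z, |f z * L z| ≤ C * CL := fun z => by
    rw [abs_mul]
    exact mul_le_mul (hfC z) (hLC z) (abs_nonneg _) ((abs_nonneg _).trans (hfC z))
  set y : Ω → ℝ := fun ω => f (T, Z T ω)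
  set x : Ω → ℝ := fun ω => f (t, Z t ω)
  set A : Ω → ℝ := fun ω => ∫ u in t..T, L (u, Z u ω)
  set Q : Ω → ℝ := fun ω => ∫ u in t..T, f (u, Z u ω) * L (u, Z u ω)
  set G : Ω → ℝ := fun ω => ∫ u in t..T, Γ (u, Z u ω)
  have ym := h.stronglyMeasurable_comp hf hT hT le_rfl
  have xm := h.stronglyMeasurable_comp hf ht hT hT.1
  have Am := h.stronglyMeasurable_integral hT hL le_rfl hT.1
  have iy : Integrable y P := integrable_of_stronglyMeasurable_of_bound hm ym fun ω => hfC _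
  have ix : Integrable x P := integrable_of_stronglyMeasurable_of_bound hm xm fun ω => hfC _
  have iA : Integrable A P :=
    integrable_of_stronglyMeasurable_of_bound hm Am (abs_integral_path_le hLC hT.1)
  have iQ : Integrable Q P :=
    integrable_of_stronglyMeasurable_of_bound hm
      (h.stronglyMeasurable_integral hT (hf.mul hL) le_rfl hT.1) (abs_integral_path_le hfL hT.1)
  have iG : Integrable G P :=
    integrable_of_stronglyMeasurable_of_bound hm
      (h.stronglyMeasurable_integral hT hΓ le_rfl hT.1) (abs_integral_path_le hΓC hT.1)
  have bm : ∀ {g W : Ω → ℝ} {K : ℝ}, Integrable g P → StronglyMeasurable[F T] W →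
      (∀ ω, |W ω| ≤ K) → Integrable (fun ω => W ω * g ω) P := fun hg hW hK =>
    hg.bdd_mul (hW.mono hm).aestronglyMeasurable (ae_of_all _ hK)
  have iyy : Integrable (fun ω => y ω * y ω) P := bm iy ym fun ω => hfC _
  have ixx : Integrable (fun ω => x ω * x ω) P := bm ix xm fun ω => hfC _
  have ixy : Integrable (fun ω => x ω * y ω) P := bm iy xm fun ω => hfC _
  have iyA : Integrable (fun ω => y ω * A ω) P := bm iA ym fun ω => hfC _
  have ixA : Integrable (fun ω => x ω * A ω) P := bm iA xm fun ω => hfC _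
  have iAA : Integrable (fun ω => A ω * A ω) P :=
    bm iA Am (abs_integral_path_le hLC hT.1)
  have e1 := hD.integral_sq_integral h hf hfC hL hLC hT
  have e2 := hD2 t ht T hT hT.1 (fun _ => 1) 1 stronglyMeasurable_const (by simp)
  have e3 := hD t ht T hT hT.1 x C (h.stronglyMeasurable_comp hf ht ht le_rfl) fun ω => hfC _
  have e4 : ∀ ω, (∫ u in t..T, 2 * (f (u, Z u ω) * L (u, Z u ω)) + Γ (u, Z u ω))
      = 2 * Q ω + G ω := fun ω => by
    rw [intervalIntegral.integral_add, intervalIntegral.integral_const_mul]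
    · exact (h.intervalIntegrable hT (hf.mul hL) hfL le_rfl hT.1 ω).const_mul 2
    · exact h.intervalIntegrable hT hΓ hΓC le_rfl hT.1 ω
  simp only [one_mul, e4] at e2
  rw [integral_sub iyy ixx, integral_add (iQ.const_mul 2) iG, integral_const_mul] at e2
  simp only [mul_sub] at e3
  rw [integral_sub ixy ixx] at e3
  -- With y, x, A the final value, initial value and time integral, `e1` gives E[A²] = 2E[yA] -
  -- 2E[Q], `e3` gives E[xy] - E[x²] = E[xA], and `e2` gives E[y²] - E[x²] = 2E[Q] + E[G]. Their
  -- combination leaves E[G].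
  have e5 : ∀ ω, dynkinRemainder Z t f L T ω ^ 2
      = y ω * y ω + x ω * x ω - 2 * (x ω * y ω) - 2 * (y ω * A ω) + 2 * (x ω * A ω)
        + A ω * A ω := fun ω => by
    simp only [dynkinRemainder, y, x, A]; ring
  have e6 : ∫ ω, A ω * A ω ∂P = ∫ ω, (∫ u in t..T, L (u, Z u ω)) ^ 2 ∂P :=
    integral_congr_ae (ae_of_all _ fun ω => by simp only [A, sq])
  simp only [e5]
  rw [integral_add (by fun_prop) iAA, integral_add (by fun_prop) (ixA.const_mul 2),
    integral_sub (by fun_prop) (iyA.const_mul 2), integral_sub (by fun_prop) (ixy.const_mul 2),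
    integral_add iyy ixx, integral_const_mul, integral_const_mul, integral_const_mul, e6, e1]
  linarith

end Martingale

/-! ### The intrinsic Itô formula -/

theorem ContMarkovProcess.isMarkovUnder {d : ℕ} {T₀ : ℝ} {Ω : Type*} (M : ContMarkovProcess d T₀ Ω)
    {t : ℝ} (ht : 0 ≤ t) (x : Euc d) :
    IsMarkovUnder (M.P t x) (M.F t) M.X M.p t T₀ where
  le s hs := (M.filtration t ht).le' ⟨s, hs⟩
  mono s hs T hT hsT := M.mono t t s T ht le_rfl hs.1 hsT hT.2
  adapted s hs := M.adapted t s ht hs.1 hs.2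
  cont ω := (M.continuous_paths ω).mono (Ico_subset_Ico_left ht)
  kernel s T hs hsT hT := M.isMarkovKernel s T (ht.trans hs) hsT hT
  markov s T hs hsT hT A hA := M.markov t x s T ht hs hsT hT A hA

theorem theorem1p1 {p₀ d : ℕ} (hp : p₀ ≤ d) {T₀ : ℝ} (hT₀ : 0 < T₀) {Ω : Type*}
    (X : ContMarkovProcess d T₀ Ω) (D : Set (Euc d)) (hDo : IsOpen D) (hDc : IsConnected D)
    (B : Matrix (Fin d) (Fin d) ℝ)
    (a : Fin p₀ → Fin p₀ → ℝ × Euc d → ℝ) (b : Fin p₀ → ℝ × Euc d → ℝ)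
    (hX : IsLocalDiffusion hp X D B a b) (hB : HormanderCondition hp B)
    (t : ℝ) (ht : 0 < t) (htT : t < T₀) (x : Euc d) (α : ℝ) (hα : 0 < α) (hα1 : α ≤ 1)
    (f : ℝ × Euc d → ℝ) (hf : IntrinsicHolder hp B (Set.Ioo 0 T₀ ×ˢ D) α 2 f)
    (hfc : HasCompactSupport f) (hfs : tsupport f ⊆ Set.Ioo 0 T₀ ×ˢ D) :
    (∀ ω, ∀ T ∈ Set.Ico t T₀,
      IntervalIntegrable (fun u => opL hp B a b f (u, X.X u ω)) volume t T ∧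
      IntervalIntegrable (fun u => energyDensity hp a f (u, X.X u ω)) volume t T) ∧
    Martingale (fun (T : Set.Ico t T₀) => itoRemainder hp X B a b f t T)
      (X.filtration t ht.le) (X.P t x) ∧
    ∀ T ∈ Set.Ico t T₀,
      ∫ ω, itoRemainder hp X B a b f t T ω ∂(X.P t x) = 0 ∧
      MemLp (itoRemainder hp X B a b f t T) 2 (X.P t x) ∧
      Integrable (fun ω => ∫ s in t..T, energyDensity hp a f (s, X.X s ω)) (X.P t x) ∧
      ∫ ω, |itoRemainder hp X B a b f t T ω| ^ 2 ∂(X.P t x) =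
        ∫ ω, (∫ s in t..T, energyDensity hp a f (s, X.X s ω)) ∂(X.P t x) := by
  have hprob := X.isProbability t x ht.le htT
  have h := X.isMarkovUnder ht.le x
  have hK : IsCompact (tsupport f) := hfc
  have hf0 : ∀ z ∉ tsupport f, f z = 0 := fun z => image_eq_zero_of_notMem_tsupport
  have hC2 := hf.intrinsicC2 hp B hB (isOpen_Ioo.prod hDo) hα hfc hfs
  have hg0 : ∀ z ∉ tsupport f, f z * f z = 0 := fun z hz => by rw [hf0 z hz, zero_mul]
  have hg2 := hC2.mul_self
  obtain ⟨C, hfC, hxx, hx, hy⟩ := hC2.exists_bound hK hf0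
  obtain ⟨Cg, -, gxx, gx, gy⟩ := hg2.exists_bound hK hg0
  obtain ⟨CL, hCL⟩ := exists_bound_opL (hp := hp) (B := B) hX.locBounded_a hX.locBounded_b hK hfs C
  obtain ⟨CG, hCG⟩ := exists_bound_opL (hp := hp) (B := B) hX.locBounded_a hX.locBounded_b hK hfs Cg
  have hLC := hCL f hf0 hxx hx hy
  have hGC := hCG _ hg0 gxx gx gy
  have hL := measurable_opL hDo hX.locBounded_a hX.locBounded_b hK.isClosed hfs hC2 hf0
  have hΓ := measurable_energyDensity hDo hX.locBounded_a hK.isClosed hfs hC2 hf0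
  have hfm : Measurable f := hC2.cont.measurable
  have hmul := hC2.opL_mul_self a b
  -- The energy density is bounded through the carré du champ identity, as 𝓛f² - 2f𝓛f.
  have hΓC : ∀ z, |energyDensity hp a f z| ≤ CG + 2 * (C * CL) := fun z => by
    rw [eq_sub_of_add_eq' (hmul z).symm]
    refine (abs_sub _ _).trans (add_le_add (hGC z) ?_)
    rw [abs_mul, abs_mul, abs_two]
    gcongr
    · exact (abs_nonneg _).trans (hfC z)
    · exact hfC z
    · exact hLC z
  have hD1 : IsDynkinPair (X.P t x) (X.F t) X.X t T₀ f (opL hp B a b f) :=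
    fun r hr T hT hrT W K hW hWK => h.dynkin ht.le hX hDo hK hfs hC2 hf0 hr hT hrT hW hWK
  have hD2 : IsDynkinPair (X.P t x) (X.F t) X.X t T₀ (fun z => f z * f z)
      fun z => 2 * (f z * opL hp B a b f z) + energyDensity hp a f z := by
    rw [← funext hmul]
    exact fun r hr T hT hrT W K hW hWK => h.dynkin ht.le hX hDo hK hfs hg2 hg0 hr hT hrT hW hWK
  -- `itoRemainder` is by definition the `dynkinRemainder` of the pair (f, 𝓛f), so the general
  -- results transfer directly.
  have hsm : ∀ T ∈ Ico t T₀, StronglyMeasurable[X.F t T] (itoRemainder hp X B a b f t T) :=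
    fun T hT => h.stronglyMeasurable_dynkinRemainder hfm hL hT
  refine ⟨fun ω T hT => ⟨h.intervalIntegrable hT hL hLC le_rfl hT.1 ω,
    h.intervalIntegrable hT hΓ hΓC le_rfl hT.1 ω⟩, ⟨fun T => hsm T T.2, fun r T hrT =>
      hD1.condExp_dynkinRemainder h hfm hfC hL hLC r.2 T.2 hrT⟩, fun T hT => ⟨?_, ?_, ?_, ?_⟩⟩
  · exact hD1.integral_dynkinRemainder h hfm hfC hL hLC hT
  · exact MemLp.of_bound ((hsm T hT).mono (h.le T hT)).aestronglyMeasurable _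
      (ae_of_all _ (abs_dynkinRemainder_le hfC hLC hT.1))
  · exact integrable_of_stronglyMeasurable_of_bound (h.le T hT)
      (h.stronglyMeasurable_integral hT hΓ le_rfl hT.1) (abs_integral_path_le hΓC hT.1)
  · simp only [sq_abs]
    exact hD1.integral_sq_dynkinRemainder hD2 h hfm hfC hL hLC hΓ hΓC hT
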